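/- Let $F$ be a $p$-adic field (a nonarchimedean local field of characteristic $0$, of any residual characteristic), with ring of integers $\mathcal O$, maximal ideal $\mathfrak P$, residue field of cardinality $q$, and absolute value normalized so that a generator of $\mathfrak P$ has absolute value $q^{-1}$. For a nontrivial continuous character $\psi : F\to\mathbb C^1$ and $a\in F^*$ let $\psi_a(x)=\psi(ax)$, let $d_\psi x$ be the Haar measure on $F$ that is self-dual with respect to $\psi$, let $\widehat\phi(x)=\int_F\phi(y)\psi(xy)\,d_\psi y$ for $\phi\in S(F)$ (locally constant functions of compact support on $F$), and let $d^*_\psi x=|x|^{-1}d_\psi x$. Let $$\gamma_F(\psi)=\lim_{r\to\infty}\int_{\mathfrak P^{-r}}\psi(x^2)\,d_{\psi_2}x,\qquad \gamma_\psi(a)=\frac{\gamma_F(\psi_a)}{\gamma_F(\psi)}$$ be the unnormalized and the normalized Weil index. For a continuous character $\chi:F^*\to\mathbb C^*$ (not necessarily unitary) let $\gamma(s,\chi,\psi)$ be the Tate $\gamma$-factor, that is, the meromorphic function of $s\in\mathbb C$ such that $$\int_{F^*}\widehat\phi(x)\chi^{-1}(x)|x|^{1-s}\,d^*_\psi x=\gamma(s,\chi,\psi)\int_{F^*}\phi(x)\chi(x)|x|^{s}\,d^*_\psi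 x$$ for all $\phi\in S(F)$ and all $s$ in some vertical strip on which all these integrals converge absolutely. Theorem. For every continuous character $\chi$ of $F^*$ there is a real number $\sigma$ such that for every nontrivial continuous character $\psi$ of $F$ there is an integer $M_0\ge 0$ such that, for all integers $M\ge M_0$ and all $s\in\mathbb C$ with $\mathrm{Re}(s)>\sigma$, the following integral converges absolutely, $\gamma(2s,\chi^2,\psi_2)\neq 0$, and $$\int_{\mathfrak P^{-M}}\gamma_\psi(x)^{-1}\chi(x)|x|^s\psi(x)\,d^*_\psi x=\gamma_F(\psi_{-1})^{-1}\,\chi(-1)\,\gamma(2s,\chi^2,\psi_2)^{-1}\,\gamma\bigl(s+\tfrac12,\chi,\psi\bigr).$$ If $\psi$ is unramified (trivial on $\mathcal O$ and nontrivial on $\mathfrak P^{-1}$), one may take $M_0=\max\{2e+1,m(\chi)\}$, where $e=-\log_q|2|$ and $m(\chi)\ge 0$ is the conductor of $\chi$, the least $m \ge 0$ such that $\chi$ is trivial on $\mathcal O^*\cap(1+\mathfrak P^m)$. -/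

import Mathlib

open MeasureTheory Filter Topology
open scoped NormedField Valued

noncomputable section

namespace LocalGamma

section Field

variable (F : Type*) [NontriviallyNormedField F] [IsUltrametricDist F]

/-- The cardinality `q` of the residue field of `F`. -/
def resCard : ℕ := Nat.card 𝓀[F]

/-- The norm of `F` is the normalized absolute value: a generator of the maximal ideal of the
ring of integers has absolute value `q⁻¹`. -/
def IsNormalizedAbs : Prop :=
  ∀ ϖ : 𝒪[F], Irreducible ϖ → ‖(ϖ : F)‖ = (resCard F : ℝ)⁻¹

/-- The fractional ideal `P ^ n`, for `n : ℤ`, where `P` is the maximal ideal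
(for the normalized absolute value). -/
def primePow (n : ℤ) : Set F := {x : F | ‖x‖ ≤ (resCard F : ℝ) ^ (-n)}

/-- `e = log_q [O : 2 O] = - log_q |2|`. -/
def twoExp : ℝ := -Real.logb (resCard F) ‖(2 : F)‖

variable {F}

/-- The conductor `m(χ)` of a character `χ` of `Fˣ`: the least `m ≥ 0` such that `χ` is trivial
on `O^× ∩ (1 + P ^ m)` (which is `O^×` for `m = 0` and `1 + P ^ m` for `m > 0`). -/
def conductor (χ : Fˣ →ₜ* ℂˣ) : ℕ :=
  sInf {m : ℕ | ∀ u : Fˣ, ‖(u : F)‖ = 1 → (u : F) - 1 ∈ primePow F m → χ u = 1}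

/-- The additive character `ψ` is unramified: it is trivial on `O` and nontrivial on `P⁻¹`. -/
def IsUnramified (ψ : AddChar F Circle) : Prop :=
  (∀ x ∈ primePow F 0, ψ x = 1) ∧ ∃ x ∈ primePow F (-1), ψ x ≠ 1

end Field

variable {F : Type*} [NontriviallyNormedField F]

/-- Schwartz (Bruhat) functions on `F`: locally constant with compact support. -/
def IsSchwartz (φ : F → ℂ) : Prop := IsLocallyConstant φ ∧ HasCompactSupport φ

open Classical in
/-- A character `χ` of `Fˣ`, viewed as a function on `F` (zero at the null set `{0}`). -/
def extendZero (χ : Fˣ →ₜ* ℂˣ) (x : F) : ℂ :=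
  if h : x = 0 then 0 else (χ (Units.mk0 x h) : ℂ)

variable [MeasurableSpace F]

/-- The Fourier transform `x ↦ ∫ φ(y) ψ(xy) dμ(y)`. -/
def fourierWith (ψ : AddChar F Circle) (μ : Measure F) (φ : F → ℂ) (x : F) : ℂ :=
  ∫ y, φ y * (ψ (x * y) : ℂ) ∂μ

/-- `μ` is a self-dual Haar measure with respect to `ψ`: Fourier inversion holds. -/
def IsSelfDual (ψ : AddChar F Circle) (μ : Measure F) : Prop :=
  μ.IsAddHaarMeasure ∧
    ∀ φ : F → ℂ, IsSchwartz φ → ∀ x, fourierWith ψ μ (fourierWith ψ μ φ) x = φ (-x)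

open Classical in
/-- The self-dual measure `d_ψ x` (it exists and is unique if `ψ` is continuous, nontrivial). -/
def selfDualMeasure (ψ : AddChar F Circle) : Measure F :=
  if h : ∃ μ : Measure F, IsSelfDual ψ μ then h.choose else 0

/-- The measure `d*_ψ x = |x|⁻¹ d_ψ x`, a Haar measure on `Fˣ`, as a measure on `F`. -/
def mulMeasure (ψ : AddChar F Circle) : Measure F :=
  (selfDualMeasure ψ).withDensity fun x => ENNReal.ofReal ‖x‖⁻¹

/-- The `ψ`-Fourier transform, for the self-dual measure. -/
def fourier (ψ : AddChar F Circle) (φ : F → ℂ) : F → ℂ :=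
  fourierWith ψ (selfDualMeasure ψ) φ

/-- The integrand `φ(x) |x|^s χ(x)` of the Mellin transform. -/
def mellinIntegrand (s : ℂ) (χ : Fˣ →ₜ* ℂˣ) (φ : F → ℂ) (x : F) : ℂ :=
  φ x * (‖x‖ : ℂ) ^ s * extendZero χ x

/-- The Mellin transform `∫ φ(x) |x|^s χ(x) d*_ψ x` (used where it converges absolutely). -/
def mellinInt (ψ : AddChar F Circle) (s : ℂ) (χ : Fˣ →ₜ* ℂˣ) (φ : F → ℂ) : ℂ :=
  ∫ x, mellinIntegrand s χ φ x ∂(mulMeasure ψ)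

/-- `g` is the Tate `γ`-factor of `χ` and `ψ` as a function of `s`: it is meromorphic on `ℂ`
and, on some vertical strip on which all the Mellin transforms involved converge absolutely, it
satisfies `ζ(1-s, χ⁻¹, φ^) = g(s) ζ(s, χ, φ)` for all Schwartz functions `φ`. By the identity
theorem such a `g` is unique; normal form means that it has no removable singularities
(its value at a pole is `0`). -/
def IsTateGamma (χ : Fˣ →ₜ* ℂˣ) (ψ : AddChar F Circle) (g : ℂ → ℂ) : Prop :=
  MeromorphicNFOn g Set.univ ∧
    ∃ a b : ℝ, a < b ∧ ∀ φ : F → ℂ, IsSchwartz φ → ∀ s : ℂ, a < s.re → s.re < b →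
      Integrable (mellinIntegrand s χ φ) (mulMeasure ψ) ∧
      Integrable (mellinIntegrand (1 - s) χ⁻¹ (fourier ψ φ)) (mulMeasure ψ) ∧
      mellinInt ψ (1 - s) χ⁻¹ (fourier ψ φ) = g s * mellinInt ψ s χ φ

open Classical in
/-- The Tate `γ`-factor `γ(s, χ, ψ)`. -/
def tateGamma (s : ℂ) (χ : Fˣ →ₜ* ℂˣ) (ψ : AddChar F Circle) : ℂ :=
  if h : ∃ g : ℂ → ℂ, IsTateGamma χ ψ g then h.choose s else 0

variable [IsUltrametricDist F]

/-- The unnormalized Weil index `γ_F(ψ)`, the limit of `∫ ψ(x²) dx` over `P⁻ʳ` as `r → ∞`.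
The measure `dx` is self-dual for the pairing `(x, y) ↦ ψ(2xy)` attached to the quadratic
character `x ↦ ψ(x²)`; this makes the Weil index an eighth root of unity. -/
def weilIndex (ψ : AddChar F Circle) : ℂ :=
  limUnder atTop fun r : ℕ =>
    ∫ x in primePow F (-(r : ℤ)), (ψ (x ^ 2) : ℂ) ∂(selfDualMeasure (ψ.mulShift 2))

/-- The normalized Weil index `γ_ψ(a) = γ_F(ψ_a) / γ_F(ψ)`, where `ψ_a(x) = ψ(ax)`. -/
def normWeilIndex (ψ : AddChar F Circle) (a : F) : ℂ :=
  weilIndex (ψ.mulShift a) / weilIndex ψ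

/-- The integrand `γ_ψ(x)⁻¹ χ(x) |x|^s ψ(x)`. -/
def sweetIntegrand (χ : Fˣ →ₜ* ℂˣ) (ψ : AddChar F Circle) (s : ℂ) (x : F) : ℂ :=
  (normWeilIndex ψ x)⁻¹ * extendZero χ x * (‖x‖ : ℂ) ^ s * (ψ x : ℂ)

end LocalGamma

end

noncomputable section

set_option linter.unusedSectionVars false

namespace LocalGamma

/-! ### Fractional ideals and shells of constant valuation. -/

section FieldStructure

variable (F : Type*) [NontriviallyNormedField F] [IsUltrametricDist F] [ProperSpace F]

/-! Let G(s) be the integral of γ_F(ψ_x)⁻¹ χ(x)|x|^s ψ(x) over a large ball, and let Γ(χ, z) be the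
stable value of the integrals of χ(x)|x|^z ψ(x) d*x over growing balls (`gaussInt`). The core is the
product formula Γ(χ, s+1/2) G(s) = const · Γ(χ², 2s), a p-adic evaluation of Salié sums
(`HasCondExp.gaussInt_mul_weilGauss`).

Let Φ be the indicator of 1 + P^m with m large. Replacing x by xb² with b in 1 + P^m changes neither
χ(x)|x|^s nor γ_F(ψ_x), so in G(s) the factor ψ(x) may be averaged to K(x) = ∫ Φ(b) ψ(xb²) db
(`HasCondExp.measure_mul_weilGauss`). Completing the square (`HasCondExp.weil_formula`) gives K(x) =
|2x|^(-1/2) γ_F(ψ_x) H(1/x), where H(v) = ∫ Φ^(w) ψ(-w²v/4) dw. The Weil index cancels, and x ↦ 1/x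
turns G(s) into a Mellin transform of H. Now H is the Fourier transform of the image of Φ^(w) dw
under w ↦ -w²/4, so Tate's functional equation at s+1/2 converts it into ∫ Φ^(w) χ|·|^(s-1/2)(w²/4)
dw (`HasCondExp.quadratic_functional_equation`). This is a Mellin transform of Φ^ for χ² at 2s, and
Tate's equation once more leads back to Φ, whose Mellin transform is a volume. The remaining
constant is what passing from ψ to ψ_2 produces (`HasCondExp.gaussInt_mulShift_two`).

For Re(s) large, Γ(χ, s) γ(s, χ, ψ) = χ(-1) (`HasCondExp.gaussInt_mul_tateGamma`): Γ is the factor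
in Tate's equation, it continues meromorphically as a finite sum plus a geometric series, and
applying the equation twice gives the reflection formula. Nonvanishing of γ(2s, χ², ψ_2) follows
too.

The integral is independent of M because a function invariant under 1 + P^m, integrated against ψ
over elements of valuation below c - m, gives zero, c being the conductor exponent of ψ
(`HasCondExp.integral_shell_eq_zero`). For the Weil index m = 2e+1 works, since 1 + P^(2e+1)
consists of squares of units. Finally γ_F(ψ) γ_F(ψ_{-1}) = 1 accounts for the constant in front. -/

instance compactSpace_integer : CompactSpace 𝒪[F] := by
  have h : IsCompact {x : F | x ∈ 𝒪[F]} := by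
    have : {x : F | x ∈ 𝒪[F]} = Metric.closedBall 0 1 := by
      ext x; simp [Valued.integer.mem_iff]
    rw [this]; exact isCompact_closedBall 0 1
  exact isCompact_iff_compactSpace.mp h

instance rankOne_valued : (Valued.v : Valuation F NNReal).RankOne :=
  inferInstanceAs (Valuation.RankOne (NormedField.valuation (K := F)))

instance isDiscreteValuationRing_integer : IsDiscreteValuationRing 𝒪[F] :=
  (Valued.integer.compactSpace_iff_completeSpace_and_isDiscreteValuationRing_and_finite_residueField.mp
    inferInstance).2.1

instance finite_residueField : Finite 𝓀[F] :=
  (Valued.integer.compactSpace_iff_completeSpace_and_isDiscreteValuationRing_and_finite_residueField.mp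
    inferInstance).2.2

lemma one_lt_resCard : 1 < resCard F := by
  unfold resCard
  have : Nontrivial 𝓀[F] := inferInstanceAs (Nontrivial (IsLocalRing.ResidueField 𝒪[F]))
  exact Finite.one_lt_card

lemma one_lt_resCard_real : (1 : ℝ) < resCard F := by exact_mod_cast one_lt_resCard F

lemma resCard_pos : (0 : ℝ) < resCard F := zero_lt_one.trans (one_lt_resCard_real F)

lemma resCard_ne_zero : (resCard F : ℝ) ≠ 0 := (resCard_pos F).ne'

variable [hF : Fact (IsNormalizedAbs F)]

lemma exists_uniformizer_integer : ∃ ϖ : 𝒪[F], Irreducible ϖ ∧ ‖(ϖ : F)‖ = (resCard F : ℝ)⁻¹ := by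
  obtain ⟨ϖ, h⟩ := IsDiscreteValuationRing.exists_irreducible 𝒪[F]
  exact ⟨ϖ, h, hF.out ϖ h⟩

lemma exists_uniformizer : ∃ ϖ : Fˣ, ‖(ϖ : F)‖ = (resCard F : ℝ)⁻¹ := by
  obtain ⟨ϖ, -, h⟩ := exists_uniformizer_integer F
  have h0 : (ϖ : F) ≠ 0 := by
    rw [← norm_pos_iff, h]; exact inv_pos.mpr (resCard_pos F)
  exact ⟨Units.mk0 _ h0, h⟩

/-- A uniformizer of `F`. -/
def unif : Fˣ := (exists_uniformizer F).choose

lemma norm_unif : ‖(unif F : F)‖ = (resCard F : ℝ)⁻¹ := (exists_uniformizer F).choose_spec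

lemma norm_unif_zpow (n : ℤ) : ‖((unif F ^ n : Fˣ) : F)‖ = (resCard F : ℝ) ^ (-n) := by
  rw [Units.val_zpow_eq_zpow_val, norm_zpow, norm_unif, inv_zpow, zpow_neg]

variable {F}

lemma exists_norm_eq_zpow {x : F} (hx : x ≠ 0) : ∃ n : ℤ, ‖x‖ = (resCard F : ℝ) ^ (-n) := by
  obtain ⟨ϖ, hi, hn⟩ := exists_uniformizer_integer F
  have key : ∀ y : F, y ≠ 0 → ‖y‖ ≤ 1 → ∃ n : ℤ, ‖y‖ = (resCard F : ℝ) ^ (-n) := by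
    intro y hy h1
    have h0 : (⟨y, Valued.integer.mem_iff.mpr h1⟩ : 𝒪[F]) ≠ 0 := by
      intro h; exact hy (congrArg Subtype.val h)
    obtain ⟨n, u, hu⟩ := IsDiscreteValuationRing.eq_unit_mul_pow_irreducible h0 hi
    have hy' : y = ((u : 𝒪[F]) : F) * (ϖ : F) ^ n := by
      have := congrArg Subtype.val hu
      simpa using this
    refine ⟨n, ?_⟩
    rw [hy', norm_mul, norm_pow, Valued.integer.norm_coe_unit, hn, one_mul, zpow_neg, inv_pow,
      zpow_natCast]
  rcases le_total ‖x‖ 1 with h | h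
  · exact key x hx h
  · obtain ⟨n, hn⟩ := key x⁻¹ (inv_ne_zero hx) (by rw [norm_inv]; exact inv_le_one_of_one_le₀ h)
    refine ⟨-n, ?_⟩
    rw [norm_inv] at hn
    rw [← inv_inv ‖x‖, hn, zpow_neg, inv_inv, neg_neg]

lemma mem_primePow {n : ℤ} {x : F} : x ∈ primePow F n ↔ ‖x‖ ≤ (resCard F : ℝ) ^ (-n) := Iff.rfl

variable (F) in
/-- The set of elements of valuation `n`. -/
def shell (n : ℤ) : Set F := {x : F | ‖x‖ = (resCard F : ℝ) ^ (-n)}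

lemma mem_shell {n : ℤ} {x : F} : x ∈ shell F n ↔ ‖x‖ = (resCard F : ℝ) ^ (-n) := Iff.rfl

lemma zpow_resCard_pos (n : ℤ) : (0 : ℝ) < (resCard F : ℝ) ^ n := zpow_pos (resCard_pos F) n

lemma zpow_resCard_le {m n : ℤ} : (resCard F : ℝ) ^ m ≤ (resCard F : ℝ) ^ n ↔ m ≤ n :=
  zpow_le_zpow_iff_right₀ (one_lt_resCard_real F)

lemma zpow_resCard_lt {m n : ℤ} : (resCard F : ℝ) ^ m < (resCard F : ℝ) ^ n ↔ m < n :=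
  zpow_lt_zpow_iff_right₀ (one_lt_resCard_real F)

lemma zpow_resCard_inj {m n : ℤ} : (resCard F : ℝ) ^ m = (resCard F : ℝ) ^ n ↔ m = n :=
  zpow_right_inj₀ (resCard_pos F) (one_lt_resCard_real F).ne'

lemma ne_zero_of_mem_shell {n : ℤ} {x : F} (hx : x ∈ shell F n) : x ≠ 0 := by
  rw [← norm_pos_iff, mem_shell.mp hx]; exact zpow_resCard_pos _

lemma primePow_eq_closedBall (n : ℤ) :
    primePow F n = Metric.closedBall 0 ((resCard F : ℝ) ^ (-n)) := by
  ext x; simp [mem_primePow]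

lemma isOpen_primePow (n : ℤ) : IsOpen (primePow F n) := by
  rw [primePow_eq_closedBall]
  exact IsUltrametricDist.isOpen_closedBall _ (zpow_resCard_pos _).ne'

lemma isCompact_primePow (n : ℤ) : IsCompact (primePow F n) := by
  rw [primePow_eq_closedBall]; exact isCompact_closedBall _ _

lemma isClosed_primePow (n : ℤ) : IsClosed (primePow F n) := (isCompact_primePow n).isClosed

lemma zero_mem_primePow (n : ℤ) : (0 : F) ∈ primePow F n := by
  rw [mem_primePow, norm_zero]; exact (zpow_resCard_pos _).le

lemma add_mem_primePow {n : ℤ} {x y : F} (hx : x ∈ primePow F n) (hy : y ∈ primePow F n) :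
    x + y ∈ primePow F n :=
  (IsUltrametricDist.norm_add_le_max x y).trans (max_le hx hy)

lemma neg_mem_primePow {n : ℤ} {x : F} : -x ∈ primePow F n ↔ x ∈ primePow F n := by
  simp [mem_primePow]

lemma sub_mem_primePow {n : ℤ} {x y : F} (hx : x ∈ primePow F n) (hy : y ∈ primePow F n) :
    x - y ∈ primePow F n := by
  rw [sub_eq_add_neg]; exact add_mem_primePow hx (neg_mem_primePow.mpr hy)

lemma add_mem_primePow_iff {n : ℤ} {x y : F} (hy : y ∈ primePow F n) :
    x + y ∈ primePow F n ↔ x ∈ primePow F n :=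
  ⟨fun h => by simpa using sub_mem_primePow h hy, fun h => add_mem_primePow h hy⟩

lemma mul_mem_primePow {m n : ℤ} {x y : F} (hx : x ∈ primePow F m) (hy : y ∈ primePow F n) :
    x * y ∈ primePow F (m + n) := by
  rw [mem_primePow, norm_mul, neg_add, zpow_add₀ (resCard_ne_zero F)]
  exact mul_le_mul hx hy (norm_nonneg _) (zpow_resCard_pos _).le

lemma primePow_antitone {m n : ℤ} (h : m ≤ n) : primePow F n ⊆ primePow F m := fun _ hx =>
  le_trans hx (zpow_resCard_le.mpr (neg_le_neg h))

lemma norm_lt_zpow_iff {n : ℤ} {x : F} :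
    ‖x‖ < (resCard F : ℝ) ^ (-n) ↔ x ∈ primePow F (n + 1) := by
  rcases eq_or_ne x 0 with rfl | hx
  · simp [zero_mem_primePow, zpow_resCard_pos]
  · obtain ⟨k, hk⟩ := exists_norm_eq_zpow hx
    rw [mem_primePow, hk, zpow_resCard_lt, zpow_resCard_le]; omega

lemma shell_eq_diff (n : ℤ) : shell F n = primePow F n \ primePow F (n + 1) := by
  ext x
  rw [Set.mem_sdiff, ← norm_lt_zpow_iff, mem_primePow, not_lt, mem_shell, le_antisymm_iff]

lemma primePow_eq_union (n : ℤ) : primePow F n = shell F n ∪ primePow F (n + 1) := by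
  rw [shell_eq_diff, Set.sdiff_union_of_subset (primePow_antitone (by omega))]

lemma disjoint_shell_primePow (n : ℤ) : Disjoint (shell F n) (primePow F (n + 1)) := by
  rw [shell_eq_diff]; exact Set.disjoint_sdiff_left

lemma isClosed_shell (n : ℤ) : IsClosed (shell F n) := isClosed_eq continuous_norm continuous_const

lemma isOpen_shell (n : ℤ) : IsOpen (shell F n) := by
  rw [shell_eq_diff]; exact (isOpen_primePow n).sdiff (isClosed_primePow _)

lemma isCompact_shell (n : ℤ) : IsCompact (shell F n) :=
  (isCompact_primePow n).of_isClosed_subset (isClosed_shell n)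
    (by rw [shell_eq_diff]; exact Set.sdiff_subset)

lemma mul_mem_primePow_iff {a : F} {k n : ℤ} (ha : a ∈ shell F k) {x : F} :
    a * x ∈ primePow F (k + n) ↔ x ∈ primePow F n := by
  rw [mem_primePow, norm_mul, mem_shell.mp ha, neg_add, zpow_add₀ (resCard_ne_zero F),
    mul_le_mul_iff_right₀ (zpow_resCard_pos _)]; rfl

lemma mul_mem_shell_iff {a : F} {k n : ℤ} (ha : a ∈ shell F k) {x : F} :
    a * x ∈ shell F (k + n) ↔ x ∈ shell F n := by
  rw [mem_shell, norm_mul, mem_shell.mp ha, neg_add, zpow_add₀ (resCard_ne_zero F),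
    mul_right_inj' (zpow_resCard_pos _).ne']; rfl

lemma add_mem_shell {n : ℤ} {x v : F} (hx : x ∈ shell F n) (hv : v ∈ primePow F (n + 1)) :
    x + v ∈ shell F n := by
  rw [shell_eq_diff] at hx ⊢
  refine ⟨add_mem_primePow hx.1 (primePow_antitone (by omega) hv), fun h => hx.2 ?_⟩
  exact (add_mem_primePow_iff hv).mp h

lemma exists_mem_shell (x : F) (hx : x ≠ 0) : ∃ n : ℤ, x ∈ shell F n := exists_norm_eq_zpow hx

variable (F) in
lemma unif_zpow_mem_shell (n : ℤ) : ((unif F ^ n : Fˣ) : F) ∈ shell F n := norm_unif_zpow F n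

variable (F) in
lemma exists_closedBall_subset_primePow (r : ℝ) :
    ∃ n : ℤ, ∀ m ≤ n, Metric.closedBall (0 : F) r ⊆ primePow F m := by
  obtain ⟨n, hn⟩ := pow_unbounded_of_one_lt r (one_lt_resCard_real F)
  refine ⟨-n, fun m hm x hx => primePow_antitone hm ?_⟩
  rw [mem_primePow, neg_neg, zpow_natCast]
  exact (mem_closedBall_zero_iff.mp hx).trans hn.le

variable (F) in
lemma exists_primePow_subset_ball {ε : ℝ} (hε : 0 < ε) :
    ∃ n : ℕ, ∀ m : ℤ, n ≤ m → primePow F m ⊆ Metric.ball (0 : F) ε := by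
  obtain ⟨n, hn⟩ := exists_pow_lt_of_lt_one hε (inv_lt_one_of_one_lt₀ (one_lt_resCard_real F))
  refine ⟨n, fun m hm x hx => ?_⟩
  rw [mem_ball_zero_iff]
  refine (primePow_antitone hm hx).trans_lt ?_
  rwa [zpow_neg, zpow_natCast, ← inv_pow]

lemma exists_primePow_subset_of_mem_nhds {U : Set F} (hU : U ∈ 𝓝 (0 : F)) :
    ∃ n : ℕ, ∀ m : ℤ, n ≤ m → primePow F m ⊆ U := by
  obtain ⟨ε, hε, h⟩ := Metric.mem_nhds_iff.mp hU
  obtain ⟨n, hn⟩ := exists_primePow_subset_ball F hε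
  exact ⟨n, fun m hm => (hn m hm).trans h⟩

lemma exists_subset_primePow_of_isCompact {K : Set F} (hK : IsCompact K) :
    ∃ n : ℤ, ∀ m ≤ n, K ⊆ primePow F m := by
  obtain ⟨r, hr⟩ := hK.isBounded.subset_closedBall 0
  obtain ⟨n, hn⟩ := exists_closedBall_subset_primePow F r
  exact ⟨n, fun m hm => hr.trans (hn m hm)⟩

end FieldStructure

/-! ### Scaling of additive Haar measure. -/

section HaarScaling

variable {F : Type*} [NontriviallyNormedField F] [IsUltrametricDist F] [ProperSpace F]
  [hF : Fact (IsNormalizedAbs F)] [MeasurableSpace F] [BorelSpace F]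
  (μ : Measure F) [μ.IsAddHaarMeasure]

lemma measurableSet_primePow (n : ℤ) : MeasurableSet (primePow F n) :=
  (isOpen_primePow n).measurableSet

lemma measurableSet_shell (n : ℤ) : MeasurableSet (shell F n) := (isOpen_shell n).measurableSet

lemma measure_primePow_lt_top (n : ℤ) : μ (primePow F n) < ⊤ := (isCompact_primePow n).measure_lt_top

lemma measure_primePow_pos (n : ℤ) : 0 < μ (primePow F n) :=
  (isOpen_primePow n).measure_pos μ ⟨0, zero_mem_primePow n⟩

/-- The residue classes cut the ring of integers into q translates of the maximal ideal. -/
lemma measure_primePow_zero : μ (primePow F 0) = resCard F * μ (primePow F 1) := by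
  obtain ⟨lift, hlift⟩ := (Ideal.Quotient.mk_surjective
    (I := IsLocalRing.maximalIdeal 𝒪[F])).hasRightInverse
  let res : 𝒪[F] → 𝓀[F] := IsLocalRing.residue 𝒪[F]
  let lift' : 𝓀[F] → 𝒪[F] := lift
  have hl : ∀ a, res (lift' a) = a := hlift
  have hres : ∀ x y : 𝒪[F], res x = res y ↔ ((x : F) - y) ∈ primePow F 1 := by
    intro x y
    have h1 : res x = res y ↔ x - y ∈ IsLocalRing.maximalIdeal 𝒪[F] := Ideal.Quotient.eq
    rw [h1, IsLocalRing.mem_maximalIdeal, mem_nonunits_iff, Valued.integer.isUnit_iff_norm_eq_one]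
    have h2 : ‖((x : F) - y)‖ < 1 ↔ ((x : F) - y) ∈ primePow F 1 := by
      simpa using norm_lt_zpow_iff (n := 0) (x := (x : F) - y)
    rw [← h2]
    have h3 : ‖x - y‖ = ‖((x : F) - y)‖ := rfl
    have h4 := Valued.integer.norm_le_one (x - y)
    rw [← h3]
    exact ⟨fun h => lt_of_le_of_ne h4 h, fun h => h.ne⟩
  have hun : primePow F 0 = ⋃ a : 𝓀[F], (fun x => x + -((lift' a : 𝒪[F]) : F)) ⁻¹' primePow F 1 := by
    ext x
    simp only [Set.mem_iUnion, Set.mem_preimage]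
    constructor
    · intro hx
      have hx' : x ∈ 𝒪[F] := by
        rw [Valued.integer.mem_iff]; simpa [mem_primePow] using hx
      exact ⟨res ⟨x, hx'⟩, by
        have := (hres ⟨x, hx'⟩ (lift' (res ⟨x, hx'⟩))).mp (hl _).symm
        simpa [sub_eq_add_neg] using this⟩
    · rintro ⟨a, ha⟩
      have h1 : ((lift' a : 𝒪[F]) : F) ∈ primePow F 0 := by
        simpa [mem_primePow] using Valued.integer.norm_le_one (lift' a)
      have := add_mem_primePow (primePow_antitone (by norm_num) ha) h1
      simpa using this
  have hdisj : Pairwise (Function.onFun Disjoint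
      (fun a : 𝓀[F] => (fun x : F => x + -((lift' a : 𝒪[F]) : F)) ⁻¹' primePow F 1)) := by
    intro a b hab
    refine Set.disjoint_left.mpr fun x hxa hxb => hab ?_
    have := sub_mem_primePow hxb hxa
    rw [← hl a, ← hl b, hres]
    simpa [sub_eq_add_neg, add_comm] using this
  rw [hun, measure_iUnion hdisj fun a => (measurable_add_const _) (measurableSet_primePow 1)]
  simp_rw [measure_preimage_add_right]
  have : Fintype 𝓀[F] := Fintype.ofFinite _
  rw [tsum_fintype, Finset.sum_const, Finset.card_univ, nsmul_eq_mul, resCard, Nat.card_eq_fintype_card]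

open scoped Pointwise in
lemma smul_primePow (a : Fˣ) {k : ℤ} (ha : (a : F) ∈ shell F k) (n : ℤ) :
    a • primePow F n = primePow F (k + n) := by
  ext x
  rw [Set.mem_smul_set_iff_inv_smul_mem, ← mul_mem_primePow_iff ha]
  simp [Units.smul_def]

open scoped Pointwise in
-- A unit preserves O, so its modulus is 1; a uniformizer carries O onto P, which has index q;
-- together these generate the multiplicative group.
lemma distribHaarChar_eq_nnnorm (a : Fˣ) : distribHaarChar F a = ‖(a : F)‖₊ := by
  have unit_case : ∀ u : Fˣ, ‖(u : F)‖ = 1 → distribHaarChar F u = 1 := fun u hu => by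
    apply distribHaarChar_eq_of_measure_smul_eq_mul (μ := Measure.addHaar)
      (measure_primePow_pos _ 0).ne' (measure_primePow_lt_top _ 0).ne
    rw [smul_primePow u (k := 0) (by simpa [mem_shell] using hu)]
    simp
  have hunif : distribHaarChar F (unif F) = ‖(unif F : F)‖₊ := by
    apply distribHaarChar_eq_of_measure_smul_eq_mul (μ := Measure.addHaar)
      (measure_primePow_pos _ 0).ne' (measure_primePow_lt_top _ 0).ne
    have h1 := unif_zpow_mem_shell F 1
    rw [zpow_one] at h1
    rw [smul_primePow _ h1, measure_primePow_zero, ← mul_assoc, add_zero]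
    have h2 : ((‖(unif F : F)‖₊ : NNReal) : ENNReal) * (resCard F : ENNReal) = 1 := by
      have : ‖(unif F : F)‖₊ = (resCard F : NNReal)⁻¹ := by
        ext; simpa using norm_unif F
      rw [this, ← ENNReal.coe_natCast, ← ENNReal.coe_mul, inv_mul_cancel₀, ENNReal.coe_one]
      exact_mod_cast (one_lt_resCard F).ne_bot
    rw [h2, one_mul]
  obtain ⟨n, hn⟩ := exists_norm_eq_zpow a.ne_zero
  have ha : a = unif F ^ n * (unif F ^ (-n) * a) := by rw [← mul_assoc, ← zpow_add]; simp
  have hu : ‖((unif F ^ (-n) * a : Fˣ) : F)‖ = 1 := by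
    rw [Units.val_mul, norm_mul, norm_unif_zpow, hn, ← zpow_add₀ (resCard_ne_zero F)]; simp
  have : distribHaarChar F a = ‖(unif F : F)‖₊ ^ n := by
    conv_lhs => rw [ha]
    rw [map_mul, unit_case _ hu, mul_one, map_zpow, hunif]
  rw [this]
  ext
  rw [NNReal.coe_zpow, coe_nnnorm, coe_nnnorm, hn, norm_unif, inv_zpow, zpow_neg]

open scoped Pointwise in
lemma map_mul_left_haar {a : F} (ha : a ≠ 0) :
    μ.map (a * ·) = ENNReal.ofReal ‖a‖⁻¹ • μ := by
  ext s hs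
  rw [Measure.map_apply (measurable_const_mul a) hs, Measure.smul_apply]
  have h : (a * ·) ⁻¹' s = (Units.mk0 a ha)⁻¹ • s := by
    ext x
    rw [Set.mem_smul_set_iff_inv_smul_mem]
    simp [Units.smul_def]
  rw [h, ← distribHaarChar_mul, distribHaarChar_eq_nnnorm]
  simp [ENNReal.ofReal]
  congr 1
  rw [← nnnorm_inv, ← norm_inv, norm_toNNReal]

lemma integral_comp_mul_left {a : F} (ha : a ≠ 0) (f : F → ℂ) :
    ∫ x, f (a * x) ∂μ = (‖a‖⁻¹ : ℝ) * ∫ x, f x ∂μ := by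
  have h := (Homeomorph.mulLeft₀ a ha).measurableEmbedding.integral_map (μ := μ) f
  have h2 : μ.map (Homeomorph.mulLeft₀ a ha) = ENNReal.ofReal ‖a‖⁻¹ • μ := map_mul_left_haar μ ha
  rw [h2, integral_smul_measure, ENNReal.toReal_ofReal (by positivity)] at h
  rw [← Complex.real_smul]
  exact h.symm

lemma measureReal_primePow (n : ℤ) :
    μ.real (primePow F n) = (resCard F : ℝ) ^ (-n) * μ.real (primePow F 0) := by
  have h := map_mul_left_haar μ (unif F ^ (-n)).ne_zero
  have h2 := congrArg (fun ν => ν (primePow F 0)) h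
  simp only [Measure.smul_apply, smul_eq_mul] at h2
  rw [Measure.map_apply (measurable_const_mul _) (measurableSet_primePow 0)] at h2
  have h3 : (((unif F ^ (-n) : Fˣ) : F) * ·) ⁻¹' primePow F 0 = primePow F n := by
    ext x
    have := mul_mem_primePow_iff (unif_zpow_mem_shell F (-n)) (x := x) (n := n)
    rw [neg_add_cancel] at this
    exact this
  rw [h3, norm_unif_zpow] at h2
  rw [Measure.real, h2, ENNReal.toReal_mul, ENNReal.toReal_ofReal (by positivity), Measure.real,
    ← zpow_neg, neg_neg]

lemma measureReal_primePow_pos (n : ℤ) : 0 < μ.real (primePow F n) :=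
  ENNReal.toReal_pos (measure_primePow_pos μ n).ne' (measure_primePow_lt_top μ n).ne

end HaarScaling

/-! ### Multiplicative Haar measure on the field. -/

section MulHaar

variable {F : Type*} [NontriviallyNormedField F] [IsUltrametricDist F] [ProperSpace F]
  [hF : Fact (IsNormalizedAbs F)] [MeasurableSpace F] [BorelSpace F]
  (μ : Measure F) [μ.IsAddHaarMeasure]

/-- The multiplicative Haar measure `|x|⁻¹ dμ(x)` on `Fˣ`, seen as a measure on `F`. -/
def mulHaar (μ : Measure F) : Measure F := μ.withDensity fun x => ENNReal.ofReal ‖x‖⁻¹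

lemma measurable_density : Measurable fun x : F => ENNReal.ofReal ‖x‖⁻¹ :=
  measurable_norm.inv.ennreal_ofReal

instance sFinite_mulHaar : SFinite (mulHaar μ) := by unfold mulHaar; infer_instance

lemma lintegral_mulHaar {f : F → ENNReal} (hf : Measurable f) :
    ∫⁻ x, f x ∂(mulHaar μ) = ∫⁻ x, ENNReal.ofReal ‖x‖⁻¹ * f x ∂μ := by
  rw [mulHaar, lintegral_withDensity_eq_lintegral_mul _ measurable_density hf]; rfl

lemma integral_mulHaar (f : F → ℂ) :
    ∫ x, f x ∂(mulHaar μ) = ∫ x, (‖x‖⁻¹ : ℝ) * f x ∂μ := by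
  rw [mulHaar, integral_withDensity_eq_integral_toReal_smul measurable_density (by simp)]
  refine integral_congr_ae (Eventually.of_forall fun x => ?_)
  simp only
  rw [ENNReal.toReal_ofReal (by positivity), Complex.real_smul]

lemma mulHaar_smul (c : ENNReal) : mulHaar (c • μ) = c • mulHaar μ := by
  unfold mulHaar; rw [withDensity_smul_measure]

lemma mulHaar_singleton_zero : mulHaar μ {0} = 0 := by
  rw [mulHaar, withDensity_apply _ (measurableSet_singleton 0)]
  simp

lemma ae_mulHaar_ne_zero : ∀ᵐ x ∂(mulHaar μ), x ≠ 0 := by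
  rw [ae_iff]; simpa using mulHaar_singleton_zero μ

lemma ae_haar_ne_zero : ∀ᵐ x ∂μ, x ≠ 0 := by
  rw [ae_iff]; simp

lemma measurePreserving_mul_left {a : F} (ha : a ≠ 0) :
    MeasurePreserving (a * ·) (mulHaar μ) (mulHaar μ) := by
  refine ⟨measurable_const_mul a, ?_⟩
  refine Measure.ext_of_lintegral _ fun f hf => ?_
  rw [lintegral_map hf (measurable_const_mul a),
    lintegral_mulHaar (f := fun x => f (a * x)) μ (hf.comp (measurable_const_mul a)),
    lintegral_mulHaar μ hf]
  have h2 : μ = ENNReal.ofReal ‖a‖ • μ.map (a * ·) := by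
    rw [map_mul_left_haar μ ha, smul_smul, ← ENNReal.ofReal_mul (norm_nonneg a),
      mul_inv_cancel₀ (norm_ne_zero_iff.mpr ha)]
    simp
  conv_rhs => rw [h2]
  rw [lintegral_smul_measure, lintegral_map (f := fun x => ENNReal.ofReal ‖x‖⁻¹ * f x)
    (measurable_density.mul hf) (measurable_const_mul a), smul_eq_mul, ← lintegral_const_mul _ (by fun_prop)]
  refine lintegral_congr fun x => ?_
  rw [← mul_assoc, ← ENNReal.ofReal_mul (norm_nonneg a), norm_mul, mul_inv, ← mul_assoc,
    mul_inv_cancel₀ (norm_ne_zero_iff.mpr ha), one_mul]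

lemma measurableEmbedding_mul_left {a : F} (ha : a ≠ 0) : MeasurableEmbedding (a * · : F → F) :=
  (Homeomorph.mulLeft₀ a ha).measurableEmbedding

lemma mulHaar_shell (n : ℤ) : mulHaar μ (shell F n) = mulHaar μ (shell F 0) := by
  have h := (measurePreserving_mul_left μ (unif F ^ n).ne_zero).measure_preimage
    (measurableSet_shell n).nullMeasurableSet
  rw [← h]
  congr 1
  ext x
  simpa using mul_mem_shell_iff (unif_zpow_mem_shell F n) (x := x) (n := 0)

lemma mulHaar_shell_zero : mulHaar μ (shell F 0) = μ (shell F 0) := by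
  rw [mulHaar, withDensity_apply _ (measurableSet_shell 0), setLIntegral_congr_fun (g := fun _ => 1)
    (measurableSet_shell 0)]
  · simp
  · intro x hx
    have : ‖x‖ = 1 := by simpa [mem_shell] using hx
    simp [this]

lemma mulHaar_shell_pos (n : ℤ) : 0 < mulHaar μ (shell F n) := by
  rw [mulHaar_shell, mulHaar_shell_zero]
  exact (isOpen_shell 0).measure_pos μ ⟨1, by simp [mem_shell]⟩

lemma mulHaar_shell_lt_top (n : ℤ) : mulHaar μ (shell F n) < ⊤ := by
  rw [mulHaar_shell, mulHaar_shell_zero]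
  exact (isCompact_shell 0).measure_lt_top

/-- Evaluate the double integral of f(x) g(x y⁻¹) in both orders, using only invariance under
multiplication; the auxiliary f has finite nonzero mass, which can be cancelled. -/
lemma lintegral_comp_inv_mulHaar {g : F → ENNReal} (hg : Measurable g) :
    ∫⁻ x, g x⁻¹ ∂(mulHaar μ) = ∫⁻ x, g x ∂(mulHaar μ) := by
  set ν := mulHaar μ
  let f : F → ENNReal := (shell F 0).indicator 1
  have hf : Measurable f := measurable_one.indicator (measurableSet_shell 0)
  have hf1 : ∫⁻ x, f x ∂ν = ν (shell F 0) := by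
    simp only [f]
    rw [lintegral_indicator_one (measurableSet_shell 0)]
  have inv : ∀ (h : F → ENNReal), Measurable h → ∀ a : F, a ≠ 0 →
      ∫⁻ x, h (a * x) ∂ν = ∫⁻ x, h x ∂ν := fun h hh a ha =>
    (measurePreserving_mul_left μ ha).lintegral_comp hh
  have e : (∫⁻ x, f x ∂ν) * ∫⁻ y, g y⁻¹ ∂ν = (∫⁻ x, f x ∂ν) * ∫⁻ y, g y ∂ν := by
    calc (∫⁻ x, f x ∂ν) * ∫⁻ y, g y⁻¹ ∂ν
        = ∫⁻ x, f x * ∫⁻ y, g y⁻¹ ∂ν ∂ν := (lintegral_mul_const _ hf).symm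
      _ = ∫⁻ x, ∫⁻ y, f x * g (x * y⁻¹) ∂ν ∂ν := by
          refine lintegral_congr_ae ((ae_mulHaar_ne_zero μ).mono fun x hx => ?_)
          simp only
          rw [← inv (fun y => g y⁻¹) (hg.comp measurable_inv) x⁻¹ (inv_ne_zero hx),
            ← lintegral_const_mul _ (by fun_prop)]
          simp [mul_comm]
      _ = ∫⁻ y, ∫⁻ x, f x * g (x * y⁻¹) ∂ν ∂ν := lintegral_lintegral_swap (by fun_prop)
      _ = ∫⁻ y, ∫⁻ x, f (y * x) * g x ∂ν ∂ν := by
          refine lintegral_congr_ae ((ae_mulHaar_ne_zero μ).mono fun y hy => ?_)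
          simp only
          rw [← inv (fun x => f x * g (x * y⁻¹)) (by fun_prop) y hy]
          refine lintegral_congr fun x => ?_
          rw [mul_comm y x, mul_assoc x, mul_inv_cancel₀ hy, mul_one]
      _ = ∫⁻ x, ∫⁻ y, f (y * x) * g x ∂ν ∂ν := lintegral_lintegral_swap (by fun_prop)
      _ = ∫⁻ x, (∫⁻ y, f y ∂ν) * g x ∂ν := by
          refine lintegral_congr_ae ((ae_mulHaar_ne_zero μ).mono fun x hx => ?_)
          simp only
          rw [← inv f hf x hx, ← lintegral_mul_const _ (by fun_prop)]
          simp [mul_comm]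
      _ = _ := lintegral_const_mul _ hg
  rw [hf1] at e
  exact (ENNReal.mul_right_inj (mulHaar_shell_pos μ 0).ne' (mulHaar_shell_lt_top μ 0).ne).mp e

lemma measurePreserving_inv : MeasurePreserving (fun x : F => x⁻¹) (mulHaar μ) (mulHaar μ) := by
  refine ⟨measurable_inv, Measure.ext_of_lintegral _ fun f hf => ?_⟩
  rw [lintegral_map hf measurable_inv, lintegral_comp_inv_mulHaar μ hf]

lemma measurableEmbedding_inv : MeasurableEmbedding (fun x : F => x⁻¹) :=
  (MeasurableEquiv.inv F).measurableEmbedding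

lemma primePow_diff_zero (n : ℤ) : primePow F n \ {0} = ⋃ k : ℕ, shell F (n + k) := by
  ext x
  simp only [Set.mem_sdiff, Set.mem_singleton_iff, Set.mem_iUnion, mem_primePow, mem_shell]
  constructor
  · rintro ⟨h, h0⟩
    obtain ⟨m, hm⟩ := exists_norm_eq_zpow h0
    rw [hm, zpow_resCard_le] at h
    exact ⟨(m - n).toNat, by rw [hm, Int.toNat_of_nonneg (by omega)]; congr 1; ring⟩
  · rintro ⟨k, hk⟩
    exact ⟨by rw [hk, zpow_resCard_le]; omega, ne_zero_of_mem_shell (mem_shell.mpr hk)⟩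

lemma pairwise_disjoint_shell (n : ℤ) :
    Pairwise (Function.onFun Disjoint fun k : ℕ => shell F (n + k)) := by
  intro i j hij
  refine Set.disjoint_left.mpr fun x hi hj => hij ?_
  rw [mem_shell] at hi hj
  have := hi.symm.trans hj
  rw [zpow_resCard_inj] at this
  omega

lemma lintegral_rpow_primePow (n : ℤ) (σ : ℝ) :
    ∫⁻ x in primePow F n, ENNReal.ofReal (‖x‖ ^ σ) ∂(mulHaar μ) =
      ∑' k : ℕ, ENNReal.ofReal (((resCard F : ℝ) ^ (-σ * n)) * ((resCard F : ℝ) ^ (-σ)) ^ k) *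
        mulHaar μ (shell F 0) := by
  have h1 : ∫⁻ x in primePow F n, ENNReal.ofReal (‖x‖ ^ σ) ∂(mulHaar μ) =
      ∫⁻ x in primePow F n \ {0}, ENNReal.ofReal (‖x‖ ^ σ) ∂(mulHaar μ) :=
    (setLIntegral_congr (sdiff_null_ae_eq_self (mulHaar_singleton_zero μ))).symm
  rw [h1, primePow_diff_zero, lintegral_iUnion (fun k => measurableSet_shell _)
    (pairwise_disjoint_shell n)]
  congr 1
  ext k
  rw [setLIntegral_congr_fun (g := fun _ => ENNReal.ofReal
    (((resCard F : ℝ) ^ (-σ * n)) * ((resCard F : ℝ) ^ (-σ)) ^ k)) (measurableSet_shell _)]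
  · rw [lintegral_const, Measure.restrict_apply_univ, mulHaar_shell]
  · intro x hx
    simp only
    rw [mem_shell.mp hx, ← Real.rpow_natCast, ← Real.rpow_mul (resCard_pos F).le,
      ← Real.rpow_add (resCard_pos F), ← Real.rpow_intCast, ← Real.rpow_mul (resCard_pos F).le]
    congr 2
    push_cast; ring

/-- All shells have the same finite positive mass, so this is convergence of a geometric series.
Divergence for σ ≤ 0 matters as well: it locates the strip in the uniqueness of the γ-factor. -/
lemma integrableOn_rpow_iff (n : ℤ) (σ : ℝ) :
    IntegrableOn (fun x : F => ‖x‖ ^ σ) (primePow F n) (mulHaar μ) ↔ 0 < σ := by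
  have hq := one_lt_resCard_real F
  have hr : 0 < (resCard F : ℝ) ^ (-σ) := Real.rpow_pos_of_pos (resCard_pos F) _
  have hr2 : 0 < (resCard F : ℝ) ^ (-σ * n) := Real.rpow_pos_of_pos (resCard_pos F) _
  have key : ∫⁻ x in primePow F n, ENNReal.ofReal (‖x‖ ^ σ) ∂(mulHaar μ) < ⊤ ↔ 0 < σ := by
    rw [lintegral_rpow_primePow, ENNReal.tsum_mul_right]
    constructor
    · intro h
      by_contra! hσ
      have h1 : (1 : ℝ) ≤ (resCard F : ℝ) ^ (-σ) := Real.one_le_rpow hq.le (by linarith)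
      refine h.ne (ENNReal.mul_eq_top.mpr (Or.inr ⟨?_, (mulHaar_shell_pos μ 0).ne'⟩))
      refine top_le_iff.mp ?_
      calc (⊤ : ENNReal) = ∑' k : ℕ, ENNReal.ofReal ((resCard F : ℝ) ^ (-σ * n)) :=
            (ENNReal.tsum_const_eq_top_of_ne_zero (by simpa using hr2)).symm
        _ ≤ _ := ENNReal.tsum_le_tsum fun k => ENNReal.ofReal_le_ofReal
            (le_mul_of_one_le_right hr2.le (one_le_pow₀ h1))
    · intro hσ
      have h1 : (resCard F : ℝ) ^ (-σ) < 1 := Real.rpow_lt_one_of_one_lt_of_neg hq (by linarith)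
      refine ENNReal.mul_lt_top ?_ (mulHaar_shell_lt_top μ 0)
      rw [← ENNReal.ofReal_tsum_of_nonneg (fun k => by positivity)
        ((summable_geometric_of_lt_one hr.le h1).mul_left _)]
      exact ENNReal.ofReal_lt_top
  rw [← key, IntegrableOn, Integrable, hasFiniteIntegral_iff_norm]
  have hm : AEStronglyMeasurable (fun x : F => ‖x‖ ^ σ) ((mulHaar μ).restrict (primePow F n)) :=
    (measurable_norm.pow_const σ).aestronglyMeasurable
  simp only [hm, true_and]
  simp_rw [Real.norm_of_nonneg (Real.rpow_nonneg (norm_nonneg _) σ)]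

end MulHaar

/-! ### Quasi-characters: conductor, real exponent, twists by powers of the norm. -/

section Characters

variable {F : Type*} [NontriviallyNormedField F] [IsUltrametricDist F] [ProperSpace F]
  [hF : Fact (IsNormalizedAbs F)]

/-- There are no small subgroups near 1: while the powers stay within 1/2 of 1, each squaring
multiplies the distance to 1 by at least 3/2. This yields conductors for both multiplicative and
additive characters. -/
lemma eq_one_of_norm_pow_sub_one_le {z : ℂ} (h : ∀ n : ℕ, ‖z ^ n - 1‖ ≤ 1 / 2) : z = 1 := by
  by_contra hz
  have h0 : 0 < ‖z - 1‖ := norm_pos_iff.mpr (sub_ne_zero.mpr hz)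
  have step : ∀ k : ℕ, (3 / 2 : ℝ) ^ k * ‖z - 1‖ ≤ ‖z ^ (2 ^ k) - 1‖ := by
    intro k
    induction k with
    | zero => simp
    | succ k ih =>
      have e : z ^ (2 ^ (k + 1)) - 1 = (z ^ (2 ^ k) - 1) * (2 + (z ^ (2 ^ k) - 1)) := by ring
      have h1 : (3 / 2 : ℝ) ≤ ‖2 + (z ^ (2 ^ k) - 1)‖ := by
        have := norm_sub_le_norm_add (2 : ℂ) (z ^ (2 ^ k) - 1)
        have h2 := h (2 ^ k)
        have h3 : ‖(2 : ℂ)‖ = 2 := by simp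
        linarith
      rw [e, norm_mul, pow_succ]
      nlinarith [norm_nonneg (z ^ (2 ^ k) - 1)]
  obtain ⟨k, hk⟩ := pow_unbounded_of_one_lt (1 / ‖z - 1‖) (by norm_num : (1 : ℝ) < 3 / 2)
  rw [div_lt_iff₀ h0] at hk
  linarith [step k, h (2 ^ k)]

/-- The elements `u` with `|u| = 1` and `u - 1 ∈ P ^ m`. -/
def IsCongrOne (m : ℤ) (u : F) : Prop := ‖u‖ = 1 ∧ u - 1 ∈ primePow F m

lemma IsCongrOne.mul {m : ℤ} {u v : F} (hu : IsCongrOne m u) (hv : IsCongrOne m v) :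
    IsCongrOne m (u * v) := by
  refine ⟨by rw [norm_mul, hu.1, hv.1, one_mul], ?_⟩
  have : u * v - 1 = u * (v - 1) + (u - 1) := by ring
  rw [this]
  refine add_mem_primePow ?_ hu.2
  have := mul_mem_primePow (m := 0) (x := u) (by simp [mem_primePow, hu.1]) hv.2
  rwa [zero_add] at this

lemma isCongrOne_one (m : ℤ) : IsCongrOne m (1 : F) := ⟨norm_one, by simp [zero_mem_primePow]⟩

lemma IsCongrOne.pow {m : ℤ} {u : F} (hu : IsCongrOne m u) (n : ℕ) : IsCongrOne m (u ^ n) := by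
  induction n with
  | zero => simpa using isCongrOne_one m
  | succ n ih => rw [pow_succ]; exact ih.mul hu

lemma IsCongrOne.mono {m n : ℤ} {u : F} (hu : IsCongrOne n u) (h : m ≤ n) : IsCongrOne m u :=
  ⟨hu.1, primePow_antitone h hu.2⟩

lemma isCongrOne_one_add {m : ℤ} (hm : 1 ≤ m) {v : F} (hv : v ∈ primePow F m) :
    IsCongrOne m (1 + v) := by
  refine ⟨?_, by simpa using hv⟩
  have := add_mem_shell (n := 0) (x := (1 : F)) (v := v) (by simp [mem_shell])
    (primePow_antitone hm hv)
  simpa [mem_shell] using this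

variable (χ : Fˣ →ₜ* ℂˣ)

lemma exists_conductor : ∃ m : ℕ, ∀ u : Fˣ, IsCongrOne m (u : F) → χ u = 1 := by
  have hcont : Continuous fun u : Fˣ => ((χ u : ℂˣ) : ℂ) :=
    Units.continuous_val.comp χ.continuous_toFun
  have hU : {u : Fˣ | ‖((χ u : ℂˣ) : ℂ) - 1‖ < 1 / 2} ∈ 𝓝 (1 : Fˣ) := by
    refine IsOpen.mem_nhds (isOpen_lt (by fun_prop) continuous_const) ?_
    simp
  rw [Units.isEmbedding_val₀.nhds_eq_comap, mem_comap] at hU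
  obtain ⟨t, ht, hsub⟩ := hU
  have ht' : (fun x : F => 1 + x) ⁻¹' t ∈ 𝓝 (0 : F) :=
    (continuous_const.add continuous_id).continuousAt.preimage_mem_nhds (by simpa using ht)
  obtain ⟨m, hm⟩ := exists_primePow_subset_of_mem_nhds ht'
  refine ⟨m, fun u hu => ?_⟩
  have : ((χ u : ℂˣ) : ℂ) = 1 := by
    refine eq_one_of_norm_pow_sub_one_le fun n => ?_
    have hmem : u ^ n ∈ Units.val ⁻¹' t := by
      have := hm m le_rfl (hu.pow n).2
      simpa using this
    have := hsub hmem
    simp only [Set.mem_ofPred_eq, map_pow, Units.val_pow_eq_pow_val] at this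
    exact this.le
  exact Units.ext this

lemma conductor_spec {u : Fˣ} (hu : IsCongrOne (conductor χ) (u : F)) : χ u = 1 := by
  obtain ⟨m, hm⟩ := exists_conductor χ
  have hne : {m : ℕ | ∀ u : Fˣ, ‖(u : F)‖ = 1 → (u : F) - 1 ∈ primePow F m → χ u = 1}.Nonempty :=
    ⟨m, fun u h1 h2 => hm u ⟨h1, h2⟩⟩
  exact Nat.sInf_mem hne u hu.1 hu.2

/-- The units form a compact group, so the powers of each value and of its inverse stay bounded. -/
lemma norm_char_of_norm_one {u : Fˣ} (hu : ‖(u : F)‖ = 1) : ‖((χ u : ℂˣ) : ℂ)‖ = 1 := by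
  have hcont : Continuous fun u : Fˣ => ((χ u : ℂˣ) : ℂ) :=
    Units.continuous_val.comp χ.continuous_toFun
  have hK : IsCompact {u : Fˣ | ‖(u : F)‖ = 1} := by
    rw [Units.isEmbedding_val₀.isCompact_iff]
    convert isCompact_shell (F := F) 0 using 1
    ext x
    simp only [Set.mem_image, Set.mem_ofPred_eq, mem_shell, neg_zero, zpow_zero]
    constructor
    · rintro ⟨u, hu, rfl⟩; exact hu
    · intro hx
      have h0 : x ≠ 0 := by rw [← norm_pos_iff, hx]; exact one_pos
      exact ⟨Units.mk0 x h0, hx, rfl⟩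
  obtain ⟨C, hC⟩ := hK.exists_bound_of_continuousOn hcont.continuousOn
  have le : ∀ v : Fˣ, ‖(v : F)‖ = 1 → ‖((χ v : ℂˣ) : ℂ)‖ ≤ 1 := by
    intro v hv
    by_contra! h
    obtain ⟨n, hn⟩ := pow_unbounded_of_one_lt C h
    have := hC (v ^ n) (by simp [hv])
    simp only [map_pow, Units.val_pow_eq_pow_val, norm_pow] at this
    linarith
  refine le_antisymm (le u hu) ?_
  have := le u⁻¹ (by simp [hu])
  rw [map_inv, Units.val_inv_eq_inv_val, norm_inv] at this
  exact (inv_le_one₀ (norm_pos_iff.mpr (χ u).ne_zero)).mp this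

/-- The real exponent `ρ` of a quasi-character: `|χ(x)| = |x| ^ ρ`. -/
def charExp : ℝ := -Real.logb (resCard F) ‖((χ (unif F) : ℂˣ) : ℂ)‖

lemma norm_char (x : Fˣ) : ‖((χ x : ℂˣ) : ℂ)‖ = ‖(x : F)‖ ^ charExp χ := by
  obtain ⟨n, hn⟩ := exists_norm_eq_zpow x.ne_zero
  have hx : x = unif F ^ n * (unif F ^ (-n) * x) := by rw [← mul_assoc, ← zpow_add]; simp
  have hu : ‖((unif F ^ (-n) * x : Fˣ) : F)‖ = 1 := by
    rw [Units.val_mul, norm_mul, norm_unif_zpow, hn, ← zpow_add₀ (resCard_ne_zero F)]; simp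
  have h1 : ‖((χ x : ℂˣ) : ℂ)‖ = ‖((χ (unif F) : ℂˣ) : ℂ)‖ ^ n := by
    conv_lhs => rw [hx]
    rw [map_mul, Units.val_mul, norm_mul, norm_char_of_norm_one χ hu, mul_one, map_zpow,
      Units.val_zpow_eq_zpow_val, norm_zpow]
  have hpos : 0 < ‖((χ (unif F) : ℂˣ) : ℂ)‖ := norm_pos_iff.mpr (χ _).ne_zero
  have h2 : ‖((χ (unif F) : ℂˣ) : ℂ)‖ = (resCard F : ℝ) ^ (-charExp χ) := by
    rw [charExp, neg_neg, Real.rpow_logb (resCard_pos F) (one_lt_resCard_real F).ne' hpos]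
  rw [h1, h2, hn, ← Real.rpow_intCast, ← Real.rpow_mul (resCard_pos F).le, ← Real.rpow_intCast,
    ← Real.rpow_mul (resCard_pos F).le]
  congr 1; push_cast; ring

lemma charExp_inv : charExp χ⁻¹ = -charExp χ := by
  have h : (χ⁻¹) (unif F) = (χ (unif F))⁻¹ := rfl
  simp [charExp, h]

lemma charExp_sq : charExp (χ ^ 2) = 2 * charExp χ := by
  have h : (χ ^ 2) (unif F) = (χ (unif F)) ^ 2 := by
    rw [pow_two, pow_two]; rfl
  simp [charExp, h, Real.logb_pow]

/-- The quasi-character `x ↦ |x| ^ z χ(x)`, as a function on `F` vanishing at `0`. -/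
def twist (z : ℂ) (x : F) : ℂ := (‖x‖ : ℂ) ^ z * extendZero χ x

lemma mellinIntegrand_eq (z : ℂ) (φ : F → ℂ) (x : F) :
    mellinIntegrand z χ φ x = φ x * twist χ z x := by rw [mellinIntegrand, twist, mul_assoc]

@[simp] lemma extendZero_zero : extendZero χ (0 : F) = 0 := by simp [extendZero]

lemma extendZero_of_ne {x : F} (hx : x ≠ 0) : extendZero χ x = (χ (Units.mk0 x hx) : ℂ) := by
  simp [extendZero, hx]

@[simp] lemma extendZero_units (x : Fˣ) : extendZero χ (x : F) = (χ x : ℂ) := by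
  rw [extendZero_of_ne χ x.ne_zero]; simp

lemma extendZero_mul (x y : F) : extendZero χ (x * y) = extendZero χ x * extendZero χ y := by
  by_cases hx : x = 0
  · simp [hx]
  by_cases hy : y = 0
  · simp [hy]
  rw [extendZero_of_ne χ hx, extendZero_of_ne χ hy, extendZero_of_ne χ (mul_ne_zero hx hy),
    ← Units.val_mul, ← map_mul, Units.mk0_mul]

@[simp] lemma twist_zero (z : ℂ) : twist χ z (0 : F) = 0 := by simp [twist]

lemma twist_mul (z : ℂ) (x y : F) : twist χ z (x * y) = twist χ z x * twist χ z y := by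
  rw [twist, twist, twist, extendZero_mul, norm_mul, Complex.ofReal_mul,
    Complex.mul_cpow_ofReal_nonneg (norm_nonneg _) (norm_nonneg _)]
  ring

lemma twist_one (z : ℂ) : twist χ z (1 : F) = 1 := by
  have := extendZero_units χ 1
  rw [Units.val_one] at this
  simp [twist, this]

lemma twist_ne_zero (z : ℂ) {x : F} (hx : x ≠ 0) : twist χ z x ≠ 0 := by
  intro h
  have := twist_mul χ z x x⁻¹
  rw [mul_inv_cancel₀ hx, twist_one, h, zero_mul] at this
  exact one_ne_zero this

lemma twist_inv (z : ℂ) (x : F) : twist χ z x⁻¹ = (twist χ z x)⁻¹ := by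
  rcases eq_or_ne x 0 with rfl | hx
  · simp
  · refine eq_inv_of_mul_eq_one_left ?_
    rw [← twist_mul, inv_mul_cancel₀ hx, twist_one]

lemma twist_inv_char (z : ℂ) (x : F) : twist χ⁻¹ z x = twist χ (-z) x⁻¹ := by
  rcases eq_or_ne x 0 with rfl | hx
  · simp
  · have h : (χ⁻¹) (Units.mk0 x hx) = (χ (Units.mk0 x hx))⁻¹ := rfl
    rw [twist_inv, twist, twist, mul_inv, ← Complex.cpow_neg, neg_neg, extendZero_of_ne _ hx,
      extendZero_of_ne _ hx, h]
    simp

lemma twist_add (z w : ℂ) {x : F} : twist χ (z + w) x = (‖x‖ : ℂ) ^ z * twist χ w x := by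
  rcases eq_or_ne x 0 with rfl | hx
  · simp
  · rw [twist, twist, Complex.cpow_add _ _ (by simpa using hx), mul_assoc]

/-- This is where the pair (χ², 2s) comes from: the quasi-character for (χ, s) is evaluated at
squares. -/
lemma twist_sq (z : ℂ) (x : F) : twist (χ ^ 2) (2 * z) x = twist χ z x ^ 2 := by
  rcases eq_or_ne x 0 with rfl | hx
  · simp
  · have h : (χ ^ 2) (Units.mk0 x hx) = (χ (Units.mk0 x hx)) ^ 2 := by
      rw [pow_two, pow_two]; rfl
    rw [twist, twist, extendZero_of_ne _ hx, extendZero_of_ne _ hx, h, mul_pow, Units.val_pow_eq_pow_val,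
      ← Complex.cpow_nat_mul]
    norm_num

lemma norm_twist (z : ℂ) {x : F} (hx : x ≠ 0) : ‖twist χ z x‖ = ‖x‖ ^ (z.re + charExp χ) := by
  have h := norm_char χ (Units.mk0 x hx)
  rw [twist, norm_mul, extendZero_of_ne _ hx, h, Units.val_mk0,
    Complex.norm_cpow_eq_rpow_re_of_pos (norm_pos_iff.mpr hx), Real.rpow_add (norm_pos_iff.mpr hx)]

lemma norm_twist_le (z : ℂ) (x : F) : ‖twist χ z x‖ ≤ ‖x‖ ^ (z.re + charExp χ) := by
  rcases eq_or_ne x 0 with rfl | hx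
  · simp [Real.rpow_nonneg]
  · exact (norm_twist χ z hx).le

lemma twist_congrOne (z : ℂ) {u : F} (hu : IsCongrOne (conductor χ) u) : twist χ z u = 1 := by
  have h0 : u ≠ 0 := by rw [← norm_pos_iff, hu.1]; exact one_pos
  rw [twist, extendZero_of_ne _ h0, conductor_spec χ (u := Units.mk0 u h0) hu, hu.1]
  simp

lemma continuousOn_twist (z : ℂ) : ContinuousOn (twist χ z) {(0 : F)}ᶜ := by
  have h1 : ContinuousOn (fun x : F => (‖x‖ : ℂ) ^ z) {(0 : F)}ᶜ := by
    refine ContinuousOn.cpow_const (by fun_prop) fun x hx => ?_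
    left
    simpa using hx
  refine h1.mul fun x hx => ?_
  have h2 : ContinuousAt (fun u : Fˣ => ((χ u : ℂˣ) : ℂ)) (Units.mk0 x hx) :=
    (Units.continuous_val.comp χ.continuous_toFun).continuousAt
  refine ContinuousAt.continuousWithinAt ?_
  have h3 := (Units.isOpenEmbedding_val (R := F)).continuousAt_iff (g := extendZero χ)
    (x := Units.mk0 x hx)
  refine h3.mp (h2.congr (Eventually.of_forall fun u => ?_))
  simp

lemma measurable_twist [MeasurableSpace F] [BorelSpace F] (z : ℂ) : Measurable (twist χ z) :=
  measurable_of_continuousOn_compl_singleton 0 (continuousOn_twist χ z)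

lemma continuous_twist {z : ℂ} (hz : 0 < z.re + charExp χ) : Continuous (twist χ z) := by
  rw [continuous_iff_continuousAt]
  intro x
  rcases eq_or_ne x 0 with rfl | hx
  · rw [ContinuousAt, twist_zero]
    refine squeeze_zero_norm (norm_twist_le χ z) ?_
    have : ContinuousAt (fun x : F => ‖x‖ ^ (z.re + charExp χ)) 0 :=
      (continuous_norm.rpow_const fun _ => Or.inr hz.le).continuousAt
    simpa [ContinuousAt, Real.zero_rpow hz.ne'] using this
  · exact (continuousOn_twist χ z).continuousAt (isOpen_compl_singleton.mem_nhds hx)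

lemma integrableOn_twist [MeasurableSpace F] [BorelSpace F] (μ : Measure F) [μ.IsAddHaarMeasure]
    (n : ℤ) {z : ℂ} : IntegrableOn (twist χ z) (primePow F n) (mulHaar μ) ↔
      0 < z.re + charExp χ := by
  rw [← integrableOn_rpow_iff μ n, IntegrableOn, IntegrableOn]
  rw [← integrable_norm_iff (measurable_twist χ z).aestronglyMeasurable]
  refine integrable_congr ?_
  exact (ae_restrict_of_ae (ae_mulHaar_ne_zero μ)).mono fun x hx => norm_twist χ z hx

end Characters

lemma indicator_eq_indicator {α β : Type*} {S : Set α} {T : Set β} {f : α → ℂ} {g : β → ℂ} {x : α}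
    {y : β} (h : x ∈ S ↔ y ∈ T) (hfg : x ∈ S → f x = g y) : S.indicator f x = T.indicator g y := by
  by_cases hx : x ∈ S
  · rw [Set.indicator_of_mem hx, Set.indicator_of_mem (h.mp hx), hfg hx]
  · rw [Set.indicator_of_notMem hx, Set.indicator_of_notMem fun hy => hx (h.mpr hy)]

/-! ### Additive characters and their conductor exponent. -/

section AdditiveCharacters

variable {F : Type*} [NontriviallyNormedField F] [IsUltrametricDist F] [ProperSpace F]
  [hF : Fact (IsNormalizedAbs F)]

/-- `c` is the conductor exponent of the additive character `ψ`: `ψ` is trivial on `P ^ c` and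
nontrivial on `P ^ (c - 1)`. -/
def HasCondExp (ψ : AddChar F Circle) (c : ℤ) : Prop :=
  (∀ x ∈ primePow F c, ψ x = 1) ∧ ∃ x ∈ primePow F (c - 1), ψ x ≠ 1

variable {ψ : AddChar F Circle} {c : ℤ}

lemma exists_hasCondExp (hψ : Continuous ψ) (h1 : ψ ≠ 1) : ∃ c, HasCondExp ψ c := by
  have hcont : Continuous fun x : F => (ψ x : ℂ) := by fun_prop
  have hU : {x : F | ‖(ψ x : ℂ) - 1‖ < 1 / 2} ∈ 𝓝 (0 : F) := by
    refine IsOpen.mem_nhds (isOpen_lt (by fun_prop) continuous_const) ?_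
    simp
  obtain ⟨m, hm⟩ := exists_primePow_subset_of_mem_nhds hU
  have htriv : ∀ x ∈ primePow F m, ψ x = 1 := by
    intro x hx
    have : (ψ x : ℂ) = 1 := by
      refine eq_one_of_norm_pow_sub_one_le fun n => ?_
      have hn : n • x ∈ primePow F m := by
        induction n with
        | zero => simpa using zero_mem_primePow (F := F) _
        | succ n ih => rw [succ_nsmul]; exact add_mem_primePow ih hx
      have := hm m le_rfl hn
      simp only [Set.mem_ofPred_eq, AddChar.map_nsmul_eq_pow, Circle.coe_pow] at this
      exact this.le
    exact Circle.ext this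
  obtain ⟨x, hx⟩ : ∃ x, ψ x ≠ 1 := by
    by_contra! h; exact h1 (by ext x; simp [h x])
  have hx0 : x ≠ 0 := by rintro rfl; simp at hx
  obtain ⟨k, hk⟩ := exists_mem_shell x hx0
  obtain ⟨c, hc, hleast⟩ := Int.exists_least_of_bdd (P := fun n => ∀ x ∈ primePow F n, ψ x = 1)
    ⟨k, fun z hz => by
      by_contra! hzk
      exact hx (hz x (primePow_antitone hzk.le (mem_shell.mp hk).le))⟩ ⟨m, htriv⟩
  refine ⟨c, hc, ?_⟩
  by_contra! h
  have := hleast (c - 1) h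
  omega

lemma IsUnramified.hasCondExp (h : IsUnramified ψ) : HasCondExp ψ 0 := by
  -- The two definitions agree on the nose once `0 - 1` reduces to `-1`.
  exact h

lemma HasCondExp.mulShift (hc : HasCondExp ψ c) {a : F} {k : ℤ} (ha : a ∈ shell F k) :
    HasCondExp (ψ.mulShift a) (c - k) := by
  refine ⟨fun x hx => ?_, ?_⟩
  · rw [AddChar.mulShift_apply]
    exact hc.1 _ (by simpa using (mul_mem_primePow_iff ha).mpr hx)
  · obtain ⟨x, hx, h⟩ := hc.2
    have ha0 := ne_zero_of_mem_shell ha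
    refine ⟨a⁻¹ * x, ?_, by rwa [AddChar.mulShift_apply, mul_inv_cancel_left₀ ha0]⟩
    rw [← mul_mem_primePow_iff ha, mul_inv_cancel_left₀ ha0]
    convert hx using 1; ring_nf

lemma HasCondExp.exists_mul_ne_one (hc : HasCondExp ψ c) {n : ℤ} {x : F}
    (hx : x ∉ primePow F (c - n)) : ∃ v ∈ primePow F n, ψ (x * v) ≠ 1 := by
  have hx0 : x ≠ 0 := by rintro rfl; exact hx (zero_mem_primePow _)
  obtain ⟨k, hk⟩ := exists_mem_shell x hx0
  obtain ⟨w, hw, h⟩ := hc.2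
  refine ⟨x⁻¹ * w, ?_, by rwa [mul_inv_cancel_left₀ hx0]⟩
  rw [mem_primePow, mem_shell.mp hk, zpow_resCard_le] at hx
  rw [← mul_mem_primePow_iff hk, mul_inv_cancel_left₀ hx0]
  exact primePow_antitone (by omega) hw

lemma HasCondExp.map_mul_eq_one (hc : HasCondExp ψ c) {n : ℤ} {x y : F}
    (hx : x ∈ primePow F (c - n)) (hy : y ∈ primePow F n) : ψ (x * y) = 1 :=
  hc.1 _ (by simpa using mul_mem_primePow hx hy)

lemma HasCondExp.continuous (hc : HasCondExp ψ c) : Continuous ψ := by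
  rw [continuous_iff_continuousAt]
  intro x
  refine (continuousAt_const (y := ψ x)).congr ?_
  have : (fun y => y - x) ⁻¹' primePow F c ∈ 𝓝 x :=
    (continuous_id.sub continuous_const).continuousAt.preimage_mem_nhds
      ((isOpen_primePow c).mem_nhds (by simp [zero_mem_primePow]))
  filter_upwards [this] with y hy
  have h : y = x + (y - x) := by ring
  rw [h, AddChar.map_add_eq_mul, hc.1 _ hy, mul_one]

lemma coe_map_add (x y : F) : (ψ (x + y) : ℂ) = ψ x * ψ y := by
  rw [AddChar.map_add_eq_mul, Circle.coe_mul]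

lemma coe_ne_one {z : Circle} (h : z ≠ 1) : (z : ℂ) ≠ 1 := fun h' => h (Circle.ext h')

lemma HasCondExp.coe_add_of_mem (hc : HasCondExp ψ c) (x : F) {y : F} (hy : y ∈ primePow F c) :
    (ψ (x + y) : ℂ) = ψ x := by rw [coe_map_add, hc.1 y hy]; simp

end AdditiveCharacters

/-! ### Schwartz functions: uniform level and bounded support. -/

section Schwartz

variable {F : Type*} [NontriviallyNormedField F] [IsUltrametricDist F] [ProperSpace F]
  [hF : Fact (IsNormalizedAbs F)] {φ : F → ℂ}

/-- A Lebesgue number makes local constancy uniform on the compact support. If only x + v lies in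
the support, translate back by -v. -/
lemma IsSchwartz.exists_level (h : IsSchwartz φ) :
    ∃ N : ℤ, ∀ n, N ≤ n → ∀ x, ∀ v ∈ primePow F n, φ (x + v) = φ x := by
  obtain ⟨δ, hδ, H⟩ := lebesgue_number_lemma_of_metric (c := fun z : ℂ => φ ⁻¹' {z}) h.2
    (fun z => h.1.isOpen_fiber z) (fun x _ => Set.mem_iUnion.mpr ⟨φ x, rfl⟩)
  obtain ⟨n, hn⟩ := exists_primePow_subset_ball F hδ
  have key : ∀ x ∈ tsupport φ, ∀ v ∈ primePow F n, φ (x + v) = φ x := by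
    intro x hx v hv
    obtain ⟨z, hz⟩ := H x hx
    have h1 : φ x = z := hz (Metric.mem_ball_self hδ)
    have h2 : φ (x + v) = z := hz (by simpa using hn n le_rfl hv)
    rw [h1, h2]
  refine ⟨n, fun m hm x v hv => ?_⟩
  replace hv := primePow_antitone hm hv
  by_cases hx : x ∈ tsupport φ
  · exact key x hx v hv
  by_cases hy : x + v ∈ tsupport φ
  · have := key _ hy (-v) (neg_mem_primePow.mpr hv)
    rw [add_neg_cancel_right] at this
    exact this.symm
  · rw [image_eq_zero_of_notMem_tsupport hx, image_eq_zero_of_notMem_tsupport hy]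

lemma IsSchwartz.exists_support (h : IsSchwartz φ) :
    ∃ N : ℤ, ∀ n ≤ N, ∀ x, x ∉ primePow F n → φ x = 0 := by
  obtain ⟨N, hN⟩ := exists_subset_primePow_of_isCompact h.2
  exact ⟨N, fun n hn x hx => image_eq_zero_of_notMem_tsupport fun h => hx (hN n hn h)⟩

lemma isSchwartz_of_level_support {n m : ℤ} (hn : ∀ x, ∀ v ∈ primePow F n, φ (x + v) = φ x)
    (hm : ∀ x, x ∉ primePow F m → φ x = 0) : IsSchwartz φ := by
  refine ⟨(IsLocallyConstant.iff_eventually_eq φ).mpr fun x => ?_, ?_⟩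
  · have : (fun y => y - x) ⁻¹' primePow F n ∈ 𝓝 x :=
      (continuous_id.sub continuous_const).continuousAt.preimage_mem_nhds
        ((isOpen_primePow n).mem_nhds (by simp [zero_mem_primePow]))
    filter_upwards [this] with y hy
    have := hn x (y - x) hy
    rwa [add_sub_cancel] at this
  · exact HasCompactSupport.intro (isCompact_primePow m) hm

lemma IsSchwartz.continuous (h : IsSchwartz φ) : Continuous φ := h.1.continuous

lemma IsSchwartz.exists_bound (h : IsSchwartz φ) : ∃ C, 0 ≤ C ∧ ∀ x, ‖φ x‖ ≤ C := by
  obtain ⟨C, hC⟩ := h.continuous.bounded_above_of_compact_support h.2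
  exact ⟨C, (norm_nonneg _).trans (hC 0), hC⟩

lemma isSchwartz_indicator_add (a : F) (n : ℤ) :
    IsSchwartz ((fun x => x - a) ⁻¹' primePow F n |>.indicator fun _ => (1 : ℂ)) := by
  obtain ⟨k, hk⟩ := exists_subset_primePow_of_isCompact (isCompact_singleton (x := a))
  refine isSchwartz_of_level_support (n := n) (m := min n k) (fun x v hv => ?_) fun x hx => ?_
  · have : (x + v) - a ∈ primePow F n ↔ x - a ∈ primePow F n := by
      rw [add_sub_right_comm]; exact add_mem_primePow_iff hv
    exact indicator_eq_indicator this fun _ => rfl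
  · refine Set.indicator_of_notMem (fun h => hx ?_) _
    have h2 := add_mem_primePow (primePow_antitone (min_le_left n k) h)
      (primePow_antitone (min_le_right n k) (hk k le_rfl rfl))
    simpa using h2

lemma isSchwartz_indicator (n : ℤ) : IsSchwartz ((primePow F n).indicator fun _ => (1 : ℂ)) := by
  simpa using isSchwartz_indicator_add (0 : F) n

end Schwartz

/-! ### Fourier inversion and self-dual measures. -/

section Fourier

variable {F : Type*} [NontriviallyNormedField F] [IsUltrametricDist F] [ProperSpace F]
  [hF : Fact (IsNormalizedAbs F)] [MeasurableSpace F] [BorelSpace F]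
  (μ : Measure F) [μ.IsAddHaarMeasure] {ψ : AddChar F Circle} {c : ℤ} {φ : F → ℂ}

lemma setIntegral_comp_add_right {S : Set F} (hS : MeasurableSet S) {v : F}
    (hv : ∀ x, x + v ∈ S ↔ x ∈ S) (f : F → ℂ) :
    ∫ x in S, f (x + v) ∂μ = ∫ x in S, f x ∂μ := by
  rw [← integral_indicator hS, ← integral_indicator hS,
    ← integral_add_right_eq_self (S.indicator f) v]
  exact integral_congr_ae (Eventually.of_forall fun x =>
    (indicator_eq_indicator (hv x) fun _ => rfl).symm)

/-- A translation preserves the integral and also multiplies it by ζ ≠ 1. The vanishing statements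
for ψ-integrals below rest on this. -/
lemma setIntegral_eq_zero_of_shift {S : Set F} (hS : MeasurableSet S) {v : F}
    (hv : ∀ x, x + v ∈ S ↔ x ∈ S) {f : F → ℂ} {ζ : ℂ} (hζ : ζ ≠ 1)
    (hf : ∀ x ∈ S, f (x + v) = ζ * f x) : ∫ x in S, f x ∂μ = 0 := by
  have h := setIntegral_comp_add_right μ hS hv f
  rw [setIntegral_congr_fun hS hf, integral_const_mul] at h
  have h2 : (ζ - 1) * ∫ x in S, f x ∂μ = 0 := by rw [sub_mul, h, one_mul, sub_self]
  exact (mul_eq_zero.mp h2).resolve_left (sub_ne_zero.mpr hζ)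

lemma IsSchwartz.integrable (h : IsSchwartz φ) : Integrable φ μ :=
  h.continuous.integrable_of_hasCompactSupport h.2

open Classical in
lemma HasCondExp.integral_primePow (hc : HasCondExp ψ c) (n : ℤ) (x : F) :
    ∫ y in primePow F n, (ψ (x * y) : ℂ) ∂μ =
      if x ∈ primePow F (c - n) then (μ.real (primePow F n) : ℂ) else 0 := by
  split_ifs with hx
  · rw [setIntegral_congr_fun (g := fun _ => (1 : ℂ)) (measurableSet_primePow n)]
    · simp
    · intro y hy
      simp only
      rw [hc.map_mul_eq_one hx hy]; simp
  · obtain ⟨v, hv, h⟩ := hc.exists_mul_ne_one hx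
    refine setIntegral_eq_zero_of_shift μ (measurableSet_primePow n)
      (fun y => add_mem_primePow_iff hv) (ζ := ψ (x * v)) (coe_ne_one h) fun y _ => ?_
    rw [mul_add, coe_map_add, mul_comm]

lemma HasCondExp.fourierWith_eq_zero (hc : HasCondExp ψ c) {n : ℤ}
    (hn : ∀ x, ∀ v ∈ primePow F n, φ (x + v) = φ x) {x : F} (hx : x ∉ primePow F (c - n)) :
    fourierWith ψ μ φ x = 0 := by
  obtain ⟨v, hv, h⟩ := hc.exists_mul_ne_one hx
  rw [fourierWith, ← setIntegral_univ]
  refine setIntegral_eq_zero_of_shift μ MeasurableSet.univ (v := v) (by simp)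
    (ζ := ψ (x * v)) (coe_ne_one h) fun y _ => ?_
  rw [hn y v hv, mul_add, coe_map_add]; ring

lemma HasCondExp.fourierWith_add (hc : HasCondExp ψ c) {m : ℤ}
    (hm : ∀ x, x ∉ primePow F m → φ x = 0) (x : F) {v : F} (hv : v ∈ primePow F (c - m)) :
    fourierWith ψ μ φ (x + v) = fourierWith ψ μ φ x := by
  refine integral_congr_ae (Eventually.of_forall fun y => ?_)
  simp only
  by_cases hy : y ∈ primePow F m
  · rw [add_mul, coe_map_add, hc.map_mul_eq_one hv hy]; simp
  · simp [hm y hy]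

lemma HasCondExp.isSchwartz_fourierWith (hc : HasCondExp ψ c) (hφ : IsSchwartz φ) :
    IsSchwartz (fourierWith ψ μ φ) := by
  obtain ⟨n, hn⟩ := hφ.exists_level
  obtain ⟨m, hm⟩ := hφ.exists_support
  exact isSchwartz_of_level_support (n := c - m) (m := c - n)
    (fun x v hv => hc.fourierWith_add μ (hm m le_rfl) x hv)
    (fun x hx => hc.fourierWith_eq_zero μ (hn n le_rfl) hx)

lemma HasCondExp.fourierWith_indicator_add (hc : HasCondExp ψ c) (a : F) (n : ℤ) (x : F) :
    fourierWith ψ μ ((fun x => x - a) ⁻¹' primePow F n |>.indicator fun _ => (1 : ℂ)) x =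
      ψ (x * a) * (primePow F (c - n)).indicator (fun _ => (μ.real (primePow F n) : ℂ)) x := by
  rw [fourierWith, ← integral_add_right_eq_self _ a]
  have : ∀ y, ((fun x => x - a) ⁻¹' primePow F n).indicator (fun _ => (1 : ℂ)) (y + a) *
      (ψ (x * (y + a)) : ℂ) = ψ (x * a) * (primePow F n).indicator (fun y => (ψ (x * y) : ℂ)) y := by
    intro y
    have h : y + a ∈ (fun x => x - a) ⁻¹' primePow F n ↔ y ∈ primePow F n := by simp
    by_cases hy : y ∈ primePow F n
    · rw [Set.indicator_of_mem (h.mpr hy), Set.indicator_of_mem hy, mul_add, coe_map_add]; ring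
    · rw [Set.indicator_of_notMem (mt h.mp hy), Set.indicator_of_notMem hy]; ring
  simp_rw [this]
  rw [integral_const_mul, integral_indicator (measurableSet_primePow n), hc.integral_primePow μ]
  simp only [Set.indicator]

/-- Since φ^ lives on P^(c-n), Fubini and orthogonality on that ball leave only the coset -x + P^n,
where φ is constant. This gives the inversion constant of an arbitrary Haar measure. -/
lemma HasCondExp.fourierWith_fourierWith (hc : HasCondExp ψ c) (hφ : IsSchwartz φ) {n : ℤ}
    (hn : ∀ x, ∀ v ∈ primePow F n, φ (x + v) = φ x) (x : F) :
    fourierWith ψ μ (fourierWith ψ μ φ) x =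
      (μ.real (primePow F n) * μ.real (primePow F (c - n)) : ℝ) * φ (-x) := by
  classical
  have h1 : fourierWith ψ μ (fourierWith ψ μ φ) x =
      ∫ y in primePow F (c - n), fourierWith ψ μ φ y * (ψ (x * y) : ℂ) ∂μ := by
    rw [fourierWith, ← integral_indicator (measurableSet_primePow _)]
    congr 1; ext y
    by_cases hy : y ∈ primePow F (c - n)
    · simp [hy]
    · simp [hy, hc.fourierWith_eq_zero μ hn hy]
  have hcc := hc.continuous
  rw [h1]
  simp_rw [fourierWith, ← integral_mul_const]
  rw [integral_integral_swap]
  · have h2 : ∀ z, ∫ y in primePow F (c - n), φ z * (ψ (y * z) : ℂ) * (ψ (x * y) : ℂ) ∂μ =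
        ((fun z => z - (-x)) ⁻¹' primePow F n).indicator
          (fun _ => φ (-x) * (μ.real (primePow F (c - n)) : ℂ)) z := by
      intro z
      have h3 : ∀ y, φ z * (ψ (y * z) : ℂ) * (ψ (x * y) : ℂ) = φ z * (ψ ((x + z) * y) : ℂ) := by
        intro y
        rw [mul_assoc, ← coe_map_add]; congr 3; ring
      simp_rw [h3]
      rw [integral_const_mul, hc.integral_primePow μ]
      simp only [Set.indicator, Set.mem_preimage, sub_neg_eq_add, sub_sub_cancel, add_comm z x]
      split_ifs with h
      · have := hn (-x) (x + z) h
        rw [neg_add_cancel_left] at this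
        rw [this]
      · simp
    simp_rw [h2]
    rw [integral_indicator ((measurable_sub_const _) (measurableSet_primePow n)), setIntegral_const]
    have h4 : μ.real ((fun z => z - (-x)) ⁻¹' primePow F n) = μ.real (primePow F n) := by
      simp only [sub_neg_eq_add, Measure.real]
      rw [measure_preimage_add_right]
    rw [h4, Complex.real_smul]
    push_cast; ring
  · have hi : Integrable (fun p : F × F => (1 : ℂ) * φ p.2)
        ((μ.restrict (primePow F (c - n))).prod μ) := by
      have : IsFiniteMeasure (μ.restrict (primePow F (c - n))) :=
        ⟨by rw [Measure.restrict_apply_univ]; exact measure_primePow_lt_top μ _⟩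
      exact Integrable.mul_prod (integrable_const (1 : ℂ)) (hφ.integrable μ)
    have := hi.bdd_mul (f := fun p : F × F => (ψ (p.1 * p.2) : ℂ) * (ψ (x * p.1) : ℂ)) (c := 1)
      (Continuous.aestronglyMeasurable (by fun_prop)) (Eventually.of_forall fun p => by
        rw [norm_mul, Circle.norm_coe, Circle.norm_coe, one_mul])
    refine this.congr (Eventually.of_forall fun p => ?_)
    simp only [Function.uncurry]; ring

/-- The product of the volumes of P^n and P^(c-n) does not depend on n, so self-duality is a single
numerical normalization. Existence, uniqueness and scaling of the self-dual measure follow from it.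
-/
lemma HasCondExp.isSelfDual_iff (hc : HasCondExp ψ c) :
    IsSelfDual ψ μ ↔ μ.real (primePow F 0) * μ.real (primePow F c) = 1 := by
  have key : ∀ n, μ.real (primePow F n) * μ.real (primePow F (c - n)) =
      μ.real (primePow F 0) * μ.real (primePow F c) := by
    intro n
    rw [measureReal_primePow μ n, measureReal_primePow μ (c - n), measureReal_primePow μ c,
      show -c = -n + -(c - n) by ring, zpow_add₀ (resCard_ne_zero F)]
    ring
  constructor
  · intro h
    have h1 := h.2 _ (isSchwartz_indicator 0) 0
    rw [hc.fourierWith_fourierWith μ (isSchwartz_indicator 0) (n := 0), key] at h1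
    · simpa [zero_mem_primePow, ← Complex.ofReal_mul] using! h1
    · intro x v hv
      exact indicator_eq_indicator (add_mem_primePow_iff hv) fun _ => rfl
  · intro h
    refine ⟨inferInstance, fun φ hφ x => ?_⟩
    obtain ⟨n, hn⟩ := hφ.exists_level
    rw [hc.fourierWith_fourierWith μ hφ (hn n le_rfl), key, h, Complex.ofReal_one, one_mul]

lemma IsSelfDual.measure_mul (hc : HasCondExp ψ c) (h : IsSelfDual ψ μ) (n : ℤ) :
    μ.real (primePow F n) * μ.real (primePow F (c - n)) = 1 := by
  rw [← (hc.isSelfDual_iff μ).mp h, measureReal_primePow μ n, measureReal_primePow μ (c - n),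
    measureReal_primePow μ c, show -c = -n + -(c - n) by ring, zpow_add₀ (resCard_ne_zero F)]
  ring

lemma haar_eq_of_measureReal_eq (ν : Measure F) [ν.IsAddHaarMeasure]
    (h : μ.real (primePow F 0) = ν.real (primePow F 0)) : μ = ν := by
  have h1 := Measure.isAddLeftInvariant_eq_smul μ ν
  set k := Measure.addHaarScalarFactor μ ν
  have h2 : μ.real (primePow F 0) = k * ν.real (primePow F 0) := by
    conv_lhs => rw [h1]
    rw [measureReal_nnreal_smul_apply]
  rw [h] at h2
  have h3 : (k : ℝ) = 1 := by
    have := measureReal_primePow_pos ν 0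
    field_simp at h2
    exact h2.symm
  rw [h1, show k = 1 by exact_mod_cast h3, one_smul]

lemma HasCondExp.exists_isSelfDual (hc : HasCondExp ψ c) : ∃ μ : Measure F, IsSelfDual ψ μ := by
  let μ₀ : Measure F := Measure.addHaar
  set t := μ₀.real (primePow F 0) * μ₀.real (primePow F c)
  have ht : 0 < t := mul_pos (measureReal_primePow_pos μ₀ 0) (measureReal_primePow_pos μ₀ c)
  have hs : 0 < (√t)⁻¹ := inv_pos.mpr (Real.sqrt_pos.mpr ht)
  let μ : Measure F := ENNReal.ofReal (√t)⁻¹ • μ₀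
  have : μ.IsAddHaarMeasure := Measure.IsAddHaarMeasure.smul _
    (ENNReal.ofReal_pos.mpr hs).ne' ENNReal.ofReal_ne_top
  refine ⟨μ, (hc.isSelfDual_iff μ).mpr ?_⟩
  have e : ∀ n, μ.real (primePow F n) = (√t)⁻¹ * μ₀.real (primePow F n) := fun n => by
    rw [measureReal_ennreal_smul_apply, ENNReal.toReal_ofReal hs.le]
  calc _ = (√t)⁻¹ * (√t)⁻¹ * t := by rw [e, e, mul_mul_mul_comm]
    _ = 1 := by rw [← mul_inv, Real.mul_self_sqrt ht.le, inv_mul_cancel₀ ht.ne']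

lemma HasCondExp.isSelfDual_selfDualMeasure (hc : HasCondExp ψ c) :
    IsSelfDual ψ (selfDualMeasure ψ) := by
  have h := hc.exists_isSelfDual
  rw [selfDualMeasure, dif_pos h]
  exact h.choose_spec

lemma HasCondExp.isAddHaarMeasure (hc : HasCondExp ψ c) : (selfDualMeasure ψ).IsAddHaarMeasure :=
  hc.isSelfDual_selfDualMeasure.1

lemma IsSelfDual.eq_selfDualMeasure (hc : HasCondExp ψ c) (h : IsSelfDual ψ μ) :
    μ = selfDualMeasure ψ := by
  have h2 := hc.isSelfDual_selfDualMeasure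
  have := hc.isAddHaarMeasure
  refine haar_eq_of_measureReal_eq μ _ ?_
  rw [hc.isSelfDual_iff μ, measureReal_primePow _ c] at h
  rw [hc.isSelfDual_iff (selfDualMeasure ψ), measureReal_primePow _ c] at h2
  have e : μ.real (primePow F 0) ^ 2 = (selfDualMeasure ψ).real (primePow F 0) ^ 2 := by
    have hq := zpow_resCard_pos (F := F) (-c)
    have h3 := h.trans h2.symm
    have h4 : (resCard F : ℝ) ^ (-c) * μ.real (primePow F 0) ^ 2 =
      (resCard F : ℝ) ^ (-c) * (selfDualMeasure ψ).real (primePow F 0) ^ 2 := by linarith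
    exact mul_left_cancel₀ hq.ne' h4
  exact (pow_left_inj₀ measureReal_nonneg measureReal_nonneg two_ne_zero).mp e

lemma HasCondExp.selfDualMeasure_mulShift (hc : HasCondExp ψ c) {a : F} (ha : a ≠ 0) :
    selfDualMeasure (ψ.mulShift a) = ENNReal.ofReal √‖a‖ • selfDualMeasure ψ := by
  obtain ⟨k, hk⟩ := exists_mem_shell a ha
  have hc' := hc.mulShift hk
  have hh := hc.isAddHaarMeasure
  have hpos : 0 < √‖a‖ := Real.sqrt_pos.mpr (norm_pos_iff.mpr ha)
  have : (ENNReal.ofReal √‖a‖ • selfDualMeasure ψ).IsAddHaarMeasure :=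
    Measure.IsAddHaarMeasure.smul _ (by simpa using ha) ENNReal.ofReal_ne_top
  refine (IsSelfDual.eq_selfDualMeasure _ hc' ((hc'.isSelfDual_iff _).mpr ?_)).symm
  have h := (hc.isSelfDual_iff _).mp hc.isSelfDual_selfDualMeasure
  simp only [measureReal_ennreal_smul_apply, ENNReal.toReal_ofReal hpos.le]
  rw [← h, measureReal_primePow _ (c - k), measureReal_primePow _ c,
    show -(c - k) = -c - -k by ring, zpow_sub₀ (resCard_ne_zero F), ← mem_shell.mp hk]
  have : √‖a‖ * √‖a‖ = ‖a‖ := Real.mul_self_sqrt (norm_nonneg a)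
  have h0 : ‖a‖ ≠ 0 := norm_ne_zero_iff.mpr ha
  field_simp
  rw [sq, this]; ring

lemma mulMeasure_eq (ψ : AddChar F Circle) : mulMeasure ψ = mulHaar (selfDualMeasure ψ) := rfl

lemma HasCondExp.mulMeasure_mulShift (hc : HasCondExp ψ c) {a : F} (ha : a ≠ 0) :
    mulMeasure (ψ.mulShift a) = ENNReal.ofReal √‖a‖ • mulMeasure ψ := by
  have := hc.isAddHaarMeasure
  rw [mulMeasure_eq, mulMeasure_eq, hc.selfDualMeasure_mulShift ha, mulHaar_smul]

end Fourier

/-! ### Gauss integrals over balls and their stabilization. -/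

section GaussIntegrals

variable {F : Type*} [NontriviallyNormedField F] [IsUltrametricDist F] [ProperSpace F]
  [hF : Fact (IsNormalizedAbs F)] [MeasurableSpace F] [BorelSpace F]
  (μ : Measure F) [μ.IsAddHaarMeasure] {ψ : AddChar F Circle} {c : ℤ}

lemma setIntegral_mulHaar {S : Set F} (hS : MeasurableSet S) (f : F → ℂ) :
    ∫ x in S, f x ∂(mulHaar μ) = ∫ x in S, (‖x‖⁻¹ : ℝ) * f x ∂μ := by
  rw [← integral_indicator hS, integral_mulHaar, ← integral_indicator hS]
  refine integral_congr_ae (Eventually.of_forall fun x => ?_)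
  by_cases hx : x ∈ S <;> simp [hx]

lemma integral_norm_mul_mulHaar (f : F → ℂ) :
    ∫ x, (‖x‖ : ℂ) * f x ∂(mulHaar μ) = ∫ x, f x ∂μ := by
  rw [integral_mulHaar]
  refine integral_congr_ae ((ae_haar_ne_zero μ).mono fun x hx => ?_)
  simp only
  rw [← mul_assoc, ← Complex.ofReal_mul, inv_mul_cancel₀ (norm_ne_zero_iff.mpr hx)]
  simp

/-- Functions on `Fˣ` invariant under multiplication by `1 + P ^ m`. -/
def CongrInvariant (m : ℤ) (f : F → ℂ) : Prop :=
  ∀ x u, x ≠ 0 → IsCongrOne m u → f (x * u) = f x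

lemma CongrInvariant.mono {m n : ℤ} (h : m ≤ n) {f : F → ℂ} (hf : CongrInvariant m f) :
    CongrInvariant n f := fun x u hx hu => hf x u hx (hu.mono h)

lemma congrInvariant_twist (χ : Fˣ →ₜ* ℂˣ) (z : ℂ) : CongrInvariant (conductor χ) (twist χ z) :=
  fun x u _ hu => by rw [twist_mul, twist_congrOne χ z hu, mul_one]

/-- Write x + v = x(1 + x⁻¹v). For v in P^(c-1) and x of valuation k < c - m the second factor lies
in 1 + P^m, so f does not see the shift, while ψ(v) ≠ 1 for a suitable v. -/
lemma HasCondExp.integral_shell_eq_zero (hc : HasCondExp ψ c) {m : ℤ} (hm : 1 ≤ m) {f : F → ℂ}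
    (hf : CongrInvariant m f) {k : ℤ} (hk : k < c - m) :
    ∫ x in shell F k, f x * (ψ x : ℂ) ∂(mulHaar μ) = 0 := by
  obtain ⟨v, hv, hv1⟩ := hc.2
  replace hv : v ∈ primePow F (m + k) := primePow_antitone (by omega) hv
  have hv2 : v ∈ primePow F (k + 1) := primePow_antitone (by omega) hv
  rw [setIntegral_mulHaar μ (measurableSet_shell k)]
  refine setIntegral_eq_zero_of_shift μ (measurableSet_shell k) (v := v) (fun x => ⟨fun h => ?_,
    fun h => add_mem_shell h hv2⟩) (coe_ne_one hv1) fun x hx => ?_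
  · have := add_mem_shell h (neg_mem_primePow.mpr hv2)
    rwa [add_neg_cancel_right] at this
  · have hx0 := ne_zero_of_mem_shell hx
    have h1 : x + v = x * (1 + x⁻¹ * v) := by
      rw [mul_add, mul_one, mul_inv_cancel_left₀ hx0]
    have h2 : x⁻¹ * v ∈ primePow F m := by
      rw [← mul_mem_primePow_iff hx, mul_inv_cancel_left₀ hx0, add_comm]; exact hv
    have h3 : ‖x + v‖ = ‖x‖ := by rw [mem_shell.mp (add_mem_shell hx hv2), mem_shell.mp hx]
    have h4 : f (x + v) = f x := by rw [h1, hf x _ hx0 (isCongrOne_one_add hm h2)]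
    rw [h3, h4, coe_map_add]; ring

lemma setIntegral_primePow_eq_add {f : F → ℂ} {n : ℤ}
    (hf : IntegrableOn f (primePow F n) (mulHaar μ)) :
    ∫ x in primePow F n, f x ∂(mulHaar μ) =
      ∫ x in shell F n, f x ∂(mulHaar μ) + ∫ x in primePow F (n + 1), f x ∂(mulHaar μ) := by
  conv_lhs => rw [primePow_eq_union]
  rw [primePow_eq_union] at hf
  exact setIntegral_union (disjoint_shell_primePow n) (measurableSet_primePow _)
    hf.left_of_union hf.right_of_union

lemma HasCondExp.integrableOn_mul (hc : HasCondExp ψ c) {S : Set F} {f : F → ℂ}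
    {ν : Measure F} (hf : IntegrableOn f S ν) (y : F) :
    IntegrableOn (fun x => f x * (ψ (x * y) : ℂ)) S ν := by
  have hcont := hc.continuous
  have := hf.bdd_mul (f := fun x => (ψ (x * y) : ℂ)) (c := 1)
    (Continuous.aestronglyMeasurable (by fun_prop)) (Eventually.of_forall fun p => (Circle.norm_coe _).le)
  exact this.congr (Eventually.of_forall fun x => mul_comm _ _)

lemma HasCondExp.integrableOn_mul_self (hc : HasCondExp ψ c) {S : Set F} {f : F → ℂ}
    {ν : Measure F} (hf : IntegrableOn f S ν) : IntegrableOn (fun x => f x * (ψ x : ℂ)) S ν := by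
  simpa using hc.integrableOn_mul hf 1

lemma HasCondExp.integral_primePow_stable (hc : HasCondExp ψ c) {m : ℤ} (hm : 1 ≤ m) {f : F → ℂ}
    (hf : CongrInvariant m f) (hi : ∀ n, IntegrableOn f (primePow F n) (mulHaar μ)) {n : ℤ}
    (hn : n ≤ c - m) :
    ∫ x in primePow F n, f x * (ψ x : ℂ) ∂(mulHaar μ) =
      ∫ x in primePow F (c - m), f x * (ψ x : ℂ) ∂(mulHaar μ) := by
  induction n, hn using Int.leInductionDown with
  | base => rfl
  | pred k hk ih =>
    rw [setIntegral_primePow_eq_add μ (hc.integrableOn_mul_self (hi _)),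
      hc.integral_shell_eq_zero μ hm hf (by omega), zero_add, sub_add_cancel, ih]

variable (χ : Fˣ →ₜ* ℂˣ) (z : ℂ)

/-- `max (m(χ), 1)`. -/
def condLevel (χ : Fˣ →ₜ* ℂˣ) : ℕ := max (conductor χ) 1

/-- The truncated integrals `∫ χ(x) |x| ^ z ψ(x) d^*x` over `P ^ n`. -/
def gaussTrunc (μ : Measure F) (ψ : AddChar F Circle) (χ : Fˣ →ₜ* ℂˣ) (z : ℂ) (n : ℤ) : ℂ :=
  ∫ x in primePow F n, twist χ z x * (ψ x : ℂ) ∂(mulHaar μ)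

/-- The stable value of `gaussTrunc`, for `ψ` of conductor exponent `c`. -/
def gaussInt (μ : Measure F) (ψ : AddChar F Circle) (c : ℤ) (χ : Fˣ →ₜ* ℂˣ) (z : ℂ) : ℂ :=
  gaussTrunc μ ψ χ z (c - condLevel χ)

lemma congrInvariant_twist_condLevel : CongrInvariant (condLevel χ) (twist χ z) :=
  (congrInvariant_twist χ z).mono (by exact_mod_cast le_max_left _ _)

lemma one_le_condLevel : (1 : ℤ) ≤ condLevel χ := by exact_mod_cast le_max_right _ _

variable {z}

lemma HasCondExp.gaussTrunc_eq (hc : HasCondExp ψ c) (hz : 0 < z.re + charExp χ) {n : ℤ}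
    (hn : n ≤ c - condLevel χ) : gaussTrunc μ ψ χ z n = gaussInt μ ψ c χ z :=
  hc.integral_primePow_stable μ (one_le_condLevel χ) (congrInvariant_twist_condLevel χ z)
    (fun n => (integrableOn_twist χ μ n).mpr hz) hn

/-- Small balls are controlled by absolute convergence, and on large balls the truncation is
constant. The uniform bound serves for dominated convergence in Tate's functional equation. -/
lemma HasCondExp.exists_bound_gaussTrunc (hc : HasCondExp ψ c) (hz : 0 < z.re + charExp χ) :
    ∃ B, ∀ n, ‖gaussTrunc μ ψ χ z n‖ ≤ B := by
  refine ⟨∫ x in primePow F (c - condLevel χ), ‖twist χ z x‖ ∂(mulHaar μ), fun n => ?_⟩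
  have key : ∀ k, c - condLevel χ ≤ k → ‖gaussTrunc μ ψ χ z k‖ ≤
      ∫ x in primePow F (c - condLevel χ), ‖twist χ z x‖ ∂(mulHaar μ) := fun k hk => by
    calc _ ≤ ∫ x in primePow F k, ‖twist χ z x * (ψ x : ℂ)‖ ∂(mulHaar μ) :=
          norm_integral_le_integral_norm _
      _ = ∫ x in primePow F k, ‖twist χ z x‖ ∂(mulHaar μ) := by
          simp_rw [norm_mul, Circle.norm_coe, mul_one]
      _ ≤ _ := setIntegral_mono_set ((integrableOn_twist χ μ _).mpr hz).norm
          (Eventually.of_forall fun x => norm_nonneg _) (primePow_antitone hk).eventuallyLE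
  rcases le_total n (c - condLevel χ) with h | h
  · rw [hc.gaussTrunc_eq μ χ hz h]; exact key _ le_rfl
  · exact key n h

lemma setIntegral_mulHaar_comp_mul {a : F} {k : ℤ} (ha : a ∈ shell F k) (n : ℤ) (f : F → ℂ) :
    ∫ x in primePow F n, f (a * x) ∂(mulHaar μ) = ∫ x in primePow F (k + n), f x ∂(mulHaar μ) := by
  have ha0 := ne_zero_of_mem_shell ha
  rw [← (measurePreserving_mul_left μ ha0).setIntegral_preimage_emb
    (measurableEmbedding_mul_left ha0) f]
  congr 2
  ext x
  exact (mul_mem_primePow_iff ha).symm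

lemma integral_twist_mul_scaled {y : F} {k : ℤ} (hy : y ∈ shell F k) (n : ℤ) :
    ∫ x in primePow F n, twist χ z x * (ψ (x * y) : ℂ) ∂(mulHaar μ) =
      twist χ z y⁻¹ * gaussTrunc μ ψ χ z (k + n) := by
  have hy0 := ne_zero_of_mem_shell hy
  rw [gaussTrunc, ← integral_const_mul, ← setIntegral_mulHaar_comp_mul μ hy n]
  refine integral_congr_ae (Eventually.of_forall fun x => ?_)
  simp only
  rw [twist_mul, ← mul_assoc, ← mul_assoc, ← twist_mul, inv_mul_cancel₀ hy0, twist_one, one_mul,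
    mul_comm y]

end GaussIntegrals

/-! ### Tate's local functional equation. -/

section FunctionalEquation

variable {F : Type*} [NontriviallyNormedField F] [IsUltrametricDist F] [ProperSpace F]
  [hF : Fact (IsNormalizedAbs F)] [MeasurableSpace F] [BorelSpace F]
  (μ : Measure F) [μ.IsAddHaarMeasure] {ψ : AddChar F Circle} {c : ℤ}
  (χ : Fˣ →ₜ* ℂˣ) {z : ℂ} {φ : F → ℂ}

lemma IsSchwartz.integrable_mellinIntegrand (hφ : IsSchwartz φ) (hz : 0 < z.re + charExp χ) :
    Integrable (mellinIntegrand z χ φ) (mulHaar μ) := by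
  obtain ⟨n, hn⟩ := hφ.exists_support
  obtain ⟨C, -, hC⟩ := hφ.exists_bound
  have h1 : Integrable ((primePow F n).indicator (twist χ z)) (mulHaar μ) :=
    (integrable_indicator_iff (measurableSet_primePow n)).mpr ((integrableOn_twist χ μ n).mpr hz)
  have h2 := h1.bdd_mul (f := φ) (c := C) hφ.continuous.aestronglyMeasurable
    (Eventually.of_forall hC)
  refine h2.congr (Eventually.of_forall fun x => ?_)
  simp only [mellinIntegrand_eq]
  by_cases hx : x ∈ primePow F n
  · rw [Set.indicator_of_mem hx]
  · rw [hn n le_rfl x hx]; simp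

lemma norm_mul_twist (w : ℂ) (x : F) : (‖x‖ : ℂ) * twist χ w x = twist χ (1 + w) x := by
  rw [twist_add, Complex.cpow_one]

lemma HasCondExp.integral_primePow_fourierWith (hc : HasCondExp ψ c) (hφ : IsSchwartz φ)
    (hz : 0 < z.re + charExp χ) (n : ℤ) :
    ∫ x in primePow F n, fourierWith ψ μ φ x * twist χ z x ∂(mulHaar μ) =
      ∫ y, φ y * ∫ x in primePow F n, twist χ z x * (ψ (x * y) : ℂ) ∂(mulHaar μ) ∂μ := by
  simp_rw [fourierWith, ← integral_mul_const, ← integral_const_mul]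
  rw [integral_integral_swap]
  · refine integral_congr_ae (Eventually.of_forall fun y => ?_)
    refine integral_congr_ae (Eventually.of_forall fun x => ?_)
    simp only; ring
  · have hcc := hc.continuous
    have hi : Integrable (fun p : F × F => twist χ z p.1 * φ p.2)
        (((mulHaar μ).restrict (primePow F n)).prod μ) :=
      Integrable.mul_prod ((integrableOn_twist χ μ n).mpr hz) (hφ.integrable μ)
    have := hi.bdd_mul (f := fun p : F × F => (ψ (p.1 * p.2) : ℂ)) (c := 1)
      (Continuous.aestronglyMeasurable (by fun_prop)) (Eventually.of_forall fun p => (Circle.norm_coe _).le)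
    refine this.congr (Eventually.of_forall fun p => ?_)
    simp only [Function.uncurry]; ring

lemma HasCondExp.measurable_integral_twist_mul (hc : HasCondExp ψ c) (z : ℂ) (n : ℤ) :
    Measurable fun y => ∫ x in primePow F n, twist χ z x * (ψ (x * y) : ℂ) ∂(mulHaar μ) := by
  have hcc := hc.continuous
  have hm : StronglyMeasurable (Function.uncurry fun y x : F =>
      twist χ z x * (ψ (x * y) : ℂ)) := by
    refine Measurable.stronglyMeasurable ?_
    refine Measurable.mul ((measurable_twist χ z).comp measurable_snd) ?_
    exact Continuous.measurable (by fun_prop)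
  exact (hm.integral_prod_right (ν := (mulHaar μ).restrict (primePow F n))).measurable

/-- Tate's local functional equation, with the `γ`-factor given as a convergent integral. -/
theorem HasCondExp.tate_functional_equation (hc : HasCondExp ψ c) (hφ : IsSchwartz φ)
    (hz : 0 < z.re + charExp χ) (hi : Integrable (mellinIntegrand (1 - z) χ⁻¹ φ) (mulHaar μ)) :
    ∫ x, mellinIntegrand z χ (fourierWith ψ μ φ) x ∂(mulHaar μ) =
      gaussInt μ ψ c χ z * ∫ y, mellinIntegrand (1 - z) χ⁻¹ φ y ∂(mulHaar μ) := by
  obtain ⟨B, hB⟩ := hc.exists_bound_gaussTrunc μ χ hz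
  obtain ⟨N, hN⟩ := (hc.isSchwartz_fourierWith μ hφ).exists_support
  -- T j is the integrand after Fubini, rewritten for d*y. The inverse twist removes the factor
  -- χ(y⁻¹)|y⁻¹|^z which rescaling by y extracts from the inner integral, so that what remains is a
  -- bounded truncated Gauss integral.
  let T : ℕ → F → ℂ := fun j y => mellinIntegrand (1 - z) χ⁻¹ φ y *
    ((twist χ⁻¹ (-z) y)⁻¹ *
      ∫ x in primePow F (-(j : ℤ)), twist χ z x * (ψ (x * y) : ℂ) ∂(mulHaar μ))
  have hT : ∀ j (y : F) (k : ℤ), y ∈ shell F k → T j y = mellinIntegrand (1 - z) χ⁻¹ φ y *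
      gaussTrunc μ ψ χ z (k + -(j : ℤ)) := by
    intro j y k hy
    have hy0 := ne_zero_of_mem_shell hy
    simp only [T]
    rw [integral_twist_mul_scaled μ χ hy, twist_inv_char, neg_neg,
      inv_mul_cancel_left₀ (twist_ne_zero χ z (inv_ne_zero hy0))]
  have h1 : ∀ j : ℕ, ∫ x in primePow F (-(j : ℤ)), fourierWith ψ μ φ x * twist χ z x ∂(mulHaar μ) =
      ∫ y, T j y ∂(mulHaar μ) := by
    intro j
    rw [hc.integral_primePow_fourierWith μ χ hφ hz, ← integral_norm_mul_mulHaar]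
    refine integral_congr_ae ((ae_mulHaar_ne_zero μ).mono fun y hy => ?_)
    have := twist_ne_zero χ⁻¹ (-z) hy
    simp only [T]
    rw [mellinIntegrand_eq, sub_eq_add_neg, ← norm_mul_twist]
    generalize (∫ x in primePow F (-(j : ℤ)), twist χ z x * (ψ (x * y) : ℂ) ∂(mulHaar μ)) = I
    field_simp
  have h2 : Tendsto (fun j : ℕ => ∫ y, T j y ∂(mulHaar μ)) atTop
      (𝓝 (∫ y, mellinIntegrand (1 - z) χ⁻¹ φ y * gaussInt μ ψ c χ z ∂(mulHaar μ))) := by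
    refine tendsto_integral_of_dominated_convergence
      (fun y => ‖mellinIntegrand (1 - z) χ⁻¹ φ y‖ * B) (fun j => ?_) (hi.norm.mul_const B)
      (fun j => (ae_mulHaar_ne_zero μ).mono fun y hy => ?_)
      ((ae_mulHaar_ne_zero μ).mono fun y hy => ?_)
    · exact hi.aestronglyMeasurable.mul ((measurable_twist χ⁻¹ (-z)).inv.mul
        (hc.measurable_integral_twist_mul μ χ z (-(j : ℤ)))).aestronglyMeasurable
    · obtain ⟨k, hk⟩ := exists_mem_shell y hy
      rw [hT j y k hk, norm_mul]
      exact mul_le_mul_of_nonneg_left (hB _) (norm_nonneg _)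
    · obtain ⟨k, hk⟩ := exists_mem_shell y hy
      -- For fixed y of valuation k the truncation sits at k - j, which is eventually in the stable
      -- range.
      refine tendsto_const_nhds.congr' ?_
      filter_upwards [eventually_ge_atTop (k - (c - condLevel χ)).toNat] with j hj
      rw [hT j y k hk, hc.gaussTrunc_eq μ χ hz (by omega)]
  have h3 : Tendsto (fun j : ℕ => ∫ y, T j y ∂(mulHaar μ)) atTop
      (𝓝 (∫ x, mellinIntegrand z χ (fourierWith ψ μ φ) x ∂(mulHaar μ))) := by
    refine tendsto_const_nhds.congr' ?_
    filter_upwards [eventually_ge_atTop (-N).toNat] with j hj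
    rw [← h1, ← integral_indicator (measurableSet_primePow _)]
    refine integral_congr_ae (Eventually.of_forall fun x => ?_)
    simp only [mellinIntegrand_eq]
    by_cases hx : x ∈ primePow F (-(j : ℤ))
    · rw [Set.indicator_of_mem hx]
    · rw [Set.indicator_of_notMem hx, hN _ (by omega) x hx, zero_mul]
  rw [tendsto_nhds_unique h3 h2, integral_mul_const, mul_comm]

end FunctionalEquation

/-! ### Identity theorem for meromorphic functions vanishing on a strip. -/

section IdentityTheorem

lemma eventually_eq_zero_of_meromorphicOn {f : ℂ → ℂ} (hf : MeromorphicOn f Set.univ) {a b : ℝ}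
    (hab : a < b) (h : ∀ s : ℂ, a < s.re → s.re < b → f s = 0) (z : ℂ) :
    ∀ᶠ w in 𝓝[≠] z, f w = 0 := by
  rw [← meromorphicOrderAt_eq_top_iff]
  by_contra hne
  refine hf.meromorphicOrderAt_ne_top_of_isPreconnected (y := (((a + b) / 2 : ℝ) : ℂ))
    isPreconnected_univ (Set.mem_univ z) (Set.mem_univ _) hne ?_
  rw [meromorphicOrderAt_eq_top_iff]
  refine eventually_nhdsWithin_of_eventually_nhds ?_
  have hU : IsOpen {s : ℂ | a < s.re ∧ s.re < b} :=
    (isOpen_lt continuous_const Complex.continuous_re).inter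
      (isOpen_lt Complex.continuous_re continuous_const)
  have hmem : (((a + b) / 2 : ℝ) : ℂ) ∈ {s : ℂ | a < s.re ∧ s.re < b} := by
    simp only [Set.mem_ofPred_eq, Complex.ofReal_re]
    constructor <;> linarith
  filter_upwards [hU.mem_nhds hmem] with s hs using h s hs.1 hs.2

lemma eq_zero_of_meromorphicOn {f : ℂ → ℂ} (hf : MeromorphicOn f Set.univ) {a b : ℝ}
    (hab : a < b) (h : ∀ s : ℂ, a < s.re → s.re < b → f s = 0) {z : ℂ} (hz : ContinuousAt f z) :
    f z = 0 := by
  have h1 := eventually_eq_zero_of_meromorphicOn hf hab h z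
  have h2 : f =ᶠ[𝓝[≠] z] fun _ => 0 := h1
  exact ((hz.eventuallyEq_nhds_iff_eventuallyEq_nhdsNE continuousAt_const).mp h2).eq_of_nhds

lemma toMeromorphicNFOn_apply_of_analyticAt {f : ℂ → ℂ} (hf : MeromorphicOn f Set.univ) {z : ℂ}
    (hz : AnalyticAt ℂ f z) : toMeromorphicNFOn f Set.univ z = f z := by
  rw [toMeromorphicNFOn_eq_toMeromorphicNFAt hf (Set.mem_univ z),
    toMeromorphicNFAt_eq_self.mpr hz.meromorphicNFAt]

end IdentityTheorem

/-! ### Meromorphic continuation of the Gauss integral, and the test function on principal units. -/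

section Continuation

variable {F : Type*} [NontriviallyNormedField F] [IsUltrametricDist F] [ProperSpace F]
  [hF : Fact (IsNormalizedAbs F)] [MeasurableSpace F] [BorelSpace F]
  (μ : Measure F) [μ.IsAddHaarMeasure] {ψ : AddChar F Circle} {c : ℤ}
  (χ : Fˣ →ₜ* ℂˣ) {z : ℂ}

/-- The integral of `χ(x) |x| ^ z ψ(x)` over the elements of valuation `k`. -/
def shellInt (μ : Measure F) (ψ : AddChar F Circle) (χ : Fˣ →ₜ* ℂˣ) (k : ℤ) (z : ℂ) : ℂ :=
  ∫ x in shell F k, twist χ z x * (ψ x : ℂ) ∂(mulHaar μ)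

/-- The meromorphic continuation of `gaussInt`. -/
def gaussMero (μ : Measure F) (ψ : AddChar F Circle) (c : ℤ) (χ : Fˣ →ₜ* ℂˣ) (z : ℂ) : ℂ :=
  ∑ j ∈ Finset.range (condLevel χ), shellInt μ ψ χ (c - (j + 1 : ℕ)) z +
    shellInt μ ψ χ c z / (1 - twist χ z (unif F : F))

lemma analyticAt_twist (x : F) (z : ℂ) : AnalyticAt ℂ (fun z => twist χ z x) z := by
  rcases eq_or_ne x 0 with rfl | hx
  · simpa using analyticAt_const
  · have h : (fun z => twist χ z x) =
        fun z => Complex.exp (Complex.log (‖x‖ : ℂ) * z) * extendZero χ x := by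
      ext z
      rw [twist, Complex.cpow_def_of_ne_zero (by simpa using hx)]
    rw [h]
    fun_prop

/-- On a shell |x|^z is constant in x, so the integral is one exponential in z times its value at z
= 0. -/
lemma analyticAt_shellInt (ψ : AddChar F Circle) (k : ℤ) (z : ℂ) :
    AnalyticAt ℂ (shellInt μ ψ χ k) z := by
  have h : shellInt μ ψ χ k = fun z => twist 1 z ((unif F ^ k : Fˣ) : F) * shellInt μ ψ χ k 0 := by
    ext z
    rw [shellInt, shellInt, ← integral_const_mul]
    refine setIntegral_congr_fun (measurableSet_shell k) fun x hx => ?_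
    have h1 : extendZero 1 ((unif F ^ k : Fˣ) : F) = 1 := by
      rw [extendZero_units]; rfl
    rw [twist, twist, twist, h1, norm_unif_zpow, mem_shell.mp hx, Complex.cpow_zero]
    ring
  rw [h]
  exact (analyticAt_twist 1 _ z).mul analyticAt_const

lemma meromorphicAt_gaussMero (ψ : AddChar F Circle) (c : ℤ) (z : ℂ) :
    MeromorphicAt (gaussMero μ ψ c χ) z := by
  have h1 : AnalyticAt ℂ (fun z => ∑ j ∈ Finset.range (condLevel χ),
      shellInt μ ψ χ (c - (j + 1 : ℕ)) z) z :=
    Finset.analyticAt_fun_sum _ fun j _ => analyticAt_shellInt μ χ ψ _ z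
  exact h1.meromorphicAt.add ((analyticAt_shellInt μ χ ψ c z).meromorphicAt.div
    (analyticAt_const.sub (analyticAt_twist χ _ z)).meromorphicAt)

lemma twist_unif_ne_one (hz : z.re + charExp χ ≠ 0) : twist χ z (unif F : F) ≠ 1 := by
  intro h
  have h1 := norm_twist χ z (unif F).ne_zero
  rw [h, norm_one, norm_unif, Real.inv_rpow (resCard_pos F).le, ← Real.rpow_neg (resCard_pos F).le] at h1
  rcases lt_or_gt_of_ne hz with h2 | h2
  · exact h1.not_lt (Real.one_lt_rpow (one_lt_resCard_real F) (by linarith))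
  · exact h1.not_gt (Real.rpow_lt_one_of_one_lt_of_neg (one_lt_resCard_real F) (by linarith))

lemma analyticAt_gaussMero (ψ : AddChar F Circle) (c : ℤ) (hz : z.re + charExp χ ≠ 0) :
    AnalyticAt ℂ (gaussMero μ ψ c χ) z := by
  have h1 : AnalyticAt ℂ (fun z => ∑ j ∈ Finset.range (condLevel χ),
      shellInt μ ψ χ (c - (j + 1 : ℕ)) z) z :=
    Finset.analyticAt_fun_sum _ fun j _ => analyticAt_shellInt μ χ ψ _ z
  exact h1.add ((analyticAt_shellInt μ χ ψ c z).div
    (analyticAt_const.sub (analyticAt_twist χ _ z))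
    (sub_ne_zero.mpr (twist_unif_ne_one χ hz).symm))

lemma HasCondExp.gaussTrunc_eq_sum (hc : HasCondExp ψ c) (hz : 0 < z.re + charExp χ) (m : ℕ) :
    gaussTrunc μ ψ χ z (c - m) = ∑ j ∈ Finset.range m, shellInt μ ψ χ (c - (j + 1 : ℕ)) z +
      gaussTrunc μ ψ χ z c := by
  induction m with
  | zero => simp
  | succ m ih =>
    rw [gaussTrunc, setIntegral_primePow_eq_add μ (hc.integrableOn_mul_self
      ((integrableOn_twist χ μ _).mpr hz)), Finset.sum_range_succ]
    have h : c - ((m + 1 : ℕ) : ℤ) + 1 = c - m := by push_cast; ring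
    rw [h]
    rw [gaussTrunc] at ih
    rw [ih, shellInt]; ring

/-- As ψ is trivial on P^c, passing to P^(c+1) amounts to scaling by a uniformizer, which multiplies
the integral by the twist at that uniformizer. This sums the geometric series. -/
lemma HasCondExp.gaussTrunc_self (hc : HasCondExp ψ c) (hz : 0 < z.re + charExp χ) :
    gaussTrunc μ ψ χ z c = shellInt μ ψ χ c z / (1 - twist χ z (unif F : F)) := by
  rw [eq_div_iff (sub_ne_zero.mpr (twist_unif_ne_one χ hz.ne').symm), mul_sub, mul_one]
  have triv : ∀ n, c ≤ n →
      gaussTrunc μ ψ χ z n = ∫ x in primePow F n, twist χ z x ∂(mulHaar μ) := by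
    intro n hn
    refine setIntegral_congr_fun (measurableSet_primePow n) fun x hx => ?_
    rw [hc.1 x (primePow_antitone hn hx)]; simp
  have h1 : gaussTrunc μ ψ χ z (c + 1) = gaussTrunc μ ψ χ z c * twist χ z (unif F : F) := by
    have hu := unif_zpow_mem_shell F 1
    rw [zpow_one] at hu
    rw [triv _ le_rfl, triv _ (by omega), add_comm c 1, ← setIntegral_mulHaar_comp_mul μ hu,
      ← integral_mul_const]
    simp_rw [twist_mul, mul_comm]
  have h2 : gaussTrunc μ ψ χ z c = shellInt μ ψ χ c z + gaussTrunc μ ψ χ z (c + 1) :=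
    setIntegral_primePow_eq_add μ (hc.integrableOn_mul_self ((integrableOn_twist χ μ _).mpr hz))
  rw [← h1, h2]; ring

lemma HasCondExp.gaussInt_eq_gaussMero (hc : HasCondExp ψ c) (hz : 0 < z.re + charExp χ) :
    gaussInt μ ψ c χ z = gaussMero μ ψ c χ z := by
  rw [gaussInt, hc.gaussTrunc_eq_sum μ χ hz, hc.gaussTrunc_self μ χ hz, gaussMero]

/-- The subgroup `1 + P ^ m`. -/
def principalUnits (F : Type*) [NontriviallyNormedField F] [IsUltrametricDist F] (m : ℤ) : Set F :=
  (fun x => x - 1) ⁻¹' primePow F m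

lemma isCongrOne_of_mem {m : ℤ} (hm : 1 ≤ m) {x : F} (hx : x ∈ principalUnits F m) :
    IsCongrOne m x := by
  have := isCongrOne_one_add hm hx
  rwa [add_sub_cancel] at this

lemma measurableSet_principalUnits (m : ℤ) : MeasurableSet (principalUnits F m) :=
  (measurable_sub_const _) (measurableSet_primePow m)

lemma measureReal_principalUnits (m : ℤ) :
    μ.real (principalUnits F m) = μ.real (primePow F m) := by
  simp only [Measure.real, principalUnits, sub_eq_add_neg]
  rw [measure_preimage_add_right]

/-- On 1 + P^m both |x| and χ are 1, so the value is nonzero and independent of w. Testing Tate's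
equation on this function isolates the γ-factor, with no convergence condition on w. -/
lemma integral_mellinIntegrand_principalUnits {m : ℤ} (hm : 1 ≤ m) (hm' : conductor χ ≤ m) (w : ℂ) :
    ∫ x, mellinIntegrand w χ ((principalUnits F m).indicator fun _ => 1) x ∂(mulHaar μ) =
      μ.real (primePow F m) := by
  have h : ∀ x : F, (‖x‖⁻¹ : ℝ) * mellinIntegrand w χ ((principalUnits F m).indicator fun _ => 1) x =
      (principalUnits F m).indicator (fun _ => (1 : ℂ)) x := by
    intro x
    rw [mellinIntegrand_eq]
    by_cases hx : x ∈ principalUnits F m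
    · have h1 := isCongrOne_of_mem hm hx
      rw [Set.indicator_of_mem hx, twist_congrOne χ w (h1.mono hm'), h1.1]; simp
    · rw [Set.indicator_of_notMem hx]; simp
  rw [integral_mulHaar]
  simp_rw [h]
  rw [integral_indicator_const _ (measurableSet_principalUnits m), measureReal_principalUnits]
  simp

lemma integrable_mellinIntegrand_principalUnits {m : ℤ} (hm : 1 ≤ m) (hm' : conductor χ ≤ m)
    (w : ℂ) :
    Integrable (mellinIntegrand w χ ((principalUnits F m).indicator fun _ => 1)) (mulHaar μ) := by
  -- A non-integrable function would have integral 0 by convention, but the integral is a positive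
  -- volume.
  by_contra h
  have h1 := integral_mellinIntegrand_principalUnits μ χ hm hm' w
  rw [integral_undef h] at h1
  exact (measureReal_primePow_pos μ m).ne' (by exact_mod_cast h1.symm)

lemma isSchwartz_principalUnits (m : ℤ) :
    IsSchwartz ((principalUnits F m).indicator fun _ => (1 : ℂ)) :=
  isSchwartz_indicator_add 1 m

end Continuation

/-! ### Existence, uniqueness and reflection formula of the Tate γ-factor. -/

section GammaFactor

variable {F : Type*} [NontriviallyNormedField F] [IsUltrametricDist F] [ProperSpace F]
  [hF : Fact (IsNormalizedAbs F)] [MeasurableSpace F] [BorelSpace F]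
  {ψ : AddChar F Circle} {c : ℤ} (χ : Fˣ →ₜ* ℂˣ) {z : ℂ}

lemma meromorphicOn_gaussMero_one_sub (ψ : AddChar F Circle) (c : ℤ) (μ : Measure F)
    [μ.IsAddHaarMeasure] : MeromorphicOn (fun s => gaussMero μ ψ c χ (1 - s)) Set.univ :=
  fun s _ => (meromorphicAt_gaussMero μ χ ψ c (1 - s)).comp_analyticAt
    (g := fun s : ℂ => 1 - s) (by fun_prop)

lemma analyticAt_gaussMero_one_sub (ψ : AddChar F Circle) (c : ℤ) (μ : Measure F)
    [μ.IsAddHaarMeasure] {s : ℂ} (hs : (1 - s).re + charExp χ ≠ 0) :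
    AnalyticAt ℂ (fun s => gaussMero μ ψ c χ (1 - s)) s :=
  (analyticAt_gaussMero μ χ ψ c hs).fun_comp (f := fun s : ℂ => 1 - s) (by fun_prop)

/-- The explicit Tate `γ`-factor. -/
def gammaFactor (ψ : AddChar F Circle) (c : ℤ) (χ : Fˣ →ₜ* ℂˣ) : ℂ → ℂ :=
  toMeromorphicNFOn (fun s => gaussMero (selfDualMeasure ψ) ψ c χ⁻¹ (1 - s)) Set.univ

lemma inv_inv_char : (χ⁻¹)⁻¹ = χ := inv_inv χ

lemma HasCondExp.gammaFactor_eq (hc : HasCondExp ψ c) {s : ℂ} (hs : s.re + charExp χ ≠ 1) :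
    gammaFactor ψ c χ s = gaussMero (selfDualMeasure ψ) ψ c χ⁻¹ (1 - s) := by
  have := hc.isAddHaarMeasure
  refine toMeromorphicNFOn_apply_of_analyticAt (meromorphicOn_gaussMero_one_sub χ⁻¹ ψ c _)
    (analyticAt_gaussMero_one_sub χ⁻¹ ψ c _ ?_)
  rw [charExp_inv, Complex.sub_re, Complex.one_re]
  intro h; exact hs (by linarith)

lemma HasCondExp.isTateGamma_gammaFactor (hc : HasCondExp ψ c) :
    IsTateGamma χ ψ (gammaFactor ψ c χ) := by
  have := hc.isAddHaarMeasure
  refine ⟨meromorphicNFOn_toMeromorphicNFOn _ _, -charExp χ, 1 - charExp χ, by linarith,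
    fun φ hφ s h1 h2 => ?_⟩
  have hz : 0 < (1 - s).re + charExp χ⁻¹ := by
    rw [charExp_inv, Complex.sub_re, Complex.one_re]; linarith
  have hi1 : Integrable (mellinIntegrand s χ φ) (mulMeasure ψ) :=
    hφ.integrable_mellinIntegrand _ χ (by linarith)
  have hi2 : Integrable (mellinIntegrand (1 - s) χ⁻¹ (fourier ψ φ)) (mulMeasure ψ) :=
    (hc.isSchwartz_fourierWith _ hφ).integrable_mellinIntegrand _ χ⁻¹ hz
  refine ⟨hi1, hi2, ?_⟩
  have h := hc.tate_functional_equation (selfDualMeasure ψ) χ⁻¹ hφ hz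
    (by rw [inv_inv_char, sub_sub_cancel]; exact hi1)
  rw [inv_inv_char, sub_sub_cancel, hc.gaussInt_eq_gaussMero _ _ hz, ← hc.gammaFactor_eq χ
    (by linarith)] at h
  exact h

lemma HasCondExp.eq_gammaFactor (hc : HasCondExp ψ c) {g : ℂ → ℂ} (hg : IsTateGamma χ ψ g) :
    g = gammaFactor ψ c χ := by
  have := hc.isAddHaarMeasure
  set μ := selfDualMeasure ψ
  obtain ⟨hNF, a, b, hab, H⟩ := hg
  have hNF2 : MeromorphicNFOn (gammaFactor ψ c χ) Set.univ := meromorphicNFOn_toMeromorphicNFOn _ _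
  have agree : ∀ s : ℂ, a < s.re → s.re < b → g s - gammaFactor ψ c χ s = 0 := by
    intro s hs1 hs2
    obtain ⟨h1, h2, -⟩ := H _ (isSchwartz_indicator 0) s hs1 hs2
    -- Integrability for the indicator of O and for its Fourier transform, a multiple of the
    -- indicator of P^c, forces the given strip to lie inside 0 < Re(s) + ρ < 1, where ρ is the
    -- exponent of χ.
    have hpos : 0 < s.re + charExp χ := by
      rw [← integrableOn_twist χ μ 0, ← integrable_indicator_iff (measurableSet_primePow 0)]
      refine h1.congr (Eventually.of_forall fun x => ?_)
      simp only [mellinIntegrand_eq]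
      by_cases hx : x ∈ primePow F 0 <;> simp [hx]
    have hz : 0 < (1 - s).re + charExp χ⁻¹ := by
      rw [← integrableOn_twist χ⁻¹ μ (c - 0), ← integrable_indicator_iff (measurableSet_primePow _)]
      have hm := (measureReal_primePow_pos μ 0).ne'
      refine (h2.const_mul ((μ.real (primePow F 0) : ℂ)⁻¹)).congr (Eventually.of_forall fun x => ?_)
      have e : fourier ψ ((primePow F 0).indicator fun _ => (1 : ℂ)) x =
          (primePow F (c - 0)).indicator (fun _ => (μ.real (primePow F 0) : ℂ)) x := by
        have := hc.fourierWith_indicator_add μ 0 0 x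
        simpa using! this
      simp only [mellinIntegrand_eq, e]
      by_cases hx : x ∈ primePow F (c - 0)
      · rw [Set.indicator_of_mem hx, Set.indicator_of_mem hx, inv_mul_cancel_left₀]
        exact_mod_cast hm
      · rw [Set.indicator_of_notMem hx, Set.indicator_of_notMem hx]; simp
    have hz' := hz
    rw [charExp_inv, Complex.sub_re, Complex.one_re] at hz'
    have hφ := isSchwartz_principalUnits (F := F) (condLevel χ)
    obtain ⟨h3, h4, h5⟩ := H _ hφ s hs1 hs2
    have h6 := hc.tate_functional_equation μ χ⁻¹ hφ hz
      (by rw [inv_inv_char, sub_sub_cancel]; exact h3)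
    rw [inv_inv_char, sub_sub_cancel, hc.gaussInt_eq_gaussMero _ _ hz, ← hc.gammaFactor_eq χ
      (by linarith)] at h6
    have h7 : g s * mellinInt ψ s χ ((principalUnits F (condLevel χ)).indicator fun _ => 1) =
        gammaFactor ψ c χ s *
          mellinInt ψ s χ ((principalUnits F (condLevel χ)).indicator fun _ => 1) :=
      h5.symm.trans h6
    have h8 : mellinInt ψ s χ ((principalUnits F (condLevel χ)).indicator fun _ => 1) ≠ 0 := by
      have e := integral_mellinIntegrand_principalUnits μ χ (one_le_condLevel χ)
        (by exact_mod_cast le_max_left _ _) s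
      rw [mellinInt, mulMeasure_eq, e]
      exact_mod_cast (measureReal_primePow_pos μ _).ne'
    rw [mul_right_cancel₀ h8 h7, sub_self]
  ext z
  have h1 := eventually_eq_zero_of_meromorphicOn (f := fun s => g s - gammaFactor ψ c χ s)
    (fun s hs => (hNF.meromorphicOn s hs).sub (hNF2.meromorphicOn s hs)) hab agree z
  have h2 : g =ᶠ[𝓝[≠] z] gammaFactor ψ c χ := by
    filter_upwards [h1] with w hw using sub_eq_zero.mp hw
  -- Normal form extends the equality from the punctured neighbourhood to z itself, poles included.
  exact (((hNF (Set.mem_univ z)).eventuallyEq_nhdsNE_iff_eventuallyEq_nhds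
    (hNF2 (Set.mem_univ z))).mp h2).eq_of_nhds

lemma HasCondExp.tateGamma_eq (hc : HasCondExp ψ c) {s : ℂ} (hs : s.re + charExp χ ≠ 1) :
    tateGamma s χ ψ = gaussMero (selfDualMeasure ψ) ψ c χ⁻¹ (1 - s) := by
  have h : ∃ g, IsTateGamma χ ψ g := ⟨_, hc.isTateGamma_gammaFactor χ⟩
  rw [tateGamma, dif_pos h, hc.eq_gammaFactor χ h.choose_spec, hc.gammaFactor_eq χ hs]

lemma extendZero_neg_one : extendZero χ (-1 : F) = (χ (-1) : ℂ) := by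
  rw [← extendZero_units]; simp

lemma twist_neg (z : ℂ) (x : F) : twist χ z (-x) = (χ (-1) : ℂ) * twist χ z x := by
  rw [← neg_one_mul, twist_mul]
  congr 1
  rw [twist, extendZero_neg_one]; simp

/-- In the critical strip, Tate's equation applied to φ and then to φ^ returns φ(-x), and x ↦ -x
costs χ(-1). The identity theorem carries the relation beyond the strip. -/
lemma HasCondExp.gaussMero_reflection (hc : HasCondExp ψ c) (h0 : z.re + charExp χ ≠ 0)
    (h1 : z.re + charExp χ ≠ 1) :
    gaussMero (selfDualMeasure ψ) ψ c χ z * gaussMero (selfDualMeasure ψ) ψ c χ⁻¹ (1 - z) =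
      (χ (-1) : ℂ) := by
  have := hc.isAddHaarMeasure
  set μ := selfDualMeasure ψ
  rw [← sub_eq_zero]
  have hre : ∀ s : ℂ, (1 - s).re + charExp χ⁻¹ = 1 - (s.re + charExp χ) := fun s => by
    rw [charExp_inv, Complex.sub_re, Complex.one_re]; ring
  refine eq_zero_of_meromorphicOn (z := z) (f := fun z => gaussMero μ ψ c χ z *
    gaussMero μ ψ c χ⁻¹ (1 - z) - (χ (-1) : ℂ)) (a := -charExp χ) (b := 1 - charExp χ) ?_ (by linarith)
    ?_ ?_
  · exact fun s hs => ((meromorphicAt_gaussMero μ χ ψ c s).mul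
      (meromorphicOn_gaussMero_one_sub χ⁻¹ ψ c μ s hs)).sub (MeromorphicAt.const _ _)
  · intro s hs1 hs2
    have hz : 0 < s.re + charExp χ := by linarith
    have hz2 : 0 < (1 - s).re + charExp χ⁻¹ := by rw [hre]; linarith
    have hφ := isSchwartz_principalUnits (F := F) (condLevel χ⁻¹)
    have hφ2 := hc.isSchwartz_fourierWith μ hφ
    set φ := (principalUnits F (condLevel χ⁻¹)).indicator fun _ => (1 : ℂ)
    have e1 := hc.tate_functional_equation μ χ hφ hz
      (hφ.integrable_mellinIntegrand μ χ⁻¹ hz2)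
    have e2 := hc.tate_functional_equation μ χ⁻¹ hφ2 hz2
      (by rw [inv_inv_char, sub_sub_cancel]; exact hφ2.integrable_mellinIntegrand μ χ hz)
    rw [inv_inv_char, sub_sub_cancel, e1] at e2
    have e3 : ∫ x, mellinIntegrand (1 - s) χ⁻¹ (fourierWith ψ μ (fourierWith ψ μ φ)) x ∂(mulHaar μ) =
        (χ (-1) : ℂ) * ∫ x, mellinIntegrand (1 - s) χ⁻¹ φ x ∂(mulHaar μ) := by
      rw [← (measurePreserving_mul_left μ (neg_ne_zero.mpr one_ne_zero)).integral_comp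
        (measurableEmbedding_mul_left (neg_ne_zero.mpr one_ne_zero)), ← integral_const_mul]
      refine integral_congr_ae (Eventually.of_forall fun x => ?_)
      have hinv : ((χ⁻¹ (-1 : Fˣ) : ℂˣ) : ℂ) = (χ (-1) : ℂ) := by
        have h2 : χ (-1) * χ (-1) = 1 := by rw [← map_mul]; simp
        have h3 : (χ⁻¹) (-1) = (χ (-1))⁻¹ := rfl
        rw [h3, inv_eq_of_mul_eq_one_left h2]
      simp only [mellinIntegrand_eq, neg_one_mul]
      rw [hc.isSelfDual_selfDualMeasure.2 φ hφ, neg_neg, twist_neg, hinv]; ring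
    have hne : ∫ x, mellinIntegrand (1 - s) χ⁻¹ φ x ∂(mulHaar μ) ≠ 0 := by
      rw [integral_mellinIntegrand_principalUnits μ χ⁻¹ (one_le_condLevel _)
        (by exact_mod_cast le_max_left _ _)]
      exact_mod_cast (measureReal_primePow_pos μ _).ne'
    rw [e3, ← mul_assoc, hc.gaussInt_eq_gaussMero μ χ hz, hc.gaussInt_eq_gaussMero μ χ⁻¹ hz2] at e2
    have := mul_right_cancel₀ hne e2
    rw [this, mul_comm, sub_self]
  · refine (((analyticAt_gaussMero μ χ ψ c h0).mul (analyticAt_gaussMero_one_sub χ⁻¹ ψ c μ ?_)).sub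
      analyticAt_const).continuousAt
    rw [hre]; intro h; exact h1 (by linarith)

/-- For `Re s` large the Tate `γ`-factor is the inverse of a convergent Gauss integral. -/
lemma HasCondExp.gaussInt_mul_tateGamma (hc : HasCondExp ψ c) {s : ℂ} (hs : 1 < s.re + charExp χ) :
    gaussInt (selfDualMeasure ψ) ψ c χ s * tateGamma s χ ψ = (χ (-1) : ℂ) := by
  have := hc.isAddHaarMeasure
  rw [hc.tateGamma_eq χ hs.ne', hc.gaussInt_eq_gaussMero _ _ (by linarith),
    hc.gaussMero_reflection χ (by linarith) hs.ne']

end GammaFactor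

/-! ### Squares among the principal units. -/

section Squares

variable {F : Type*} [NontriviallyNormedField F] [IsUltrametricDist F] [ProperSpace F]
  [hF : Fact (IsNormalizedAbs F)]

/-- The solution is the fixed point of t ↦ w - t², a contraction of P by the factor q⁻¹ because |a +
b| ≤ q⁻¹ there. -/
lemma exists_add_sq_eq {w : F} (hw : w ∈ primePow F 1) : ∃ t ∈ primePow F 1, t + t ^ 2 = w := by
  have hq : (resCard F : ℝ)⁻¹ < 1 := inv_lt_one_of_one_lt₀ (one_lt_resCard_real F)
  have hmul : ∀ {a b : F}, a ∈ primePow F 1 → b ∈ primePow F 1 → a * b ∈ primePow F 1 :=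
    fun ha hb => primePow_antitone (by norm_num) (mul_mem_primePow ha hb)
  have hmaps : Set.MapsTo (fun t => w - t ^ 2) (primePow F 1) (primePow F 1) := fun t ht =>
    sub_mem_primePow hw (by rw [sq]; exact hmul ht ht)
  have hcontr : ContractingWith (resCard F : NNReal)⁻¹ (hmaps.restrict _ _ _) := by
    refine ⟨by rw [← NNReal.coe_lt_coe]; simpa using hq, LipschitzWith.of_dist_le_mul ?_⟩
    rintro ⟨a, ha⟩ ⟨b, hb⟩
    have h1 : ‖b + a‖ ≤ (resCard F : ℝ)⁻¹ := by
      simpa [mem_primePow] using add_mem_primePow hb ha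
    simp only [Subtype.dist_eq, Set.MapsTo.val_restrict_apply, dist_eq_norm]
    have h2 : w - a ^ 2 - (w - b ^ 2) = (b + a) * (b - a) := by ring
    rw [h2, norm_mul, norm_sub_rev b a]
    exact mul_le_mul_of_nonneg_right (by simpa using h1) (norm_nonneg _)
  obtain ⟨t, ht, hfix, -⟩ := hcontr.exists_fixedPoint' (isCompact_primePow 1).isComplete hmaps
    (zero_mem_primePow 1) (edist_ne_top _ _)
  refine ⟨t, ht, ?_⟩
  have : w - t ^ 2 = t := hfix
  linear_combination -this

variable [CharZero F]

variable (F) in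
lemma exists_two_mem_shell : ∃ e : ℕ, (2 : F) ∈ shell F e ∧ twoExp F = e := by
  obtain ⟨n, hn⟩ := exists_mem_shell (2 : F) two_ne_zero
  have h2 : ‖(2 : F)‖ ≤ 1 := by
    have := IsUltrametricDist.norm_add_le_max (1 : F) 1
    rw [one_add_one_eq_two] at this
    simpa using this
  have h0 : 0 ≤ n := by
    rw [mem_shell.mp hn, ← zpow_zero (resCard F : ℝ), zpow_resCard_le] at h2; omega
  obtain ⟨e, rfl⟩ := Int.eq_ofNat_of_zero_le h0
  refine ⟨e, hn, ?_⟩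
  rw [twoExp, mem_shell.mp hn, ← Real.rpow_intCast,
    Real.logb_rpow (resCard_pos F) (one_lt_resCard_real F).ne']
  simp

/-- Use (1 + 2t)² = 1 + 4(t + t²). Since 4 has valuation 2e, the hypothesis puts (u - 1)/4 in P;
this is the origin of 2e + 1 in the theorem. -/
lemma IsCongrOne.exists_sq {e : ℕ} (he : (2 : F) ∈ shell F e) {u : F}
    (hu : IsCongrOne (2 * e + 1) u) : ∃ b : F, ‖b‖ = 1 ∧ u = b ^ 2 := by
  have h4 : (4 : F) ∈ shell F (e + e) := by
    have : (4 : F) = 2 * 2 := by norm_num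
    rw [this]; exact (mul_mem_shell_iff he).mpr he
  have h40 := ne_zero_of_mem_shell h4
  obtain ⟨t, ht, hteq⟩ := exists_add_sq_eq (w := 4⁻¹ * (u - 1)) (by
    rw [← mul_mem_primePow_iff h4, mul_inv_cancel_left₀ h40, ← two_mul]; exact hu.2)
  refine ⟨1 + 2 * t, ?_, ?_⟩
  · refine (isCongrOne_one_add le_rfl ?_).1
    exact primePow_antitone (by omega) (mul_mem_primePow (mem_shell.mp he).le ht)
  · have h5 : (1 + 2 * t) ^ 2 = 1 + 4 * (t + t ^ 2) := by ring
    rw [h5, hteq, mul_inv_cancel_left₀ h40]; ring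

end Squares

/-! ### The Weil index and Weil's formula. -/

section WeilIndex

variable {F : Type*} [NontriviallyNormedField F] [IsUltrametricDist F] [ProperSpace F]
  [hF : Fact (IsNormalizedAbs F)] [MeasurableSpace F] [BorelSpace F]
  (μ : Measure F) [μ.IsAddHaarMeasure] {ψ : AddChar F Circle} {c : ℤ} {φ : F → ℂ}

/-- The quadratic Gauss integral `∫ ψ(x u²) du` over `P ^ n`. -/
def quadInt (μ : Measure F) (ψ : AddChar F Circle) (x : F) (n : ℤ) : ℂ :=
  ∫ u in primePow F n, (ψ (x * u ^ 2) : ℂ) ∂μ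

lemma isFiniteMeasure_restrict_primePow (n : ℤ) : IsFiniteMeasure (μ.restrict (primePow F n)) :=
  ⟨by rw [Measure.restrict_apply_univ]; exact measure_primePow_lt_top μ _⟩

variable [CharZero F]

/-- Insert Fourier inversion for φ and complete the square: xb² - bw = x(b - w/(2x))² - w²/(4x). The
shift by w/(2x) is absorbed by the ball, leaving a quadratic Gauss integral independent of w. -/
lemma HasCondExp.weil_formula (hc : HasCondExp ψ c) (hsd : IsSelfDual ψ μ) (hφ : IsSchwartz φ)
    {x : F} (hx : x ≠ 0) : ∃ N : ℤ, ∀ n ≤ N, ∫ b, φ b * (ψ (x * b ^ 2) : ℂ) ∂μ =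
      quadInt μ ψ x n * ∫ w, fourierWith ψ μ φ w * (ψ (-(w ^ 2 / (4 * x))) : ℂ) ∂μ := by
  obtain ⟨N₁, hN₁⟩ := hφ.exists_support
  have hφ2 := hc.isSchwartz_fourierWith μ hφ
  obtain ⟨N₂, hN₂⟩ := hφ2.exists_support
  have h2x : 2 * x ≠ 0 := mul_ne_zero two_ne_zero hx
  obtain ⟨k, hk⟩ := exists_mem_shell _ h2x
  -- The ball P^n must contain the support of φ and every w/(2x) with w in the support of φ^.
  refine ⟨min N₁ (N₂ - k), fun n hn => ?_⟩
  have hcc := hc.continuous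
  have e1 : ∫ b, φ b * (ψ (x * b ^ 2) : ℂ) ∂μ =
      ∫ b in primePow F n, ∫ w, fourierWith ψ μ φ w * (ψ (-b * w) : ℂ) * (ψ (x * b ^ 2) : ℂ) ∂μ ∂μ := by
    rw [← integral_indicator (measurableSet_primePow n)]
    refine integral_congr_ae (Eventually.of_forall fun b => ?_)
    simp only
    by_cases hb : b ∈ primePow F n
    · rw [Set.indicator_of_mem hb, integral_mul_const]
      have := hsd.2 φ hφ (-b)
      rw [neg_neg] at this
      rw [← this]; rfl
    · rw [Set.indicator_of_notMem hb, hN₁ n (by omega) b hb, zero_mul]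
  rw [e1, integral_integral_swap]
  · rw [← integral_const_mul]
    refine integral_congr_ae (Eventually.of_forall fun w => ?_)
    simp only
    by_cases hw : w ∈ primePow F N₂
    · have hsh : -(w / (2 * x)) ∈ primePow F n := by
        rw [neg_mem_primePow, ← mul_mem_primePow_iff hk, mul_div_cancel₀ _ h2x]
        exact primePow_antitone (by omega) hw
      have hq : quadInt μ ψ x n = ∫ b in primePow F n, (ψ (x * (b + -(w / (2 * x))) ^ 2) : ℂ) ∂μ :=
        (setIntegral_comp_add_right μ (measurableSet_primePow n)
          (fun y => add_mem_primePow_iff hsh) _).symm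
      rw [hq, ← integral_mul_const]
      refine integral_congr_ae (Eventually.of_forall fun b => ?_)
      simp only
      have : x * (b + -(w / (2 * x))) ^ 2 + -(w ^ 2 / (4 * x)) + w ^ 2 / (2 * x) =
        -b * w + x * b ^ 2 + w ^ 2 / (2 * x) := by field_simp; ring
      have := add_right_cancel this
      rw [mul_left_comm, ← coe_map_add, this, coe_map_add, mul_assoc]
    · rw [hN₂ N₂ le_rfl w hw]; simp
  · have := isFiniteMeasure_restrict_primePow μ n
    have hi : Integrable (fun p : F × F => (1 : ℂ) * fourierWith ψ μ φ p.2)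
        ((μ.restrict (primePow F n)).prod μ) :=
      Integrable.mul_prod (integrable_const (1 : ℂ)) (hφ2.integrable μ)
    have := hi.bdd_mul (f := fun p : F × F => (ψ (-p.1 * p.2) : ℂ) * (ψ (x * p.1 ^ 2) : ℂ)) (c := 1)
      (Continuous.aestronglyMeasurable (by fun_prop)) (Eventually.of_forall fun p => by
        rw [norm_mul, Circle.norm_coe, Circle.norm_coe, one_mul])
    refine this.congr (Eventually.of_forall fun p => ?_)
    simp only [Function.uncurry]; ring

/-- Apply Weil's formula to the indicator of P^j, with j so negative that ψ(-w²/(4x)) = 1 on the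
support of its transform. The last integral is then 1, and the left side does not involve n. -/
lemma HasCondExp.quadInt_stable (hc : HasCondExp ψ c) (hsd : IsSelfDual ψ μ) {x : F} (hx : x ≠ 0) :
    ∃ g, ∃ N : ℤ, ∀ n ≤ N, quadInt μ ψ x n = g := by
  have h4x : 4 * x ≠ 0 := mul_ne_zero (by norm_num) hx
  obtain ⟨k, hk⟩ := exists_mem_shell _ h4x
  let j : ℤ := min c 0 - |k|
  have hj : c + k ≤ (c - j) + (c - j) := by
    have := le_abs_self k
    have := abs_nonneg k
    simp only [j]; omega
  obtain ⟨N, hN⟩ := hc.weil_formula μ hsd (isSchwartz_indicator j) hx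
  refine ⟨_, N, fun n hn => (Eq.trans ?_ (hN n hn).symm)⟩
  have hone : ∫ w, fourierWith ψ μ ((primePow F j).indicator fun _ => 1) w *
      (ψ (-(w ^ 2 / (4 * x))) : ℂ) ∂μ = 1 := by
    have e : ∀ w, fourierWith ψ μ ((primePow F j).indicator fun _ => 1) w *
      (ψ (-(w ^ 2 / (4 * x))) : ℂ) =
        (primePow F (c - j)).indicator (fun _ => (μ.real (primePow F j) : ℂ)) w := by
      intro w
      have h1 : fourierWith ψ μ ((primePow F j).indicator fun _ => 1) w =
          (primePow F (c - j)).indicator (fun _ => (μ.real (primePow F j) : ℂ)) w := by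
        simpa using! hc.fourierWith_indicator_add μ 0 j w
      rw [h1]
      by_cases hw : w ∈ primePow F (c - j)
      · have h2 : -(w ^ 2 / (4 * x)) ∈ primePow F c := by
          rw [neg_mem_primePow, ← mul_mem_primePow_iff hk, mul_div_cancel₀ _ h4x, sq]
          exact primePow_antitone (by omega) (mul_mem_primePow hw hw)
        rw [hc.1 _ h2]; simp
      · simp [hw]
    simp_rw [e]
    rw [integral_indicator_const _ (measurableSet_primePow _), Complex.real_smul,
      ← Complex.ofReal_mul, mul_comm, hsd.measure_mul μ hc, Complex.ofReal_one]
  rw [hone, mul_one]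

/-- The square root compares the self-dual measures of ψ_{2x} and ψ, so Weil indices for different x
are computed with one fixed measure. -/
lemma HasCondExp.weilIndex_mulShift (hc : HasCondExp ψ c) {x : F} (hx : x ≠ 0) :
    ∃ N : ℤ, ∀ n ≤ N, weilIndex (ψ.mulShift x) =
      (√‖2 * x‖ : ℝ) * quadInt (selfDualMeasure ψ) ψ x n := by
  have := hc.isAddHaarMeasure
  obtain ⟨g, N, hN⟩ := hc.quadInt_stable _ hc.isSelfDual_selfDualMeasure hx
  refine ⟨N, fun n hn => ?_⟩
  rw [hN n hn, weilIndex]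
  refine Tendsto.limUnder_eq (tendsto_const_nhds.congr' ?_)
  filter_upwards [eventually_ge_atTop (-N).toNat] with r hr
  have h1 : (ψ.mulShift x).mulShift 2 = ψ.mulShift (2 * x) := by
    ext y; simp only [AddChar.mulShift_apply]; congr 2; ring
  rw [h1, hc.selfDualMeasure_mulShift (mul_ne_zero two_ne_zero hx), Measure.restrict_smul,
    integral_smul_measure, ENNReal.toReal_ofReal (Real.sqrt_nonneg _), Complex.real_smul,
    ← hN (-(r : ℤ)) (by omega)]
  rfl

lemma quadInt_neg (x : F) (n : ℤ) : quadInt μ ψ (-x) n = starRingEnd ℂ (quadInt μ ψ x n) := by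
  rw [quadInt, quadInt, ← integral_conj]
  refine integral_congr_ae (Eventually.of_forall fun u => ?_)
  simp only
  rw [neg_mul, AddChar.map_neg_eq_inv, Circle.coe_inv_eq_conj]

/-- Substitute u = t + b in x(u² - b²) to get xt² + 2xtb. Integrating over b confines t to a ball so
small that ψ(xt²) = 1, and self-duality evaluates the product of volumes. -/
lemma HasCondExp.quadInt_mul_quadInt_neg (hc : HasCondExp ψ c) (hsd : IsSelfDual ψ μ) {x : F}
    (hx : x ≠ 0) : ∃ N : ℤ, ∀ n ≤ N,
      quadInt μ ψ x n * quadInt μ ψ (-x) n = (‖2 * x‖⁻¹ : ℝ) := by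
  classical
  have h2x : 2 * x ≠ 0 := mul_ne_zero two_ne_zero hx
  obtain ⟨k, hk⟩ := exists_mem_shell _ h2x
  obtain ⟨l, hl⟩ := exists_mem_shell _ hx
  have hcc := hc.continuous
  -- A crude bound securing both n ≤ c - n - k and l + 2(c - n - k) ≥ c.
  refine ⟨min (c - k) 0 - |c| - |k| - |l|, fun n hn => ?_⟩
  have hkc := neg_abs_le c
  have hkc2 := le_abs_self c
  have hkk := neg_abs_le k
  have hkk2 := le_abs_self k
  have hll := neg_abs_le l
  have hll2 := le_abs_self l
  have hfin := isFiniteMeasure_restrict_primePow μ n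
  have e1 : quadInt μ ψ x n * quadInt μ ψ (-x) n = ∫ b in primePow F n, ∫ t in primePow F n,
      (ψ (x * t ^ 2) : ℂ) * (ψ (2 * x * t * b) : ℂ) ∂μ ∂μ := by
    rw [mul_comm, quadInt, ← integral_mul_const]
    refine setIntegral_congr_fun (measurableSet_primePow n) fun b hb => ?_
    rw [quadInt, ← setIntegral_comp_add_right μ (measurableSet_primePow n)
      (fun y => add_mem_primePow_iff hb), ← integral_const_mul]
    refine integral_congr_ae (Eventually.of_forall fun t => ?_)
    simp only
    rw [← coe_map_add, ← coe_map_add]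
    congr 2; ring
  rw [e1, integral_integral_swap]
  · have e2 : ∀ t, ∫ b in primePow F n, (ψ (x * t ^ 2) : ℂ) * (ψ (2 * x * t * b) : ℂ) ∂μ =
        (primePow F (c - n - k)).indicator (fun _ => (μ.real (primePow F n) : ℂ)) t := by
      intro t
      rw [integral_const_mul, hc.integral_primePow μ]
      have hiff : 2 * x * t ∈ primePow F (c - n) ↔ t ∈ primePow F (c - n - k) := by
        have := mul_mem_primePow_iff hk (x := t) (n := c - n - k)
        rwa [show k + (c - n - k) = c - n by ring] at this
      by_cases ht : t ∈ primePow F (c - n - k)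
      · have h3 : x * t ^ 2 ∈ primePow F c := by
          rw [sq]
          exact primePow_antitone (by omega) ((mul_mem_primePow_iff hl).mpr (mul_mem_primePow ht ht))
        rw [if_pos (hiff.mpr ht), Set.indicator_of_mem ht, hc.1 _ h3]; simp
      · rw [if_neg (mt hiff.mp ht), Set.indicator_of_notMem ht, mul_zero]
    simp_rw [e2]
    rw [setIntegral_indicator (measurableSet_primePow _),
      Set.inter_eq_right.mpr (primePow_antitone (by omega)), setIntegral_const, Complex.real_smul,
      ← Complex.ofReal_mul]
    congr 1
    have h5 := hsd.measure_mul μ hc n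
    have h6 : μ.real (primePow F (c - n - k)) =
        (resCard F : ℝ) ^ k * μ.real (primePow F (c - n)) := by
      rw [measureReal_primePow μ (c - n - k), measureReal_primePow μ (c - n), ← mul_assoc,
        ← zpow_add₀ (resCard_ne_zero F)]
      congr 2; ring
    rw [h6, mem_shell.mp hk, ← zpow_neg, neg_neg, mul_assoc, mul_comm (μ.real _), h5, mul_one]
  · have hi : Integrable (fun p : F × F => (1 : ℂ))
        ((μ.restrict (primePow F n)).prod (μ.restrict (primePow F n))) := integrable_const 1
    have := hi.bdd_mul (f := fun p : F × F => (ψ (x * p.2 ^ 2) : ℂ) * (ψ (2 * x * p.2 * p.1) : ℂ))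
      (c := 1) (Continuous.aestronglyMeasurable (by fun_prop)) (Eventually.of_forall fun p => by
        rw [norm_mul, Circle.norm_coe, Circle.norm_coe, one_mul])
    refine this.congr (Eventually.of_forall fun p => ?_)
    simp only [Function.uncurry]; ring

lemma HasCondExp.weilIndex_mul_neg (hc : HasCondExp ψ c) {x : F} (hx : x ≠ 0) :
    weilIndex (ψ.mulShift x) * weilIndex (ψ.mulShift (-x)) = 1 := by
  have := hc.isAddHaarMeasure
  obtain ⟨N₁, h1⟩ := hc.weilIndex_mulShift hx
  obtain ⟨N₂, h2⟩ := hc.weilIndex_mulShift (neg_ne_zero.mpr hx)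
  obtain ⟨N₃, h3⟩ := hc.quadInt_mul_quadInt_neg _ hc.isSelfDual_selfDualMeasure hx
  let n := min N₁ (min N₂ N₃)
  rw [h1 n (by omega), h2 n (by omega), mul_mul_mul_comm, h3 n (by omega), mul_neg, norm_neg,
    ← Complex.ofReal_mul, ← Complex.ofReal_mul, Real.mul_self_sqrt (norm_nonneg _),
    mul_inv_cancel₀ (norm_ne_zero_iff.mpr (mul_ne_zero two_ne_zero hx)), Complex.ofReal_one]

lemma HasCondExp.norm_weilIndex (hc : HasCondExp ψ c) {x : F} (hx : x ≠ 0) :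
    ‖weilIndex (ψ.mulShift x)‖ = 1 := by
  have := hc.isAddHaarMeasure
  obtain ⟨N₁, h1⟩ := hc.weilIndex_mulShift hx
  obtain ⟨N₂, h2⟩ := hc.weilIndex_mulShift (neg_ne_zero.mpr hx)
  let n := min N₁ N₂
  have h := hc.weilIndex_mul_neg hx
  have hconj : weilIndex (ψ.mulShift (-x)) = starRingEnd ℂ (weilIndex (ψ.mulShift x)) := by
    rw [h1 n (by omega), h2 n (by omega), quadInt_neg, map_mul, Complex.conj_ofReal, mul_neg, norm_neg]
  rw [hconj, Complex.mul_conj, Complex.normSq_eq_norm_sq] at h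
  have h4 : ‖weilIndex (ψ.mulShift x)‖ ^ 2 = 1 := by exact_mod_cast h
  exact (pow_eq_one_iff_of_nonneg (norm_nonneg _) two_ne_zero).mp h4

lemma HasCondExp.weilIndex_ne_zero (hc : HasCondExp ψ c) {x : F} (hx : x ≠ 0) :
    weilIndex (ψ.mulShift x) ≠ 0 := by
  rw [← norm_ne_zero_iff, hc.norm_weilIndex hx]; exact one_ne_zero

lemma quadInt_mul_sq (x : F) {b : F} (hb : ‖b‖ = 1) (n : ℤ) :
    quadInt μ ψ (x * b ^ 2) n = quadInt μ ψ x n := by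
  have hb0 : b ≠ 0 := by rw [← norm_pos_iff, hb]; exact one_pos
  have hbs : b ∈ shell F 0 := by simpa [mem_shell] using hb
  have h := integral_comp_mul_left μ hb0
    ((primePow F n).indicator fun u => (ψ (x * u ^ 2) : ℂ))
  rw [hb, inv_one, Complex.ofReal_one, one_mul, integral_indicator (measurableSet_primePow n)] at h
  rw [quadInt, quadInt, ← h, ← integral_indicator (measurableSet_primePow n)]
  refine integral_congr_ae (Eventually.of_forall fun u => ?_)
  refine indicator_eq_indicator ?_ fun _ => ?_
  · have := mul_mem_primePow_iff hbs (x := u) (n := n)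
    rw [zero_add] at this; exact this.symm
  · congr 2; ring

/-- Such a u is the square of a unit b, and u ↦ bu preserves both the ball and the measure. -/
lemma HasCondExp.congrInvariant_weilIndex (hc : HasCondExp ψ c) {e : ℕ} (he : (2 : F) ∈ shell F e) :
    CongrInvariant (2 * e + 1) fun x : F => weilIndex (ψ.mulShift x) := by
  intro x u hx hu
  obtain ⟨b, hb, rfl⟩ := hu.exists_sq he
  have hb0 : b ≠ 0 := by rw [← norm_pos_iff, hb]; exact one_pos
  have := hc.isAddHaarMeasure
  obtain ⟨N₁, h1⟩ := hc.weilIndex_mulShift hx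
  obtain ⟨N₂, h2⟩ := hc.weilIndex_mulShift (mul_ne_zero hx (pow_ne_zero 2 hb0))
  simp only
  rw [h1 (min N₁ N₂) (by omega), h2 (min N₁ N₂) (by omega), quadInt_mul_sq _ _ hb]
  simp [hb]

lemma CongrInvariant.measurable {m : ℤ} {f : F → ℂ} (hf : CongrInvariant m f) : Measurable f := by
  refine measurable_of_continuousOn_compl_singleton 0 fun x hx => ContinuousAt.continuousWithinAt ?_
  have hx0 : x ≠ 0 := hx
  refine (continuousAt_const (y := f x)).congr ?_
  have : (fun y => x⁻¹ * y - 1) ⁻¹' primePow F (max m 1) ∈ 𝓝 x :=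
    (by fun_prop : Continuous fun y => x⁻¹ * y - 1).continuousAt.preimage_mem_nhds
      ((isOpen_primePow _).mem_nhds (by simp [hx0, zero_mem_primePow]))
  filter_upwards [this] with y hy
  have h1 := isCongrOne_one_add (le_max_right m 1) hy
  rw [add_sub_cancel] at h1
  have := hf x _ hx0 (h1.mono (le_max_left m 1))
  rw [mul_inv_cancel_left₀ hx0] at this
  exact this.symm

end WeilIndex

/-! ### Functional equation for the image of a measure under a quadratic map. -/

section QuadraticFourier

variable {F : Type*} [NontriviallyNormedField F] [IsUltrametricDist F] [ProperSpace F]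
  [hF : Fact (IsNormalizedAbs F)] [MeasurableSpace F] [BorelSpace F]
  (μ : Measure F) [μ.IsAddHaarMeasure] {ψ : AddChar F Circle} {c : ℤ} {ξ : F → ℂ}

/-- The Fourier transform of the image of the measure `ξ(w) dw` under `w ↦ -w² / 4`. -/
def quadFourier (μ : Measure F) (ψ : AddChar F Circle) (ξ : F → ℂ) (v : F) : ℂ :=
  ∫ w, ξ w * (ψ (-(w ^ 2 / 4 * v)) : ℂ) ∂μ

lemma exists_sq_div_four_mem (k : ℤ) : ∃ l : ℤ, ∀ w ∈ primePow F k, w ^ 2 / 4 ∈ primePow F l := by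
  have hK : IsCompact ((fun w : F => w ^ 2 / 4) '' primePow F k) :=
    (isCompact_primePow k).image (by fun_prop)
  obtain ⟨l, hl⟩ := exists_subset_primePow_of_isCompact hK
  exact ⟨l, fun w hw => hl l le_rfl ⟨w, hw, rfl⟩⟩

/-- The map w ↦ w²/4 sends the support of ξ into a bounded set. Compact support is not asserted for
the transform, hence the truncations that follow. -/
lemma HasCondExp.exists_quadFourier_level (hc : HasCondExp ψ c) (hξ : IsSchwartz ξ) :
    ∃ n : ℤ, ∀ v, ∀ u ∈ primePow F n, quadFourier μ ψ ξ (v + u) = quadFourier μ ψ ξ v := by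
  obtain ⟨k, hk⟩ := hξ.exists_support
  obtain ⟨l, hl⟩ := exists_sq_div_four_mem (F := F) k
  refine ⟨c - l, fun v u hu => ?_⟩
  refine integral_congr_ae (Eventually.of_forall fun w => ?_)
  simp only
  by_cases hw : w ∈ primePow F k
  · rw [mul_add, neg_add, hc.coe_add_of_mem]
    rw [neg_mem_primePow]
    simpa using mul_mem_primePow (hl w hw) hu
  · rw [hk k le_rfl w hw]; simp

lemma HasCondExp.isSchwartz_quadFourier_indicator (hc : HasCondExp ψ c) (hξ : IsSchwartz ξ) (N : ℤ) :
    IsSchwartz ((primePow F N).indicator (quadFourier μ ψ ξ)) := by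
  obtain ⟨n, hn⟩ := hc.exists_quadFourier_level μ hξ
  refine isSchwartz_of_level_support (n := max n N) (m := N) (fun x v hv => ?_)
    fun x hx => Set.indicator_of_notMem hx _
  exact indicator_eq_indicator
    (add_mem_primePow_iff (primePow_antitone (le_max_right _ _) hv))
    fun _ => hn x v (primePow_antitone (le_max_left _ _) hv)

/-- Cutting off at P^N on one side of the transform smooths the image measure at scale P^(c-N) on
the other; the mass at w is spread around w²/4. -/
lemma HasCondExp.fourierWith_quadFourier_indicator (hc : HasCondExp ψ c) (hξ : IsSchwartz ξ) (N : ℤ)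
    (y : F) : fourierWith ψ μ ((primePow F N).indicator (quadFourier μ ψ ξ)) y =
      ∫ w, ξ w * (primePow F (c - N)).indicator (fun _ => (μ.real (primePow F N) : ℂ))
        (y - w ^ 2 / 4) ∂μ := by
  classical
  have hcc := hc.continuous
  have e1 : fourierWith ψ μ ((primePow F N).indicator (quadFourier μ ψ ξ)) y =
      ∫ v in primePow F N, ∫ w, ξ w * (ψ (-(w ^ 2 / 4 * v)) : ℂ) * (ψ (y * v) : ℂ) ∂μ ∂μ := by
    rw [fourierWith, ← integral_indicator (measurableSet_primePow N)]
    refine integral_congr_ae (Eventually.of_forall fun v => ?_)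
    simp only
    by_cases hv : v ∈ primePow F N
    · rw [Set.indicator_of_mem hv, Set.indicator_of_mem hv, integral_mul_const]; rfl
    · rw [Set.indicator_of_notMem hv, Set.indicator_of_notMem hv, zero_mul]
  rw [e1, integral_integral_swap]
  · refine integral_congr_ae (Eventually.of_forall fun w => ?_)
    simp only
    have : ∀ v, ξ w * (ψ (-(w ^ 2 / 4 * v)) : ℂ) * (ψ (y * v) : ℂ) =
        ξ w * (ψ ((y - w ^ 2 / 4) * v) : ℂ) := fun v => by
      rw [mul_assoc, ← coe_map_add]; congr 3; ring
    simp_rw [this]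
    rw [integral_const_mul, hc.integral_primePow μ]
    simp only [Set.indicator]
  · have := isFiniteMeasure_restrict_primePow μ N
    have hi : Integrable (fun p : F × F => (1 : ℂ) * ξ p.2) ((μ.restrict (primePow F N)).prod μ) :=
      Integrable.mul_prod (integrable_const (1 : ℂ)) (hξ.integrable μ)
    have := hi.bdd_mul (f := fun p : F × F => (ψ (-(p.2 ^ 2 / 4 * p.1)) : ℂ) * (ψ (y * p.1) : ℂ))
      (c := 1) (Continuous.aestronglyMeasurable (by fun_prop)) (Eventually.of_forall fun p => by
        rw [norm_mul, Circle.norm_coe, Circle.norm_coe, one_mul])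
    refine this.congr (Eventually.of_forall fun p => ?_)
    simp only [Function.uncurry]; ring

/-- The normalized average of `θ` over `a + P ^ n`, where `r` is the inverse volume of `P ^ n`. -/
lemma norm_average_sub_le {θ : F → ℂ} (hθ : Continuous θ) {n : ℤ} {r B : ℝ} (hr : 0 ≤ r)
    (hrn : r * μ.real (primePow F n) = 1) {a : F} {z : ℂ}
    (h : ∀ t ∈ primePow F n, ‖θ (a + t) - z‖ ≤ B) :
    ‖(r : ℂ) * ∫ t in primePow F n, θ (a + t) ∂μ - z‖ ≤ B := by
  have hint : IntegrableOn (fun t => θ (a + t)) (primePow F n) μ :=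
    (by fun_prop : Continuous fun t => θ (a + t)).continuousOn.integrableOn_compact
      (isCompact_primePow n)
  have := isFiniteMeasure_restrict_primePow μ n
  have e : (r : ℂ) * ∫ t in primePow F n, θ (a + t) ∂μ - z =
      (r : ℂ) * ∫ t in primePow F n, (θ (a + t) - z) ∂μ := by
    rw [integral_sub hint (integrable_const z), setIntegral_const, mul_sub, Complex.real_smul,
      ← mul_assoc, ← Complex.ofReal_mul, hrn, Complex.ofReal_one, one_mul]
  rw [e, norm_mul, Complex.norm_real, Real.norm_of_nonneg hr]
  calc _ ≤ r * (B * μ.real (primePow F n)) := mul_le_mul_of_nonneg_left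
        (norm_setIntegral_le_of_norm_le_const (measure_primePow_lt_top μ n) h) hr
    _ = B * (r * μ.real (primePow F n)) := by ring
    _ = B := by rw [hrn, mul_one]

lemma tendsto_average (hc : HasCondExp ψ c) (hsd : IsSelfDual ψ μ) {θ : F → ℂ} (hθ : Continuous θ)
    (a : F) : Tendsto (fun N : ℕ => (μ.real (primePow F (-(N : ℤ))) : ℂ) *
      ∫ t in primePow F (c - -(N : ℤ)), θ (a + t) ∂μ) atTop (𝓝 (θ a)) := by
  rw [Metric.tendsto_nhds]
  intro ε hε
  have hU : {t : F | ‖θ (a + t) - θ a‖ < ε / 2} ∈ 𝓝 (0 : F) := by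
    refine IsOpen.mem_nhds (isOpen_lt (by fun_prop) continuous_const) ?_
    simpa using hε
  obtain ⟨n, hn⟩ := exists_primePow_subset_of_mem_nhds hU
  filter_upwards [eventually_ge_atTop (n - c).toNat] with N hN
  rw [dist_eq_norm]
  refine (norm_average_sub_le μ hθ (z := θ a) (B := ε / 2) measureReal_nonneg
    (hsd.measure_mul μ hc _) fun t ht => ?_).trans_lt (by linarith)
  have : ‖θ (a + t) - θ a‖ < ε / 2 := hn (c - -(N : ℤ)) (by omega) ht
  exact this.le

/-- Against a test function θ, the smoothed image measure yields averages of θ over w²/4 + P^(c-N).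
-/
lemma HasCondExp.integral_fourierWith_quadFourier_mul (hc : HasCondExp ψ c) (hξ : IsSchwartz ξ)
    {θ : F → ℂ} (hθ : Continuous θ) (N : ℤ) :
    ∫ y, fourierWith ψ μ ((primePow F N).indicator (quadFourier μ ψ ξ)) y * θ y ∂μ =
      ∫ w, ξ w * ((μ.real (primePow F N) : ℂ) *
        ∫ t in primePow F (c - N), θ (w ^ 2 / 4 + t) ∂μ) ∂μ := by
  obtain ⟨k, hk⟩ := hξ.exists_support
  obtain ⟨l, hl⟩ := exists_sq_div_four_mem (F := F) k
  simp_rw [hc.fourierWith_quadFourier_indicator μ hξ, ← integral_mul_const]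
  rw [integral_integral_swap]
  · refine integral_congr_ae (Eventually.of_forall fun w => ?_)
    simp only
    simp_rw [mul_assoc]
    rw [integral_const_mul]
    congr 1
    rw [← integral_add_right_eq_self (μ := μ) _ (w ^ 2 / 4),
      ← integral_indicator (measurableSet_primePow (c - N)), ← integral_const_mul]
    refine integral_congr_ae (Eventually.of_forall fun t => ?_)
    simp only [add_sub_cancel_right]
    by_cases ht : t ∈ primePow F (c - N)
    · rw [Set.indicator_of_mem ht, Set.indicator_of_mem ht, add_comm]
    · rw [Set.indicator_of_notMem ht, Set.indicator_of_notMem ht, zero_mul, mul_zero]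
  · let j := min l (c - N)
    have hθi : Integrable ((primePow F j).indicator θ) μ :=
      (integrable_indicator_iff (measurableSet_primePow j)).mpr
        (hθ.continuousOn.integrableOn_compact (isCompact_primePow j))
    have hi : Integrable (fun p : F × F => (primePow F j).indicator θ p.1 * ξ p.2) (μ.prod μ) :=
      Integrable.mul_prod hθi (hξ.integrable μ)
    have hm : Measurable ((primePow F (c - N)).indicator
        (fun _ : F => (μ.real (primePow F N) : ℂ))) :=
      measurable_const.indicator (measurableSet_primePow _)
    have := hi.bdd_mul (f := fun p : F × F => (primePow F (c - N)).indicator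
      (fun _ => (μ.real (primePow F N) : ℂ)) (p.1 - p.2 ^ 2 / 4)) (c := μ.real (primePow F N))
      (hm.comp (by fun_prop : Measurable fun p : F × F => p.1 - p.2 ^ 2 / 4)).aestronglyMeasurable
      (Eventually.of_forall fun p => (norm_indicator_le_norm_self _ _).trans_eq (by
        rw [Complex.norm_real, Real.norm_of_nonneg measureReal_nonneg]))
    refine this.congr (Eventually.of_forall fun p => ?_)
    simp only [Function.uncurry]
    by_cases hw : p.2 ∈ primePow F k
    · by_cases hy : p.1 - p.2 ^ 2 / 4 ∈ primePow F (c - N)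
      · have : p.1 ∈ primePow F j := by
          have := add_mem_primePow (primePow_antitone (min_le_right l (c - N)) hy)
            (primePow_antitone (min_le_left l (c - N)) (hl _ hw))
          rwa [sub_add_cancel] at this
        rw [Set.indicator_of_mem this]; ring
      · rw [Set.indicator_of_notMem hy]; ring
    · rw [hk k le_rfl _ hw]; ring

variable (χ : Fˣ →ₜ* ℂˣ) {z : ℂ}

lemma integral_mellinIntegrand_eq (φ : F → ℂ) :
    ∫ y, mellinIntegrand z χ φ y ∂(mulHaar μ) = ∫ y, φ y * twist χ (z - 1) y ∂μ := by
  rw [← integral_norm_mul_mulHaar μ]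
  refine integral_congr_ae (Eventually.of_forall fun y => ?_)
  simp only [mellinIntegrand_eq]
  rw [mul_left_comm, norm_mul_twist, add_sub_cancel]

/-- The functional equation for the image of the measure `ξ(w) dw` under `w ↦ w² / 4`. -/
theorem HasCondExp.quadratic_functional_equation (hc : HasCondExp ψ c) (hsd : IsSelfDual ψ μ)
    (hξ : IsSchwartz ξ) (hz : 0 < (z - 1).re + charExp χ)
    (hi : Integrable (mellinIntegrand (1 - z) χ⁻¹ (quadFourier μ ψ ξ)) (mulHaar μ)) :
    gaussInt μ ψ c χ z * ∫ v, mellinIntegrand (1 - z) χ⁻¹ (quadFourier μ ψ ξ) v ∂(mulHaar μ) =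
      ∫ w, ξ w * twist χ (z - 1) (w ^ 2 / 4) ∂μ := by
  have hz1 : 0 < z.re + charExp χ := by
    rw [Complex.sub_re, Complex.one_re] at hz; linarith
  -- The condition on z - 1 makes the quasi-character continuous at 0 as well, so its averages
  -- converge even at w = 0.
  have hθ := continuous_twist χ hz
  set H := quadFourier μ ψ ξ
  let S : ℕ → Set F := fun N => primePow F (-(N : ℤ))
  have hind : ∀ N, mellinIntegrand (1 - z) χ⁻¹ ((S N).indicator H) =
      (S N).indicator (mellinIntegrand (1 - z) χ⁻¹ H) := fun N => by
    ext v
    by_cases hv : v ∈ S N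
    · simp only [mellinIntegrand_eq, Set.indicator_of_mem hv]
    · simp only [mellinIntegrand_eq, Set.indicator_of_notMem hv, zero_mul]
  have e1 : ∀ N : ℕ, gaussInt μ ψ c χ z *
      ∫ v, (S N).indicator (mellinIntegrand (1 - z) χ⁻¹ H) v ∂(mulHaar μ) =
      ∫ w, ξ w * ((μ.real (S N) : ℂ) *
        ∫ t in primePow F (c - -(N : ℤ)), twist χ (z - 1) (w ^ 2 / 4 + t) ∂μ) ∂μ := by
    intro N
    have hi' : Integrable (mellinIntegrand (1 - z) χ⁻¹ ((S N).indicator H)) (mulHaar μ) := by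
      rw [hind]; exact hi.indicator (measurableSet_primePow _)
    have h1 := hc.tate_functional_equation μ χ
      (hc.isSchwartz_quadFourier_indicator μ hξ (-(N : ℤ))) hz1 hi'
    rw [← hind, ← hc.integral_fourierWith_quadFourier_mul μ hξ hθ, ← integral_mellinIntegrand_eq μ]
    exact h1.symm
  have t1 : Tendsto (fun N : ℕ => gaussInt μ ψ c χ z *
      ∫ v, (S N).indicator (mellinIntegrand (1 - z) χ⁻¹ H) v ∂(mulHaar μ)) atTop
      (𝓝 (gaussInt μ ψ c χ z * ∫ v, mellinIntegrand (1 - z) χ⁻¹ H v ∂(mulHaar μ))) := by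
    refine Tendsto.const_mul _ (tendsto_integral_of_dominated_convergence
      (fun v => ‖mellinIntegrand (1 - z) χ⁻¹ H v‖)
      (fun N => (hi.indicator (measurableSet_primePow _)).aestronglyMeasurable) hi.norm
      (fun N => Eventually.of_forall fun v => norm_indicator_le_norm_self _ _)
      (Eventually.of_forall fun v => ?_))
    refine tendsto_const_nhds.congr' ?_
    obtain ⟨n, hn⟩ := exists_subset_primePow_of_isCompact (isCompact_singleton (x := v))
    filter_upwards [eventually_ge_atTop (-n).toNat] with N hN
    rw [Set.indicator_of_mem (hn (-(N : ℤ)) (by omega) rfl)]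
  have t2 : Tendsto (fun N : ℕ => ∫ w, ξ w * ((μ.real (S N) : ℂ) *
        ∫ t in primePow F (c - -(N : ℤ)), twist χ (z - 1) (w ^ 2 / 4 + t) ∂μ) ∂μ) atTop
      (𝓝 (∫ w, ξ w * twist χ (z - 1) (w ^ 2 / 4) ∂μ)) := by
    obtain ⟨k, hk⟩ := hξ.exists_support
    obtain ⟨l, hl⟩ := exists_sq_div_four_mem (F := F) k
    -- This ball contains w²/4 + t for every w in the support of ξ and every t in P^(c+N), N ≥ 0, so
    -- B dominates all the averages.
    obtain ⟨B, hB⟩ := (isCompact_primePow (F := F) (min l c)).exists_bound_of_continuousOn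
      hθ.continuousOn
    refine tendsto_integral_of_dominated_convergence (fun w => ‖ξ w‖ * B) (fun N => ?_)
      ((hξ.integrable μ).norm.mul_const B) (fun N => Eventually.of_forall fun w => ?_)
      (Eventually.of_forall fun w => (tendsto_average μ hc hsd hθ _).const_mul _)
    · have hm : StronglyMeasurable (Function.uncurry fun w t : F =>
          twist χ (z - 1) (w ^ 2 / 4 + t)) := by
        refine Continuous.stronglyMeasurable ?_
        exact hθ.comp (by fun_prop : Continuous fun p : F × F => p.1 ^ 2 / 4 + p.2)
      exact hξ.continuous.aestronglyMeasurable.mul ((hm.integral_prod_right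
        (ν := μ.restrict (primePow F (c - -(N : ℤ))))).aestronglyMeasurable.const_mul _)
    · rw [norm_mul]
      by_cases hw : w ∈ primePow F k
      · refine mul_le_mul_of_nonneg_left ?_ (norm_nonneg _)
        have := norm_average_sub_le μ hθ (z := 0) (B := B) (a := w ^ 2 / 4) measureReal_nonneg
          (hsd.measure_mul μ hc (-(N : ℤ))) fun t ht => by
            rw [sub_zero]
            exact hB _ (add_mem_primePow (primePow_antitone (min_le_left _ _) (hl w hw))
              (primePow_antitone ((min_le_right _ _).trans (by omega)) ht))
        rwa [sub_zero] at this
      · rw [hk k le_rfl w hw]; simp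
  simp_rw [e1] at t1
  exact tendsto_nhds_unique t1 t2

end QuadraticFourier

/-! ### The product formula for the Weil-twisted Gauss integral. -/

section WeilGauss

variable {F : Type*} [NontriviallyNormedField F] [IsUltrametricDist F] [ProperSpace F] [CharZero F]
  [hF : Fact (IsNormalizedAbs F)] [MeasurableSpace F] [BorelSpace F]
  {ψ : AddChar F Circle} {c : ℤ} (χ : Fˣ →ₜ* ℂˣ) {s : ℂ}

/-- The quasi-character `χ |·|^s` divided by the Weil index. -/
def weilTwist (ψ : AddChar F Circle) (χ : Fˣ →ₜ* ℂˣ) (s : ℂ) (x : F) : ℂ :=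
  (weilIndex (ψ.mulShift x))⁻¹ * twist χ s x

/-- The integral of `γ_F(ψ_x)⁻¹ χ(x) |x|^s ψ(x)` over `P ^ n`. -/
def weilGauss (ψ : AddChar F Circle) (χ : Fˣ →ₜ* ℂˣ) (s : ℂ) (n : ℤ) : ℂ :=
  ∫ x in primePow F n, weilTwist ψ χ s x * (ψ x : ℂ) ∂(mulMeasure ψ)

lemma HasCondExp.congrInvariant_weilTwist (hc : HasCondExp ψ c) {e : ℕ} (he : (2 : F) ∈ shell F e)
    (s : ℂ) : CongrInvariant (max (2 * (e : ℤ) + 1) (conductor χ : ℤ)) (weilTwist ψ χ s) := by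
  intro x u hx hu
  have h1 := (hc.congrInvariant_weilIndex he).mono (le_max_left _ (conductor χ : ℤ)) x u hx hu
  have h2 := (congrInvariant_twist χ s).mono (le_max_right (2 * (e : ℤ) + 1) _) x u hx hu
  rw [weilTwist, h1, h2, weilTwist]

lemma HasCondExp.integrableOn_weilTwist (hc : HasCondExp ψ c) (hs : 0 < s.re + charExp χ) (n : ℤ) :
    IntegrableOn (weilTwist ψ χ s) (primePow F n) (mulMeasure ψ) := by
  have := hc.isAddHaarMeasure
  obtain ⟨e, he, -⟩ := exists_two_mem_shell F
  refine Integrable.bdd_mul (c := 1) ((integrableOn_twist χ (selfDualMeasure ψ) n).mpr hs)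
    (hc.congrInvariant_weilIndex he).measurable.inv.aestronglyMeasurable ?_
  refine ae_restrict_of_ae ((ae_mulHaar_ne_zero (selfDualMeasure ψ)).mono fun x hx => ?_)
  rw [norm_inv, hc.norm_weilIndex hx, inv_one]

lemma HasCondExp.weilGauss_stable (hc : HasCondExp ψ c) {e : ℕ} (he : (2 : F) ∈ shell F e)
    (hs : 0 < s.re + charExp χ) {n : ℤ} (hn : n ≤ c - max (2 * (e : ℤ) + 1) (conductor χ : ℤ)) :
    weilGauss ψ χ s n = weilGauss ψ χ s (c - max (2 * (e : ℤ) + 1) (conductor χ : ℤ)) := by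
  have := hc.isAddHaarMeasure
  exact hc.integral_primePow_stable _ (by omega) (hc.congrInvariant_weilTwist χ he s)
    (fun n => hc.integrableOn_weilTwist χ hs n) hn

/-- The quadratic Fourier integral of the characteristic function of `1 + P ^ m`. -/
def unitQuadInt (μ : Measure F) (ψ : AddChar F Circle) (m : ℤ) (x : F) : ℂ :=
  ∫ b, (principalUnits F m).indicator (fun _ => (1 : ℂ)) b * (ψ (x * b ^ 2) : ℂ) ∂μ

/-- Nonstationary phase: the derivative 2xb of xb² does not vanish on 1 + P^m, so for large |x| a
small shift of b changes the phase by a nontrivial constant. -/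
lemma HasCondExp.exists_unitQuadInt_eq_zero (hc : HasCondExp ψ c) (μ : Measure F)
    [μ.IsAddHaarMeasure] {m : ℤ} (hm : 1 ≤ m) :
    ∃ N : ℤ, ∀ x, x ∉ primePow F N → unitQuadInt μ ψ m x = 0 := by
  obtain ⟨e, he, -⟩ := exists_two_mem_shell F
  -- The shift v lies in P^(c-e-k-1), k being the valuation of x. The first bound puts xv² in P^c
  -- and the second puts v in P^m; then 2xv(b - 1) is in P^c because m ≥ 1.
  refine ⟨min (c - 2 * e - 2) (c - e - 1 - m) + 1, fun x hx => ?_⟩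
  have hx0 : x ≠ 0 := by rintro rfl; exact hx (zero_mem_primePow _)
  obtain ⟨k, hk⟩ := exists_mem_shell x hx0
  rw [mem_primePow, mem_shell.mp hk, zpow_resCard_le] at hx
  have h2x : 2 * x ∈ shell F (e + k) := (mul_mem_shell_iff he).mpr hk
  obtain ⟨v, hv, hv1⟩ := hc.exists_mul_ne_one (x := 2 * x) (n := c - e - k - 1) (by
    rw [mem_primePow, mem_shell.mp h2x, zpow_resCard_le]; omega)
  have hvm : v ∈ primePow F m := primePow_antitone (by omega) hv
  have hS : unitQuadInt μ ψ m x = ∫ b in principalUnits F m, (ψ (x * b ^ 2) : ℂ) ∂μ := by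
    rw [unitQuadInt, ← integral_indicator (measurableSet_principalUnits m)]
    refine integral_congr_ae (Eventually.of_forall fun b => ?_)
    by_cases hb : b ∈ principalUnits F m <;> simp [hb]
  rw [hS]
  refine setIntegral_eq_zero_of_shift μ (measurableSet_principalUnits m) (v := v) (fun b => ?_)
    (coe_ne_one hv1) fun b hb => ?_
  · have h : b + v - 1 = (b - 1) + v := by ring
    simp only [principalUnits, Set.mem_preimage, h]
    exact add_mem_primePow_iff hvm
  · have h1 : x * (b + v) ^ 2 = (2 * x * v + x * b ^ 2) + (2 * x * v * (b - 1) + x * (v * v)) := by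
      ring
    have h2 : 2 * x * v * (b - 1) ∈ primePow F c :=
      primePow_antitone (by omega)
        (mul_mem_primePow (mul_mem_primePow (mem_shell.mp h2x).le hv) hb)
    have h3 : x * (v * v) ∈ primePow F c :=
      primePow_antitone (by omega)
        (mul_mem_primePow (mem_shell.mp hk).le (mul_mem_primePow hv hv))
    rw [h1, hc.coe_add_of_mem _ (add_mem_primePow h2 h3), coe_map_add]

lemma sqrt_norm_eq_cpow (x : F) : ((√‖x‖ : ℝ) : ℂ) = (‖x‖ : ℂ) ^ (1 / 2 : ℂ) := by
  rw [Real.sqrt_eq_rpow, Complex.ofReal_cpow (norm_nonneg x)]; norm_num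

/-- Weil's formula produces |2x|^(-1/2) γ_F(ψ_x), whose Weil index cancels the one in `weilTwist`;
the factor |x|^(-1/2) accounts for the shift from s to s + 1/2. -/
lemma HasCondExp.weilTwist_mul_unitQuadInt (hc : HasCondExp ψ c) (m : ℤ) (s : ℂ) {x : F}
    (hx : x ≠ 0) : weilTwist ψ χ s x * unitQuadInt (selfDualMeasure ψ) ψ m x =
      ((√‖(2 : F)‖ : ℝ) : ℂ)⁻¹ * mellinIntegrand (1 - (s + 1 / 2)) χ⁻¹
        (quadFourier (selfDualMeasure ψ) ψ (fourierWith ψ (selfDualMeasure ψ)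
          ((principalUnits F m).indicator fun _ => 1))) x⁻¹ := by
  have := hc.isAddHaarMeasure
  set μ := selfDualMeasure ψ
  set Φ : F → ℂ := (principalUnits F m).indicator fun _ => 1
  obtain ⟨N₁, h1⟩ := hc.weil_formula μ hc.isSelfDual_selfDualMeasure (isSchwartz_principalUnits m) hx
  obtain ⟨N₂, h2⟩ := hc.weilIndex_mulShift hx
  have h1 := h1 (min N₁ N₂) (min_le_left _ _)
  have h2 := h2 (min N₁ N₂) (min_le_right _ _)
  have hγ := hc.weilIndex_ne_zero hx
  have hH : ∫ w, fourierWith ψ μ Φ w * (ψ (-(w ^ 2 / (4 * x))) : ℂ) ∂μ =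
      quadFourier μ ψ (fourierWith ψ μ Φ) x⁻¹ := by
    refine integral_congr_ae (Eventually.of_forall fun w => ?_)
    simp only
    congr 4
    rw [← div_div, div_eq_mul_inv (w ^ 2 / 4)]
  rw [h2] at hγ
  have hg := right_ne_zero_of_mul hγ
  have hs0 := left_ne_zero_of_mul hγ
  rw [norm_mul, Real.sqrt_mul (norm_nonneg _), Complex.ofReal_mul] at hs0
  have hx12 : ((√‖x‖ : ℝ) : ℂ) ≠ 0 := right_ne_zero_of_mul hs0
  have h22 : ((√‖(2 : F)‖ : ℝ) : ℂ) ≠ 0 := left_ne_zero_of_mul hs0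
  have hK : unitQuadInt μ ψ m x = quadInt μ ψ x (min N₁ N₂) *
      quadFourier μ ψ (fourierWith ψ μ Φ) x⁻¹ := by rw [← hH]; exact h1
  have htw : twist χ s x = ((√‖x‖ : ℝ) : ℂ) * twist χ (s - 1 / 2) x := by
    rw [sqrt_norm_eq_cpow, ← twist_add, add_sub_cancel]
  rw [hK, weilTwist, h2, htw, norm_mul, Real.sqrt_mul (norm_nonneg _), Complex.ofReal_mul,
    mellinIntegrand_eq, twist_inv_char, inv_inv,
    show -(1 - (s + 1 / 2)) = s - 1 / 2 by ring]
  generalize quadFourier μ ψ (fourierWith ψ μ Φ) x⁻¹ = H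
  generalize twist χ (s - 1 / 2) x = t
  change _ * quadInt μ ψ x (min N₁ N₂) ≠ 0 at hγ
  change quadInt μ ψ x (min N₁ N₂) ≠ 0 at hg
  change (_ * quadInt μ ψ x (min N₁ N₂))⁻¹ * _ * _ = _
  generalize quadInt μ ψ x (min N₁ N₂) = g at *
  field_simp

lemma HasCondExp.integrable_weilTwist_prod (hc : HasCondExp ψ c) (hs : 0 < s.re + charExp χ)
    (m n : ℤ) : Integrable (fun p : F × F => weilTwist ψ χ s p.1 *
      ((principalUnits F m).indicator (fun _ => (1 : ℂ)) p.2 * (ψ (p.1 * p.2 ^ 2) : ℂ)))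
      (((mulMeasure ψ).restrict (primePow F n)).prod (selfDualMeasure ψ)) := by
  have := hc.isAddHaarMeasure
  have hsf : SFinite (mulMeasure ψ) := sFinite_mulHaar (selfDualMeasure ψ)
  have hcc := hc.continuous
  have hi := Integrable.mul_prod (hc.integrableOn_weilTwist χ hs n)
    ((isSchwartz_principalUnits (F := F) m).integrable (selfDualMeasure ψ))
  have := hi.bdd_mul (f := fun p : F × F => (ψ (p.1 * p.2 ^ 2) : ℂ)) (c := 1)
    (Continuous.aestronglyMeasurable (by fun_prop))
    (Eventually.of_forall fun p => (Circle.norm_coe _).le)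
  refine this.congr (Eventually.of_forall fun p => ?_)
  simp only; ring

/-- For b in 1 + P^m the substitution x ↦ b²x leaves the Weil index, the twist and the ball
unchanged, so the integral with ψ(xb²) does not depend on b; integrate it over b. -/
lemma HasCondExp.measure_mul_weilGauss (hc : HasCondExp ψ c) (hs : 0 < s.re + charExp χ) {m : ℤ}
    (hm : 1 ≤ m) (hm' : conductor χ ≤ m) (n : ℤ) :
    ((selfDualMeasure ψ).real (primePow F m) : ℂ) * weilGauss ψ χ s n =
      ∫ x in primePow F n, weilTwist ψ χ s x * unitQuadInt (selfDualMeasure ψ) ψ m x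
        ∂(mulMeasure ψ) := by
  have := hc.isAddHaarMeasure
  have hsf : SFinite (mulMeasure ψ) := sFinite_mulHaar (selfDualMeasure ψ)
  have hi := hc.integrable_weilTwist_prod χ hs m n
  simp_rw [unitQuadInt, ← integral_const_mul]
  rw [integral_integral_swap hi]
  have key : ∀ b, ∫ x in primePow F n, weilTwist ψ χ s x *
      ((principalUnits F m).indicator (fun _ => (1 : ℂ)) b * (ψ (x * b ^ 2) : ℂ)) ∂(mulMeasure ψ) =
      (principalUnits F m).indicator (fun _ => weilGauss ψ χ s n) b := by
    intro b
    by_cases hb : b ∈ principalUnits F m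
    · rw [Set.indicator_of_mem hb, Set.indicator_of_mem hb]
      have hu := isCongrOne_of_mem hm hb
      have hb0 : b ≠ 0 := by rw [← norm_pos_iff, hu.1]; exact one_pos
      have hbs : b ^ 2 ∈ shell F 0 := by simp [mem_shell, hu.1]
      have h := setIntegral_mulHaar_comp_mul (selfDualMeasure ψ) hbs n
        fun x => weilTwist ψ χ s x * (ψ x : ℂ)
      rw [zero_add] at h
      rw [weilGauss, mulMeasure_eq, ← h]
      refine integral_congr_ae ((ae_restrict_of_ae (ae_mulHaar_ne_zero _)).mono fun x hx => ?_)
      have h1 : weilIndex (ψ.mulShift (b ^ 2 * x)) = weilIndex (ψ.mulShift x) := by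
        obtain ⟨N₁, h1⟩ := hc.weilIndex_mulShift hx
        obtain ⟨N₂, h2⟩ := hc.weilIndex_mulShift (mul_ne_zero (pow_ne_zero 2 hb0) hx)
        rw [h1 (min N₁ N₂) (by omega), h2 (min N₁ N₂) (by omega), mul_comm (b ^ 2),
          quadInt_mul_sq _ _ hu.1]
        simp [hu.1]
      have h2 : twist χ s (b ^ 2 * x) = twist χ s x := by
        rw [twist_mul, twist_congrOne χ s ((hu.mono hm').pow 2), one_mul]
      simp only
      rw [one_mul, weilTwist, weilTwist, h1, h2, mul_comm (b ^ 2)]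
    · rw [Set.indicator_of_notMem hb, Set.indicator_of_notMem hb]; simp
  simp_rw [key]
  rw [integral_indicator_const _ (measurableSet_principalUnits m), measureReal_principalUnits,
    Complex.real_smul]

/-- The product formula for the integral of the Weil index against a quasi-character: this is the
`p`-adic form of the evaluation of Salié sums. -/
lemma HasCondExp.gaussInt_mul_weilGauss (hc : HasCondExp ψ c) (hs : 1 / 2 < s.re + charExp χ) :
    ∃ N : ℤ, ∀ n ≤ N, gaussInt (selfDualMeasure ψ) ψ c χ (s + 1 / 2) * weilGauss ψ χ s n =
      ((√‖(2 : F)‖ : ℝ) : ℂ)⁻¹ * twist χ (s - 1 / 2) (4⁻¹ : F) *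
        gaussInt (selfDualMeasure ψ) ψ c (χ ^ 2) (2 * s) := by
  have := hc.isAddHaarMeasure
  have hsf : SFinite (mulMeasure ψ) := sFinite_mulHaar (selfDualMeasure ψ)
  have hre : (s - 1 / 2).re = s.re - 1 / 2 := by simp
  have hs0 : 0 < s.re + charExp χ := by linarith
  set μ := selfDualMeasure ψ with hμ
  have hsd : IsSelfDual ψ μ := hc.isSelfDual_selfDualMeasure
  -- Large enough for averaging against χ and for the Mellin transform of Φ against the inverse of
  -- χ² to be just a volume.
  let m : ℤ := max (condLevel χ : ℤ) (condLevel (χ ^ 2)⁻¹)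
  have hm : 1 ≤ m := (one_le_condLevel χ).trans (le_max_left _ _)
  have hm1 : (conductor χ : ℤ) ≤ m :=
    (by exact_mod_cast le_max_left _ _ : (conductor χ : ℤ) ≤ condLevel χ).trans (le_max_left _ _)
  have hm2 : (conductor (χ ^ 2)⁻¹ : ℤ) ≤ m :=
    (by exact_mod_cast le_max_left _ _ : (conductor (χ ^ 2)⁻¹ : ℤ) ≤ condLevel (χ ^ 2)⁻¹).trans
      (le_max_right _ _)
  obtain ⟨N, hN⟩ := hc.exists_unitQuadInt_eq_zero μ hm
  refine ⟨N, fun n hn => ?_⟩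
  have hΦ : IsSchwartz ((principalUnits F m).indicator fun _ => (1 : ℂ)) :=
    isSchwartz_principalUnits m
  set Φ : F → ℂ := (principalUnits F m).indicator fun _ => 1
  have hΦ2 := hc.isSchwartz_fourierWith μ hΦ
  set H := quadFourier μ ψ (fourierWith ψ μ Φ)
  have h2 : ((√‖(2 : F)‖ : ℝ) : ℂ) ≠ 0 := by simp
  have hvol : (μ.real (primePow F m) : ℂ) ≠ 0 := by
    exact_mod_cast (measureReal_primePow_pos μ m).ne'
  have hzero : ∀ x, x ∉ primePow F n → weilTwist ψ χ s x * unitQuadInt μ ψ m x = 0 :=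
    fun x hx => by rw [hN x fun h => hx (primePow_antitone hn h), mul_zero]
  have hae : (fun x => weilTwist ψ χ s x * unitQuadInt μ ψ m x) =ᵐ[mulHaar μ] fun x =>
      ((√‖(2 : F)‖ : ℝ) : ℂ)⁻¹ * mellinIntegrand (1 - (s + 1 / 2)) χ⁻¹ H x⁻¹ :=
    (ae_mulHaar_ne_zero μ).mono fun x hx => hc.weilTwist_mul_unitQuadInt χ m s hx
  have hiOn : IntegrableOn (fun x => weilTwist ψ χ s x * unitQuadInt μ ψ m x) (primePow F n)
      (mulHaar μ) := by
    have := (hc.integrable_weilTwist_prod χ hs0 m n).integral_prod_left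
    simp only [integral_const_mul] at this
    exact this
  -- Integrability on the ball suffices because the averaged phase vanishes outside it. Transported
  -- by x ↦ x⁻¹, it supplies the integrability that the quadratic functional equation needs.
  have hi : Integrable (fun x => weilTwist ψ χ s x * unitQuadInt μ ψ m x) (mulHaar μ) :=
    (integrableOn_iff_integrable_of_support_subset fun x hx => by
      by_contra h; exact hx (hzero x h)).mp hiOn
  have hi2 : Integrable (mellinIntegrand (1 - (s + 1 / 2)) χ⁻¹ H) (mulHaar μ) := by
    rw [← (measurePreserving_inv μ).integrable_comp_emb measurableEmbedding_inv]
    refine ((hi.congr hae).const_mul ((√‖(2 : F)‖ : ℝ) : ℂ)).congr (Eventually.of_forall fun x => ?_)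
    simp only [Function.comp]
    rw [mul_inv_cancel_left₀ h2]
  have e1 : (μ.real (primePow F m) : ℂ) * weilGauss ψ χ s n = ((√‖(2 : F)‖ : ℝ) : ℂ)⁻¹ *
      ∫ v, mellinIntegrand (1 - (s + 1 / 2)) χ⁻¹ H v ∂(mulHaar μ) := by
    rw [hc.measure_mul_weilGauss χ hs0 hm hm1 n, mulMeasure_eq,
      setIntegral_eq_integral_of_forall_compl_eq_zero hzero, integral_congr_ae hae,
      integral_const_mul, (measurePreserving_inv μ).integral_comp measurableEmbedding_inv
        (mellinIntegrand (1 - (s + 1 / 2)) χ⁻¹ H)]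
  -- This is the place where Re(s) + ρ > 1/2 is required, ρ being the exponent of χ.
  have hz : 0 < (s + 1 / 2 - 1).re + charExp χ := by
    rw [show s + 1 / 2 - 1 = s - 1 / 2 by ring, hre]; linarith
  have e2 := hc.quadratic_functional_equation μ χ hsd hΦ2 hz hi2
  have hs2 : 0 < (2 * s).re + charExp (χ ^ 2) := by
    rw [charExp_sq]; simp only [Complex.mul_re, Complex.re_ofNat, Complex.im_ofNat]; linarith
  -- The exponent 1 - 2s may lie outside the usual half-plane of convergence; this is harmless since
  -- Φ is supported away from 0.
  have hcpt := integrable_mellinIntegrand_principalUnits μ (χ ^ 2)⁻¹ hm hm2 (1 - 2 * s)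
  have e3 := hc.tate_functional_equation μ (χ ^ 2) hΦ hs2 hcpt
  rw [integral_mellinIntegrand_principalUnits μ (χ ^ 2)⁻¹ hm hm2, integral_mellinIntegrand_eq μ] at e3
  have e4 : ∫ w, fourierWith ψ μ Φ w * twist χ (s + 1 / 2 - 1) (w ^ 2 / 4) ∂μ =
      twist χ (s - 1 / 2) (4⁻¹ : F) *
        ∫ w, fourierWith ψ μ Φ w * twist (χ ^ 2) (2 * s - 1) w ∂μ := by
    rw [← integral_const_mul]
    refine integral_congr_ae (Eventually.of_forall fun w => ?_)
    simp only
    rw [show s + 1 / 2 - 1 = s - 1 / 2 by ring, show 2 * s - 1 = 2 * (s - 1 / 2) by ring, twist_sq,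
      div_eq_mul_inv (w ^ 2) 4, twist_mul, sq, twist_mul]
    ring
  rw [e4, e3] at e2
  refine mul_left_cancel₀ hvol ?_
  calc _ = gaussInt μ ψ c χ (s + 1 / 2) * ((μ.real (primePow F m) : ℂ) * weilGauss ψ χ s n) := by
        ring
    _ = ((√‖(2 : F)‖ : ℝ) : ℂ)⁻¹ * (gaussInt μ ψ c χ (s + 1 / 2) *
          ∫ v, mellinIntegrand (1 - (s + 1 / 2)) χ⁻¹ H v ∂(mulHaar μ)) := by rw [e1]; ring
    _ = _ := by rw [e2]; ring

/-- Substitute x ↦ 2x and rescale the self-dual measure: the result is exactly the constant in the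
product formula, which is why ψ_2 occurs in the theorem. -/
lemma HasCondExp.gaussInt_mulShift_two (hc : HasCondExp ψ c) {e : ℕ} (he : (2 : F) ∈ shell F e)
    (hs : 0 < s.re + charExp χ) :
    gaussInt (selfDualMeasure (ψ.mulShift 2)) (ψ.mulShift 2) (c - e) (χ ^ 2) (2 * s) =
      ((√‖(2 : F)‖ : ℝ) : ℂ)⁻¹ * twist χ (s - 1 / 2) (4⁻¹ : F) *
        gaussInt (selfDualMeasure ψ) ψ c (χ ^ 2) (2 * s) := by
  have := hc.isAddHaarMeasure
  have hc2 := hc.mulShift he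
  have := hc2.isAddHaarMeasure
  have hs2 : 0 < (2 * s).re + charExp (χ ^ 2) := by
    rw [charExp_sq]; simp only [Complex.mul_re, Complex.re_ofNat, Complex.im_ofNat]; linarith
  let n : ℤ := c - e - condLevel (χ ^ 2)
  rw [← hc2.gaussTrunc_eq _ (χ ^ 2) hs2 (n := n - e) (by omega),
    ← hc.gaussTrunc_eq _ (χ ^ 2) hs2 (n := e + (n - e)) (by omega)]
  have h2 : (2 : F) ≠ 0 := two_ne_zero
  rw [gaussTrunc, ← mulMeasure_eq, hc.mulMeasure_mulShift h2, Measure.restrict_smul,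
    integral_smul_measure, ENNReal.toReal_ofReal (Real.sqrt_nonneg _), Complex.real_smul,
    gaussTrunc, ← setIntegral_mulHaar_comp_mul _ he, ← integral_const_mul, ← integral_const_mul]
  refine integral_congr_ae (Eventually.of_forall fun x => ?_)
  simp only [AddChar.mulShift_apply]
  have h4 : (4⁻¹ : F) * (2 * 2) = 1 := by norm_num
  have e1 : twist χ (s - 1 / 2) (4⁻¹ : F) * twist (χ ^ 2) (2 * s) (2 * x) =
      (‖(2 : F)‖ : ℂ) * twist (χ ^ 2) (2 * s) x := by
    have h5 : twist χ s (2 * 2 : F) =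
        ((√‖(2 * 2 : F)‖ : ℝ) : ℂ) * twist χ (s - 1 / 2) (2 * 2) := by
      rw [sqrt_norm_eq_cpow, ← twist_add, add_sub_cancel]
    rw [norm_mul, Real.sqrt_mul_self (norm_nonneg _)] at h5
    have h6 : twist χ (s - 1 / 2) (4⁻¹ : F) * twist χ (s - 1 / 2) (2 * 2 : F) = 1 := by
      rw [← twist_mul, h4, twist_one]
    rw [twist_mul, twist_sq, sq, ← twist_mul, h5, ← mul_assoc, mul_left_comm, h6, mul_one]
  have h7 : ((√‖(2 : F)‖ : ℝ) : ℂ) * ((√‖(2 : F)‖ : ℝ) : ℂ) = (‖(2 : F)‖ : ℂ) := by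
    rw [← Complex.ofReal_mul, Real.mul_self_sqrt (norm_nonneg _)]
  have h8 : ((√‖(2 : F)‖ : ℝ) : ℂ) ≠ 0 := by simp
  calc _ = (((√‖(2 : F)‖ : ℝ) : ℂ)⁻¹ * (((√‖(2 : F)‖ : ℝ) : ℂ) * ((√‖(2 : F)‖ : ℝ) : ℂ))) *
        (twist (χ ^ 2) (2 * s) x * (ψ (2 * x) : ℂ)) := by
        rw [inv_mul_cancel_left₀ h8]
    _ = ((√‖(2 : F)‖ : ℝ) : ℂ)⁻¹ * ((‖(2 : F)‖ : ℂ) * twist (χ ^ 2) (2 * s) x) *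
        (ψ (2 * x) : ℂ) := by rw [h7]; ring
    _ = _ := by rw [← e1]; ring

lemma HasCondExp.weilGauss_eq (hc : HasCondExp ψ c) {e : ℕ} (he : (2 : F) ∈ shell F e)
    (hs : 1 / 2 < s.re + charExp χ) {n : ℤ} (hn : n ≤ c - max (2 * (e : ℤ) + 1) (conductor χ : ℤ)) :
    tateGamma (2 * s) (χ ^ 2) (ψ.mulShift 2) ≠ 0 ∧ weilGauss ψ χ s n = (χ (-1) : ℂ) *
      (tateGamma (2 * s) (χ ^ 2) (ψ.mulShift 2))⁻¹ * tateGamma (s + 1 / 2) χ ψ := by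
  have hs0 : 0 < s.re + charExp χ := by linarith
  obtain ⟨N, hN⟩ := hc.gaussInt_mul_weilGauss χ hs
  -- The product formula holds only for very negative n; stability of the Weil–Gauss integral then
  -- moves it to the given n.
  have h1 := hN (min N (c - max (2 * (e : ℤ) + 1) (conductor χ : ℤ))) (min_le_left _ _)
  rw [hc.weilGauss_stable χ he hs0 (min_le_right _ _), ← hc.weilGauss_stable χ he hs0 hn,
    ← hc.gaussInt_mulShift_two χ he hs0] at h1
  have hre : (s + 1 / 2).re = s.re + 1 / 2 := by simp
  have h2 := hc.gaussInt_mul_tateGamma χ (s := s + 1 / 2) (by rw [hre]; linarith)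
  have h3 := (hc.mulShift he).gaussInt_mul_tateGamma (χ ^ 2) (s := 2 * s) (by
    rw [charExp_sq]; simp only [Complex.mul_re, Complex.re_ofNat, Complex.im_ofNat]; linarith)
  have hsq : χ (-1) * χ (-1) = 1 := by rw [← map_mul]; simp
  have h4 : (χ ^ 2) (-1) = 1 := by
    rw [pow_two]; exact hsq
  rw [h4, Units.val_one] at h3
  have hsq' : (χ (-1) : ℂ) * (χ (-1) : ℂ) = 1 := by rw [← Units.val_mul, hsq, Units.val_one]
  -- As (χ²)(-1) = 1, the factor for χ² has product 1 with a Gauss integral, hence is nonzero.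
  have hne := right_ne_zero_of_mul (h3.trans_ne one_ne_zero)
  refine ⟨hne, ?_⟩
  rw [eq_inv_of_mul_eq_one_left h3] at h1
  rw [← h1]
  calc _ = (χ (-1) : ℂ) * (χ (-1) : ℂ) * weilGauss ψ χ s n := by rw [hsq', one_mul]
    _ = _ := by nth_rewrite 2 [← h2]; ring

lemma HasCondExp.unique {c' : ℤ} (h : HasCondExp ψ c) (h' : HasCondExp ψ c') : c = c' := by
  obtain ⟨x, hx, hx1⟩ := h.2
  obtain ⟨y, hy, hy1⟩ := h'.2
  rcases lt_trichotomy c c' with hlt | rfl | hlt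
  · exact absurd (h.1 y (primePow_antitone (by omega) hy)) hy1
  · rfl
  · exact absurd (h'.1 x (primePow_antitone (by omega) hx)) hx1

lemma sweetIntegrand_eq (x : F) : sweetIntegrand χ ψ s x =
    weilIndex ψ * (weilTwist ψ χ s x * (ψ x : ℂ)) := by
  rw [sweetIntegrand, normWeilIndex, inv_div, weilTwist, twist, div_eq_mul_inv]; ring

end WeilGauss

end LocalGamma

end

theorem theorem7p3 {F : Type*} [NontriviallyNormedField F] [IsUltrametricDist F]
    [ProperSpace F] [CharZero F] [MeasurableSpace F] [BorelSpace F]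
    (hF : LocalGamma.IsNormalizedAbs F) (χ : Fˣ →ₜ* ℂˣ) :
    ∃ σ : ℝ, ∀ ψ : AddChar F Circle, Continuous ψ → ψ ≠ 1 →
      ∃ M₀ : ℕ,
        (LocalGamma.IsUnramified ψ →
          (M₀ : ℝ) = max (2 * LocalGamma.twoExp F + 1) (LocalGamma.conductor χ : ℝ)) ∧
        ∀ M : ℕ, M₀ ≤ M → ∀ s : ℂ, σ < s.re →
          IntegrableOn (LocalGamma.sweetIntegrand χ ψ s)
            (LocalGamma.primePow F (-(M : ℤ))) (LocalGamma.mulMeasure ψ) ∧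
          LocalGamma.tateGamma (2 * s) (χ ^ 2) (ψ.mulShift 2) ≠ 0 ∧
          ∫ x in LocalGamma.primePow F (-(M : ℤ)), LocalGamma.sweetIntegrand χ ψ s x
              ∂(LocalGamma.mulMeasure ψ) =
            (LocalGamma.weilIndex (ψ.mulShift (-1)))⁻¹ * (χ (-1) : ℂ) *
              (LocalGamma.tateGamma (2 * s) (χ ^ 2) (ψ.mulShift 2))⁻¹ *
              LocalGamma.tateGamma (s + 1 / 2) χ ψ := by
  have : Fact (LocalGamma.IsNormalizedAbs F) := ⟨hF⟩
  -- With ρ the exponent of χ, Re(s) > 1/2 - ρ gives absolute convergence at 0 and puts both s + 1/2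
  -- and 2s in the range where Gauss integrals invert the γ-factors.
  refine ⟨1 / 2 - LocalGamma.charExp χ, fun ψ hψ hψ1 => ?_⟩
  obtain ⟨c, hc⟩ := LocalGamma.exists_hasCondExp hψ hψ1
  obtain ⟨e, he, heq⟩ := LocalGamma.exists_two_mem_shell F
  -- Chosen so that -M ≤ c - max(2e+1, m(χ)), the stable range; for unramified ψ, c = 0.
  refine ⟨(max (2 * (e : ℤ) + 1) (LocalGamma.conductor χ : ℤ) - c).toNat, fun hun => ?_,
    fun M hM s hs => ?_⟩
  · obtain rfl := hc.unique hun.hasCondExp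
    have h : (max (2 * (e : ℤ) + 1) (LocalGamma.conductor χ : ℤ) - 0).toNat =
        max (2 * e + 1) (LocalGamma.conductor χ) := by omega
    rw [h, heq]; push_cast; rfl
  · have hint := hc.integrableOn_mul_self
      (hc.integrableOn_weilTwist χ (s := s) (by linarith) (-(M : ℤ)))
    obtain ⟨hne, h⟩ := hc.weilGauss_eq χ he (s := s) (by linarith) (n := -(M : ℤ)) (by omega)
    -- Normalizing the Weil index puts γ_F(ψ) in front of the integral; it equals the inverse of
    -- γ_F(ψ_{-1}).
    have hγ : LocalGamma.weilIndex ψ = (LocalGamma.weilIndex (ψ.mulShift (-1)))⁻¹ := by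
      have h1 := hc.weilIndex_mul_neg (one_ne_zero (α := F))
      rw [AddChar.mulShift_one] at h1
      exact eq_inv_of_mul_eq_one_left h1
    refine ⟨?_, hne, ?_⟩
    · refine (hint.const_mul (LocalGamma.weilIndex ψ)).congr (Eventually.of_forall fun x => ?_)
      exact (LocalGamma.sweetIntegrand_eq χ x).symm
    · simp_rw [LocalGamma.sweetIntegrand_eq]
      rw [integral_const_mul, ← hγ]
      rw [LocalGamma.weilGauss] at h
      rw [h]; ring
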